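/- **Setting.** A finite LTS $G$ has a set of $n$ states, a finite set $\mathit{Act}\ni\tau$ of actions and a set of $m$ transitions $s\xrightarrow{a}t$. A partition of the states into *blocks* makes a $\tau$-transition *inert* if it stays inside a block; a state of a block is a *bottom state* if it has no outgoing inert transition. Running time is counted in elementary steps: every loop iteration, every single step of a coroutine, and every visit or move of one state or one transition costs one step; inserting a key into, or deleting it from, a (size-balanced) search tree costs the number of comparisons on the search path plus one. All choices left open by the algorithms (which splitter, which order of iteration, which transition to mark) are nondeterministic. *Splitting.* Both algorithms split a block $B$ under a set $T$ of transitions leaving $B$, some of which are marked, into the states $R$ that can reach the source of a transition of $T$ by inert transitions and the remaining states $U$. The sets $R$ and $U$ are computed by two coroutines that run in lockstep, by backward search along inert transitions; a coroutine is aborted when its set exceeds half of $B$, and the first one that finishes stops the other. Then the states of the smaller subblock and their incoming and outgoing transitions are moved. *GJKW17.* (1) Translate $G$ to the Kripke structure with the states of $G$, all labelled $\bot$, and an additional state $\langle a,t\rangle$, labelled $a$, for every visible action $a$ and every target $t$ of an $a$-transition; its transitions are $s\to\langle a,t\rangle\to t$ for $s\xrightarrow{a}t$ with $a\neq\tau$,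 and $s\to t$ for $s\xrightarrow{\tau}t$. (2) Contract the strongly connected components of equally labelled states; take as initial blocks the classes of equally labelled states, with states that can inertly reach a non-inert transition separated from the others; put all states in one *constellation*. (3) While some constellation $C$ contains several blocks, move a block $B'$ with $|B'|\le\frac12|C|$ from $C$ to a new constellation (``$B'$ is used as splitter'') and split all blocks with transitions to $B'$, first under $B'$ and then under $C\setminus B'$, and $B'$ itself under $C\setminus B'$. Whenever such a split into $R,U$ makes transitions $R\to U$ non-inert, the states of $R$ that can inertly reach one of them are separated as a block $N$, the constellations reachable from $N$ are inserted one by one into a balanced search tree, and the blocks concerned are split under the constellations in the tree, in order, new bottom states arising on the way being treated in the same manner. *JGKW19.* Works on $G$ itself, after contracting $\tau$-components, with a partition of the states (initially: states that can reach a visible transition by $\tau$-steps, and the others) and a partition of the non-inert transitions into *bunches* (initially one bunch). While some bunch $T$ contains several *action-block-slices* (nonempty sets of all transitions of $T$ with a given label and target block), one such slice with at most $\frac12|T|$ transitions is moved to its own bunch, and the blocks with transitions in both parts are split under both parts via a splitter list, transitions of the small slice and one transition per state of the other part being marked; newly non-inert $\tau$-transitions form a new bunch, and the block that contains new bottom states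 is put on the splitter list again for all bunches in which it has transitions. **Family.** For $k\in\mathbb N$ let $A_k$ be the LTS with states $s_0,s_1$, actions $\tau,a_0,\dots,a_k$ and transitions $s_1\xrightarrow{\tau}s_0$, $s_1\xrightarrow{a_0}s_1$ and, for $1\le i\le k$, $s_1\xrightarrow{a_i}s_0$ and $s_0\xrightarrow{a_i}s_0$. **Theorem.** 1. $A_k$ has $n=2$ states, $m=2k+2$ transitions and $|\mathit{Act}|=k+2$. 2. There are constants $c,C>0$ such that for all $k\ge2$: every execution of GJKW17 on $A_k$ terminates and takes at most $C\,k\log k$ steps; there are executions whose first $k$ splitters are the blocks $\{\langle a_i,s_0\rangle\}$, $1\le i\le k$, in some order; and every such execution takes at least $c\,k\log k$ and at least $c\,m(\log|\mathit{Act}|+\log n)$ steps. Thus the worst-case time of GJKW17 on $A_k$ is $\Theta(k\log k)$, and its bound $O(m(\log|\mathit{Act}|+\log n))$ is attained. 3. The time of GJKW17 is not $O(m\log n)$: there is no constant $C$ such that for all LTSs with $n\ge2$ and $n\le m+1$ every execution takes at most $C\,m\log n$ steps. 4. There is a constant $C>0$ such that for all $k\ge1$, JGKW19 has a complete execution on $A_k$,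 and every execution of JGKW19 on $A_k$ terminates and takes at most $C\,m$ steps. -/

import Mathlib

noncomputable section

open scoped Classical

/-! ### Nondeterministic algorithms with a step count -/

/-- A nondeterministic algorithm with result type `α`, given by its executions:
`p (some a) c` says that some complete execution returns `a` after `c` elementary steps, and
`p none c` says that some execution can be observed, unfinished, after `c` elementary steps.
A bound on the step counts of all executions, unfinished ones included, is a bound on the running
time that also excludes nontermination, since every loop iteration costs at least one step. -/
def Alg (α : Type) : Type := Option α → ℕ → Prop

namespace Alg

variable {α β σ ι : Type}

instance : Monad Alg where
  pure a := fun r c => c = 0 ∧ (r = none ∨ r = some a)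
  bind p f := fun r c =>
    (r = none ∧ p none c) ∨ ∃ a c₁ c₂, p (some a) c₁ ∧ f a r c₂ ∧ c = c₁ + c₂

/-- Spend `n` elementary steps. -/
def tick (n : ℕ) : Alg Unit := fun r c => (r = none ∧ c ≤ n) ∨ (r = some () ∧ c = n)

/-- Take an arbitrary element of `s`. -/
def pick (s : Set α) : Alg α := fun r c => c = 0 ∧ (r = none ∨ ∃ a ∈ s, r = some a)

/-- Executions of a loop: the body either continues with a new loop state or leaves the loop with a
result; starting an iteration costs one step. -/
inductive LoopExec (body : σ → Alg (σ ⊕ β)) : σ → Option β → ℕ → Prop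
  | start (s : σ) : LoopExec body s none 0
  | cut (s : σ) (c : ℕ) : body s none c → LoopExec body s none (1 + c)
  | next (s s' : σ) (r : Option β) (c c' : ℕ) :
      body s (some (Sum.inl s')) c → LoopExec body s' r c' → LoopExec body s r (1 + c + c')
  | done (s : σ) (b : β) (c : ℕ) :
      body s (some (Sum.inr b)) c → LoopExec body s (some b) (1 + c)

def loop (body : σ → Alg (σ ⊕ β)) (s : σ) : Alg β := LoopExec body s

def forList (body : ι → σ → Alg σ) : List ι → σ → Alg σ
  | [], s => pure s
  | i :: l, s => do
      tick 1
      let s' ← body i s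
      forList body l s'

/-- `for all i ∈ X do body i`, in an arbitrary order. -/
def forEach (X : Finset ι) (body : ι → σ → Alg σ) (s : σ) : Alg σ := do
  let l ← pick {l : List ι | (l : Multiset ι) = X.val}
  forList body l s

end Alg

open Alg

/-! ### Labelled transition systems -/

/-- A transition `(s, a, t)`. -/
abbrev Tr (S A : Type) : Type := S × A × S

/-- A finite labelled transition system; the set of actions is the type `A`. -/
structure LTS (S A : Type) where
  states : Finset S
  tau : A
  trans : Finset (Tr S A)
  trans_mem : ∀ e ∈ trans, e.1 ∈ states ∧ e.2.2 ∈ states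

namespace LTS

variable {S A : Type} (G : LTS S A)

/-- Outgoing transitions of a set of states. -/
def outT (X : Finset S) : Finset (Tr S A) := G.trans.filter fun e => e.1 ∈ X

/-- Incoming transitions of a set of states. -/
def inT (X : Finset S) : Finset (Tr S A) := G.trans.filter fun e => e.2.2 ∈ X

/-- The `τ`-transitions from `X` to `Y`. -/
def tauT (X Y : Finset S) : Finset (Tr S A) :=
  G.trans.filter fun e => e.2.1 = G.tau ∧ e.1 ∈ X ∧ e.2.2 ∈ Y

/-- The inert transitions inside the block `B`. -/
def inert (B : Finset S) : Finset (Tr S A) := G.tauT B B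

/-- The non-inert transitions that leave states of the block `B`. -/
def nonInert (B : Finset S) : Finset (Tr S A) := G.outT B \ G.inert B

/-- The bottom states of the block `B`. -/
def bottom (B : Finset S) : Finset S := B.filter fun s => ∀ e ∈ G.inert B, e.1 ≠ s

/-- The visible transitions. -/
def visible : Finset (Tr S A) := G.trans.filter fun e => e.2.1 ≠ G.tau

/-- The states of `B` that can reach, by inert transitions inside `B`, the source of a transition
in `T`. -/
def reachers (B : Finset S) (T : Finset (Tr S A)) : Finset S :=
  B.filter fun s => ∃ e ∈ T,
    Relation.ReflTransGen (fun u v => (u, G.tau, v) ∈ G.inert B) s e.1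

/-- Mutual reachability by `τ`-transitions that connect states related by `same`. -/
def sccSetoid (same : S → S → Prop) : Setoid S where
  r s t := Relation.ReflTransGen (fun u v => same u v ∧ (u, G.tau, v) ∈ G.trans) s t ∧
    Relation.ReflTransGen (fun u v => same u v ∧ (u, G.tau, v) ∈ G.trans) t s
  iseqv := ⟨fun _ => ⟨.refl, .refl⟩, fun h => ⟨h.2, h.1⟩,
    fun h h' => ⟨h.1.trans h'.1, h'.2.trans h.2⟩⟩

/-- A fixed representative of the strongly connected component of `s`. -/
def rep (same : S → S → Prop) (s : S) : S := (Quotient.mk (G.sccSetoid same) s).out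

/-- Contraction of every strongly connected component to one state without `τ`-loop. -/
def contract (same : S → S → Prop) : LTS S A where
  states := G.states.image (G.rep same)
  tau := G.tau
  trans := (G.trans.image fun e => (G.rep same e.1, e.2.1, G.rep same e.2.2)).filter
    fun e => ¬ (e.2.1 = G.tau ∧ e.1 = e.2.2)
  trans_mem := by
    intro e he
    obtain ⟨e', he', rfl⟩ := Finset.mem_image.1 (Finset.mem_filter.1 he).1
    exact ⟨Finset.mem_image_of_mem _ (G.trans_mem _ he').1,
      Finset.mem_image_of_mem _ (G.trans_mem _ he').2⟩

end LTS

/-- `M` consists of exactly one transition in `Y` for every state of `D` that has a transition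
in `Y`. -/
def IsMarking {S A : Type} (D : Finset S) (Y M : Finset (Tr S A)) : Prop :=
  M ⊆ Y ∧ (∀ e ∈ M, e.1 ∈ D) ∧
    ∀ s ∈ D, (∃ e ∈ Y, e.1 = s) → ∃! e, e ∈ M ∧ e.1 = s

/-- Replace the block `B` of a partition by the nonempty ones among `X` and `Y`. -/
def replaceBlock {S : Type} (P : Finset (Finset S)) (B X Y : Finset S) : Finset (Finset S) :=
  P.erase B ∪ ({X, Y} : Finset (Finset S)).erase ∅

/-! ### Splitting a block by two coroutines in lockstep -/

/-- Variables of the two coroutines. -/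
structure SplitState (S A : Type) where
  /-- states known to reach the splitter -/
  R : Finset S
  /-- states known not to reach the splitter -/
  U : Finset S
  /-- elements of `R` that the loop over `R` has already taken -/
  doneR : Finset S
  /-- elements of `U` that the loop over `U` has already taken -/
  doneU : Finset S
  /-- unmarked transitions of the splitter that the `R`-coroutine still has to visit -/
  todoT : Finset (Tr S A)
  /-- inert transitions into the current state of the `R`-coroutine, still to be visited -/
  inR : Finset (Tr S A)
  /-- inert transitions into the current state of the `U`-coroutine, still to be visited -/
  inU : Finset (Tr S A)
  /-- number of inert transitions not yet known to lead to `U` (`none`: undefined) -/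
  untested : S → Option ℕ
  /-- a state whose non-inert transitions are being tested one by one for membership in the
  splitter, with the transitions still to be tested -/
  slow : Option (S × Finset (Tr S A))
  /-- whether the `R`-coroutine has not been aborted -/
  liveR : Bool
  /-- whether the `U`-coroutine has not been aborted -/
  liveU : Bool

namespace LTS

variable {S A : Type} (G : LTS S A)

/-- One step of the coroutine that computes `U`. -/
def stepU (B : Finset S) (T : Finset (Tr S A)) (x : SplitState S A) :
    Alg (SplitState S A ⊕ (Finset S × Finset S)) :=
  match x.slow with
  | some (t, E) =>
      if E = ∅ then
        pure (.inl { x with U := insert t x.U, slow := none })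
      else do
        let e ← pick {e | e ∈ E}
        if e ∈ T then
          pure (.inl { x with slow := none })
        else
          pure (.inl { x with slow := some (t, E.erase e) })
  | none =>
      if x.inU ≠ ∅ then do
        let e ← pick {e | e ∈ x.inU}
        let t := e.1
        let y := { x with inU := x.inU.erase e }
        if t ∈ x.R then
          pure (.inl y)
        else
          let q := (x.untested t).getD ((G.inert B).filter fun f => f.1 = t).card - 1
          let z := { y with untested := Function.update x.untested t (some q) }
          if 0 < q then
            pure (.inl z)
          else if ¬ T.image (fun f => f.1) ⊆ x.R then
            pure (.inl { z with slow := some (t, (G.nonInert B).filter fun f => f.1 = t) })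
          else
            pure (.inl { z with U := insert t x.U })
      else if 2 * x.U.card ≤ B.card then
        if x.U \ x.doneU ≠ ∅ then do
          let s ← pick {s | s ∈ x.U \ x.doneU}
          pure (.inl { x with
            doneU := insert s x.doneU
            inU := (G.inert B).filter fun f => f.2.2 = s })
        else
          pure (.inr (B \ x.U, x.U))
      else
        pure (.inl { x with liveU := false })

/-- One step of the coroutine that computes `R`. -/
def stepR (B : Finset S) (x : SplitState S A) :
    Alg (SplitState S A ⊕ (Finset S × Finset S)) :=
  if x.todoT ≠ ∅ then do
    let e ← pick {e | e ∈ x.todoT}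
    pure (.inl { x with R := insert e.1 x.R, todoT := x.todoT.erase e })
  else if x.inR ≠ ∅ then do
    let e ← pick {e | e ∈ x.inR}
    pure (.inl { x with R := insert e.1 x.R, inR := x.inR.erase e })
  else if 2 * x.R.card ≤ B.card then
    if x.R \ x.doneR ≠ ∅ then do
      let s ← pick {s | s ∈ x.R \ x.doneR}
      pure (.inl { x with
        doneR := insert s x.doneR
        inR := (G.inert B).filter fun f => f.2.2 = s })
    else
      pure (.inr (x.R, B \ x.R))
  else
    pure (.inl { x with liveR := false })

/-- The two coroutines alternate; each step of either costs one. The first one that finishes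
without having been aborted delivers the result. -/
def lockstep (B : Finset S) (T : Finset (Tr S A)) (x : SplitState S A) :
    Alg (SplitState S A ⊕ (Finset S × Finset S)) := do
  let r ← if x.liveU = true then (do tick 1; G.stepU B T x) else pure (.inl x)
  match r with
  | .inr res => pure (.inr res)
  | .inl y => if y.liveR = true then (do tick 1; G.stepR B y) else pure (.inl y)

/-- `split(B, T)` with marked transitions `M ⊆ T`: the pair of the states of `B` that can inertly
reach a transition in `T` and the states that cannot. Visiting the marked transitions to
initialise `R` costs one step each. -/
def split (B : Finset S) (T M : Finset (Tr S A)) : Alg (Finset S × Finset S) := do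
  tick (M.card + 1)
  let R₀ := M.image fun e => e.1
  loop (G.lockstep B T)
    { R := R₀, U := G.bottom B \ R₀, doneR := ∅, doneU := ∅, todoT := T \ M, inR := ∅, inU := ∅,
      untested := fun _ => none, slow := none, liveR := true, liveU := true }

/-- `split`, followed by the update of the data structures: the states of the smaller subblock and
its incoming and outgoing transitions are moved, at one step each. -/
def splitBlock (B : Finset S) (T M : Finset (Tr S A)) : Alg (Finset S × Finset S) := do
  let (R, U) ← G.split B T M
  let X := if U.card ≤ R.card then U else R
  tick (X.card + (G.inT X).card + (G.outT X).card)
  pure (R, U)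

end LTS

/-! ### The algorithm that works on the LTS with a partition of transitions (JGKW19) -/

/-- An entry of the splitter list: an unstable block-bunch-slice, its marked transitions, and
whether it is a primary splitter. -/
structure Splitter (S A : Type) where
  slice : Finset (Tr S A)
  marked : Finset (Tr S A)
  primary : Prop

/-- Blocks (partition of the states), bunches (partition of the non-inert transitions), and the
splitter list. -/
structure JState (S A : Type) where
  blocks : Finset (Finset S)
  bunches : Finset (Finset (Tr S A))
  splitters : List (Splitter S A)

def Splitter.restrict {S A : Type} (p : Splitter S A) (X : Finset S) : Splitter S A where
  slice := p.slice.filter fun e => e.1 ∈ X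
  marked := p.marked.filter fun e => e.1 ∈ X
  primary := p.primary

/-- When a block is split into `X` and `Y`, its slices in the splitter list are split accordingly;
`o` tells which part comes first. -/
def splitSplitters {S A : Type} (X Y : Finset S) (o : Bool) (L : List (Splitter S A)) :
    List (Splitter S A) :=
  L.flatMap fun p =>
    if ∃ e ∈ p.slice, e.1 ∈ X ∪ Y then
      (if o then [p.restrict X, p.restrict Y] else [p.restrict Y, p.restrict X]).filter
        fun q => q.slice ≠ ∅
    else [p]

/-- The action-block-slices contained in the bunch `T`. -/
def actionBlockSlices {S A : Type} (P : Finset (Finset S)) (T : Finset (Tr S A)) :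
    Finset (Finset (Tr S A)) :=
  T.image fun e => T.filter fun f => f.2.1 = e.2.1 ∧ ∃ B ∈ P, f.2.2 ∈ B ∧ e.2.2 ∈ B

/-- The block-bunch-slices of the block `B`. -/
def blockBunchSlices {S A : Type} (Q : Finset (Finset (Tr S A))) (B : Finset S) :
    Finset (Finset (Tr S A)) :=
  (Q.image fun T => T.filter fun e => e.1 ∈ B).erase ∅

namespace LTS

variable {S A : Type} (G : LTS S A)

/-- Treatment of the block `R` when the transitions `R →τ U` have become non-inert. -/
def newBottomJ (R U : Finset S) (J : JState S A) : Alg (JState S A) := do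
  let E₀ := G.tauT R U
  tick E₀.card
  let (N, R') ← G.splitBlock R E₀ E₀
  let o ← pick (Set.univ : Set Bool)
  let L := splitSplitters N R' o J.splitters
  let Q := insert (E₀ ∪ G.tauT N R') J.bunches
  let slices := blockBunchSlices Q N
  tick (slices.card + (G.outT (G.bottom N)).card)
  let mk ← pick {mk : Finset (Tr S A) → Finset (Tr S A) |
    ∀ X ∈ slices, IsMarking (G.bottom N) X (mk X)}
  let new ← pick {l : List (Finset (Tr S A)) |
    (l : Multiset _) = (slices.filter fun X => ∀ p ∈ L, p.slice ≠ X).val}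
  pure
    { blocks := replaceBlock J.blocks R N R'
      bunches := Q
      splitters :=
        (L.map fun p =>
          if p.slice ∈ slices then ⟨p.slice, p.marked ∪ mk p.slice, False⟩ else p) ++
        new.map fun X => ⟨X, mk X, False⟩ }

/-- The second inner loop: the splitters are handled one by one, in the order of the list.
`Y` is the remainder of the bunch from which an action-block-slice has been split off. -/
def stabilize (Y : Finset (Tr S A)) : JState S A → Alg (JState S A) :=
  loop fun J =>
    match J.splitters with
    | [] => pure (.inr J)
    | p :: L => do
        let B ← pick {B | B ∈ J.blocks ∧ ∃ e ∈ p.slice, e.1 ∈ B}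
        let (R, U) ← G.splitBlock B p.slice p.marked
        let o ← pick (Set.univ : Set Bool)
        let L₁ := splitSplitters R U o L
        let L₂ := if p.primary then
            L₁.filter fun q => q.slice ≠ Y.filter fun e => e.1 ∈ U
          else L₁
        let J' : JState S A :=
          { blocks := replaceBlock J.blocks B R U, bunches := J.bunches, splitters := L₂ }
        if G.tauT R U ≠ ∅ then do
          let J'' ← G.newBottomJ R U J'
          pure (.inl J'')
        else
          pure (.inl J')

/-- The outer loop: while some bunch is nontrivial, split off a small action-block-slice and
restore stability. -/
def refineJ : JState S A → Alg (Finset (Finset S)) :=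
  loop fun J =>
    if ∃ T ∈ J.bunches, 1 < (actionBlockSlices J.blocks T).card then do
      let T ← pick {T | T ∈ J.bunches ∧ 1 < (actionBlockSlices J.blocks T).card}
      let X ← pick {X | X ∈ actionBlockSlices J.blocks T ∧ 2 * X.card ≤ T.card}
      tick X.card
      let Y := T \ X
      let splittable := J.blocks.filter fun B => (∃ e ∈ X, e.1 ∈ B) ∧ ∃ e ∈ Y, e.1 ∈ B
      let J₁ ← forEach splittable
        (fun B (J : JState S A) => do
          let XB := X.filter fun e => e.1 ∈ B
          let YB := Y.filter fun e => e.1 ∈ B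
          let M ← pick {M | IsMarking (XB.image fun e => e.1) YB M}
          tick (XB.card + M.card)
          pure { J with splitters := J.splitters ++ [⟨XB, XB, True⟩, ⟨YB, M, False⟩] })
        { J with bunches := insert X (insert Y (J.bunches.erase T)) }
      let J₂ ← G.stabilize Y J₁
      pure (.inl J₂)
    else
      pure (.inr J.blocks)

/-- JGKW19: branching bisimulation partitioning that runs directly on the LTS. The contraction of
the `τ`-components, the computation of the states that can reach a visible transition, and the
bucket sort of the transitions are charged one step per state and transition. -/
def jgkw19 : Alg (Finset (Finset S)) := do
  tick (G.states.card + G.trans.card)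
  let H := G.contract fun _ _ => True
  tick (H.states.card + H.trans.card)
  let Bvis := H.reachers H.states H.visible
  let Binvis := H.states \ Bvis
  tick H.trans.card
  H.refineJ
    { blocks := ({Bvis, Binvis} : Finset (Finset S)).erase ∅
      bunches := ({H.visible ∪ H.tauT Bvis Binvis} : Finset (Finset (Tr S A))).erase ∅
      splitters := [] }

end LTS

/-! ### Kripke structures and the embedding of LTSs -/

/-- A finite Kripke structure. -/
structure Kripke (S AP : Type) where
  states : Finset S
  trans : Finset (S × S)
  label : S → Set AP
  trans_mem : ∀ e ∈ trans, e.1 ∈ states ∧ e.2 ∈ states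

/-- A Kripke structure seen as a transition graph in which every transition is internal. -/
def Kripke.graph {S AP : Type} (K : Kripke S AP) : LTS S Unit where
  states := K.states
  tau := ()
  trans := K.trans.image fun e => (e.1, (), e.2)
  trans_mem := by
    intro e he
    obtain ⟨e', he', rfl⟩ := Finset.mem_image.1 he
    exact K.trans_mem _ he'

/-- The embedding of an LTS: an extra state `⟨a, t⟩` for every visible action `a` and state `t` that
is the target of an `a`-transition; `none` is the atomic proposition `⊥` of the original
states. -/
def LTS.embed {S A : Type} (G : LTS S A) : Kripke (S ⊕ (A × S)) (Option A) where
  states := G.states.image Sum.inl ∪ G.visible.image fun e => Sum.inr e.2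
  trans :=
    (G.visible.image fun e => (Sum.inl e.1, Sum.inr e.2)) ∪
    (G.visible.image fun e => (Sum.inr e.2, Sum.inl e.2.2)) ∪
    (G.tauT G.states G.states).image fun e => (Sum.inl e.1, Sum.inl e.2.2)
  label := fun x => match x with
    | Sum.inl _ => {none}
    | Sum.inr p => {some p.1}
  trans_mem := by
    intro e he
    simp only [LTS.visible, LTS.tauT, Finset.mem_union, Finset.mem_image, Finset.mem_filter] at he ⊢
    rcases he with (⟨f, ⟨hf, hv⟩, rfl⟩ | ⟨f, ⟨hf, hv⟩, rfl⟩) | ⟨f, ⟨hf, -⟩, rfl⟩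
    · exact ⟨.inl ⟨_, (G.trans_mem f hf).1, rfl⟩, .inr ⟨f, ⟨hf, hv⟩, rfl⟩⟩
    · exact ⟨.inr ⟨f, ⟨hf, hv⟩, rfl⟩, .inl ⟨_, (G.trans_mem f hf).2, rfl⟩⟩
    · exact ⟨.inl ⟨_, (G.trans_mem f hf).1, rfl⟩, .inl ⟨_, (G.trans_mem f hf).2, rfl⟩⟩

/-! ### The algorithm for stuttering equivalence, applied to the embedding (GJKW17) -/

/-- Number of comparisons made when searching `x` in a search tree, plus one; this is the time
charged for inserting or deleting `x`. -/
def searchSteps (x : ℕ) : Ordnode ℕ → ℕ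
  | .nil => 1
  | .node _ l y r =>
      if x < y then searchSteps x l + 1 else if y < x then searchSteps x r + 1 else 1

/-- Blocks, the size-balanced search tree of constellations to be handled, and the pairs
(block, constellation) whose transitions still need postprocessing. -/
structure PState (S : Type) where
  blocks : Finset (Finset S)
  tree : Ordnode ℕ
  pending : Finset (Finset S × ℕ)

/-- Blocks, constellations (identified by their position in the list), and the blocks used as
splitters so far, in the order of use. -/
structure KState (S : Type) where
  blocks : Finset (Finset S)
  cons : List (Finset S)
  trace : List (Finset S)

namespace LTS

variable {S : Type} (G : LTS S Unit) (cons : List (Finset S))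

/-- The non-inert transitions from the block `B` to the `i`-th constellation. -/
def toCons (B : Finset S) (i : ℕ) : Finset (Tr S Unit) :=
  (G.nonInert B).filter fun e => e.2.2 ∈ cons.getD i ∅

/-- The constellations reachable from the block `B`. -/
def reachCons (B : Finset S) : Finset ℕ :=
  (Finset.range cons.length).filter fun i => G.toCons cons B i ≠ ∅

/-- When the block `B` is split into `X` and `Y`, its pending slices are split accordingly. -/
def splitPending (B X Y : Finset S) (pend : Finset (Finset S × ℕ)) : Finset (Finset S × ℕ) :=
  (pend.filter fun p => p.1 ≠ B) ∪
    (((pend.filter fun p => p.1 = B).image fun p => (X, p.2)) ∪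
      ((pend.filter fun p => p.1 = B).image fun p => (Y, p.2))).filter
        fun p => G.toCons cons p.1 p.2 ≠ ∅

/-- The transitions `R → U` have become non-inert: separate from `R` the block `N` of the states
that can reach one of them, which contains the new bottom states; the constellations reachable from
`N` are inserted into the search tree one by one, and the transitions from `N` to them are
registered for postprocessing. Returns also `R \ N`. -/
def newBottomK (R U : Finset S) (x : PState S) : Alg (PState S × Finset S) := do
  let E₀ := G.tauT R U
  tick E₀.card
  let (N, R') ← G.splitBlock R E₀ E₀
  tick (G.outT (G.bottom N)).card
  let y ← forEach (G.reachCons cons N)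
    (fun i (y : PState S) => do
      tick (searchSteps i y.tree)
      pure { y with tree := Ordnode.insert i y.tree, pending := insert (N, i) y.pending })
    { blocks := replaceBlock x.blocks R N R'
      tree := x.tree
      pending := G.splitPending cons R N R' x.pending }
  pure (y, R')

/-- Stabilise the block `B` with respect to the `i`-th constellation. -/
def postStep (B : Finset S) (i : ℕ) (x : PState S) : Alg (PState S) := do
  let T := G.toCons cons B i
  let M ← pick {M | IsMarking (G.bottom B) T M}
  let (R, U) ← G.splitBlock B T M
  let y : PState S :=
    { blocks := replaceBlock x.blocks B R U
      tree := x.tree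
      pending := G.splitPending cons B R U (x.pending.erase (B, i)) }
  if G.tauT R U ≠ ∅ then do
    let (z, _) ← G.newBottomK cons R U y
    pure z
  else
    pure y

/-- Handle the constellations in the search tree, in order. -/
def postLoop : PState S → Alg (PState S) :=
  loop fun x =>
    match x.tree.findMin with
    | none => pure (.inr x)
    | some i => do
        let y ← loop
          (fun y : PState S =>
            if ∃ B, (B, i) ∈ y.pending then do
              let B ← pick {B | (B, i) ∈ y.pending}
              let z ← G.postStep cons B i y
              pure (.inl z)
            else pure (.inr y)) x
        tick (searchSteps i y.tree)
        pure (.inl { y with tree := Ordnode.erase i y.tree })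

/-- Postprocessing after a split into `R` and `U`: if there are new bottom states, stability is
reassessed. Returns the new partition and the part of `R` with the old bottom states. -/
def postprocess (P : Finset (Finset S)) (R U : Finset S) :
    Alg (Finset (Finset S) × Finset S) :=
  if G.tauT R U ≠ ∅ then do
    let (x, R') ← G.newBottomK cons R U { blocks := P, tree := Ordnode.nil, pending := ∅ }
    let y ← G.postLoop cons x
    pure (y.blocks, R')
  else
    pure (P, R)

/-- Split the block `B` with respect to `T` (marked transitions `M`) and postprocess. -/
def refineBlock (P : Finset (Finset S)) (B : Finset S) (T M : Finset (Tr S Unit)) :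
    Alg (Finset (Finset S) × Finset S) := do
  let (R, U) ← G.splitBlock B T M
  G.postprocess cons (replaceBlock P B R U) R U

/-- Refine the block `D`, which has a transition to the splitter `SpB`, first with respect to `SpB`
and then with respect to the rest `C` of the constellation from which `SpB` has been removed. -/
def refineUnder (SpB C D : Finset S) (P : Finset (Finset S)) : Alg (Finset (Finset S)) := do
  let T₁ := (G.outT D).filter fun e => e.2.2 ∈ SpB
  let M ← pick {M | IsMarking (T₁.image fun e => e.1)
    ((G.nonInert D).filter fun e => e.2.2 ∈ C) M}
  tick (T₁.card + M.card)
  let (P₁, R) ← G.refineBlock cons P D T₁ T₁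
  let T₂ := (G.nonInert R).filter fun e => e.2.2 ∈ C
  if T₂ ≠ ∅ then do
    let (P₂, _) ← G.refineBlock cons P₁ R T₂ (M ∩ T₂)
    pure P₂
  else
    pure P₁

end LTS

namespace Kripke

variable {S AP : Type} (K : Kripke S AP)

/-- The initial blocks: states are grouped by label, and states that can inertly reach a non-inert
transition are separated from the others. -/
def initialBlocks (G : LTS S Unit) : Finset (Finset S) :=
  ((G.states.image fun s => G.states.filter fun t => K.label t = K.label s).biUnion
    fun B => {G.reachers B (G.nonInert B), B \ G.reachers B (G.nonInert B)}).erase ∅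

end Kripke

/-- The main loop: while some constellation contains several blocks, move a small block `SpB` from
it to a new constellation of its own and restore stability. -/
def LTS.refineK {S : Type} (G : LTS S Unit) :
    KState S → Alg (Finset (Finset S) × List (Finset S)) :=
  loop fun x =>
    if ∃ i < x.cons.length, 1 < (x.blocks.filter fun B => B ⊆ x.cons.getD i ∅).card then do
      let (i, SpB) ← pick {p : ℕ × Finset S | p.1 < x.cons.length ∧ p.2 ∈ x.blocks ∧
        p.2 ⊆ x.cons.getD p.1 ∅ ∧ 2 * p.2.card ≤ (x.cons.getD p.1 ∅).card}
      let C := x.cons.getD i ∅ \ SpB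
      let cons := x.cons.set i C ++ [SpB]
      tick (SpB.card + (G.inT SpB).card)
      let P₁ ← forEach
        (x.blocks.filter fun D => D ≠ SpB ∧ ∃ e ∈ G.inT SpB, e.1 ∈ D)
        (fun D P => G.refineUnder cons SpB C D P) x.blocks
      let T := (G.outT SpB).filter fun e => e.2.2 ∈ C
      tick (G.outT SpB).card
      let P₂ ← if T ≠ ∅ then (do
          let M ← pick {M | IsMarking (G.bottom SpB) T M}
          let (P₂, _) ← G.refineBlock cons P₁ SpB T M
          pure P₂)
        else pure P₁
      pure (.inl { blocks := P₂, cons := cons, trace := x.trace ++ [SpB] })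
    else
      pure (.inr (x.blocks, x.trace))

/-- GJKW17: translation to a Kripke structure, contraction of the strongly connected components of
states with equal labels, initial partition, one constellation containing all states, and partition
refinement. The result is the final partition of the states of the Kripke structure together with
the blocks that were used as splitters, in order. -/
def LTS.gjkw17 {S A : Type} (G : LTS S A) :
    Alg (Finset (Finset (S ⊕ (A × S))) × List (Finset (S ⊕ (A × S)))) := do
  let K := G.embed
  tick (G.states.card + G.trans.card)
  tick (K.states.card + K.trans.card)
  let H := K.graph.contract fun s t => K.label s = K.label t
  tick (H.states.card + H.trans.card)
  H.refineK { blocks := K.initialBlocks H, cons := [H.states], trace := [] }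

/-! ### The family of examples -/

/-- The LTS with states `s₀ = 0`, `s₁ = 1`, visible actions `a₀, …, a_k` and `τ = none`, and
transitions `s₁ →τ s₀`, `s₁ →a₀ s₁`, and `s₁ →aᵢ s₀`, `s₀ →aᵢ s₀` for `1 ≤ i ≤ k`. -/
def exampleLTS (k : ℕ) : LTS (Fin 2) (Option (Fin (k + 1))) where
  states := Finset.univ
  tau := none
  trans := {(1, none, 0), (1, some 0, 1)} ∪
    (Finset.univ.image fun i : Fin k => (1, some i.succ, 0)) ∪
    Finset.univ.image fun i : Fin k => (0, some i.succ, 0)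
  trans_mem := fun _ _ => ⟨Finset.mem_univ _, Finset.mem_univ _⟩

/-- The first `k` splitters are the blocks `{⟨aᵢ, s₀⟩}` for `1 ≤ i ≤ k`, in some order. -/
def HandlesFirst (k : ℕ) (trace : List (Finset (Fin 2 ⊕ (Option (Fin (k + 1)) × Fin 2)))) : Prop :=
  (trace.take k).Perm ((List.finRange k).map fun i => {Sum.inr (some i.succ, 0)})

end

/-! The states s₀ and s₁ of `A_k` differ only in s₁ →a₀ s₁, since every aᵢ with i ≥ 1 is enabled in
both and leads to s₀. In the embedding, s₁ alone has a transition to α 0 = ⟨a₀, s₁⟩, while both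
states have one to every α i = ⟨aᵢ, s₀⟩, i ≥ 1. Hence the block {s₀, s₁} is stable as long as the
constellation of α 0 contains some α i with i ≥ 1, and it is split at the moment this fails. No
other block is ever split, so the partition takes only two values, `coarse` and `fine`.

Lower bound for GJKW17. If all α i with i ≥ 1 are used as splitters first, each of them is a
constellation of its own when {s₀, s₁} is split. Then s₁ becomes a bottom state and reaches all k of
these constellations, which are inserted as new keys into a balanced tree. An unsuccessful search in
a tree with j keys takes at least log₄(j + 1) steps (`size_lt_four_pow_searchSteps`), so the product
over all insertions gives k! ≤ 4^t (`LTS.total_insertAll`, `IsExampleGraph.factorial_le`), and k^k ≤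
(k!)² turns this into t ≥ (k log k)/4. Since n = 2 is constant, no bound of order m log n can hold.

Upper bound for GJKW17. No block is used twice as splitter (`MainInvariant.fresh`), and an iteration
without split costs a constant plus a multiple of the number of transitions at the splitter
(`LTS.total_iteration_of_bottom`). These weights sum to O(k). The only split is paid for once; it
takes O(k) tree operations of O(log k) steps each (`LTS.total_refineBlock_pair`). The function
`potential` adds up both contributions.

JGKW19. In `A_k` the label of a transition determines its target, so an action-block-slice consists
of all transitions of a bunch with one label. It has at most two transitions, and there are at most
k + 2 bunches. An iteration without split takes constant time, the unique split takes O(m) without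
any search tree, and the number of bunches grows in every iteration
(`IsExampleLTS.total_iterationJ`).

All these arguments are carried out with the predicate `Total`, which combines a time bound for
finished and unfinished executions, a postcondition that may mention the time spent, and the
existence of a complete execution. -/

noncomputable section

open scoped Classical

open Alg

/-! ### Reasoning about executions -/

namespace Alg

variable {α β σ ι : Type}

/-- Every execution of `p`, finished or not, takes at most `n` steps, some execution is complete,
and `Q a c` holds for every result `a` obtained after `c` steps. -/
def Total (p : Alg α) (n : ℕ) (Q : α → ℕ → Prop) : Prop :=
  (∀ c, p none c → c ≤ n) ∧ (∀ a c, p (some a) c → c ≤ n ∧ Q a c) ∧ ∃ a c, p (some a) c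

theorem Total.mono {p : Alg α} {n n' : ℕ} {Q Q' : α → ℕ → Prop} (h : Total p n Q) (hn : n ≤ n')
    (hQ : ∀ a c, c ≤ n → Q a c → Q' a c) : Total p n' Q' :=
  ⟨fun c hc => (h.1 c hc).trans hn,
    fun a c hc => ⟨(h.2.1 a c hc).1.trans hn, hQ a c (h.2.1 a c hc).1 (h.2.1 a c hc).2⟩, h.2.2⟩

theorem Total.weaken {p : Alg α} {n n' : ℕ} {Q : α → ℕ → Prop} (h : Total p n Q) (hn : n ≤ n') :
    Total p n' Q :=
  h.mono hn fun _ _ _ h => h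

theorem Total.le {p : Alg α} {n : ℕ} {Q : α → ℕ → Prop} (h : Total p n Q) {r : Option α} {c : ℕ}
    (hc : p r c) : c ≤ n := by
  cases r with
  | none => exact h.1 c hc
  | some a => exact (h.2.1 a c hc).1

theorem Total.bind {p : Alg α} {f : α → Alg β} {n n' : ℕ} {Q : α → ℕ → Prop} {Q' : β → ℕ → Prop}
    (hp : Total p n Q)
    (hf : ∀ a c, Q a c → Total (f a) n' fun b c' => Q' b (c + c')) :
    Total (p >>= f) (n + n') Q' := by
  refine ⟨?_, ?_, ?_⟩
  · rintro c (⟨-, h⟩ | ⟨a, c₁, c₂, h₁, h₂, rfl⟩)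
    · exact (hp.1 c h).trans (Nat.le_add_right _ _)
    · obtain ⟨h, hQ⟩ := hp.2.1 a c₁ h₁
      exact Nat.add_le_add h ((hf a c₁ hQ).1 c₂ h₂)
  · rintro b c (⟨h, -⟩ | ⟨a, c₁, c₂, h₁, h₂, rfl⟩)
    · cases h
    · obtain ⟨h, hQ⟩ := hp.2.1 a c₁ h₁
      obtain ⟨h', hQ'⟩ := (hf a c₁ hQ).2.1 b c₂ h₂
      exact ⟨Nat.add_le_add h h', hQ'⟩
  · obtain ⟨a, c₁, h₁⟩ := hp.2.2
    obtain ⟨b, c₂, h₂⟩ := (hf a c₁ (hp.2.1 a c₁ h₁).2).2.2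
    exact ⟨b, c₁ + c₂, Or.inr ⟨a, c₁, c₂, h₁, h₂, rfl⟩⟩

theorem Total.pure {a : α} {n : ℕ} {Q : α → ℕ → Prop} (h : Q a 0) :
    Total (pure a : Alg α) n Q := by
  refine ⟨?_, ?_, a, 0, rfl, Or.inr rfl⟩
  · rintro c ⟨rfl, -⟩
    exact Nat.zero_le _
  · rintro b c ⟨rfl, h' | h'⟩
    · cases h'
    · cases h'
      exact ⟨Nat.zero_le _, h⟩

theorem total_tick (n : ℕ) : Total (tick n) n fun _ c => c = n := by
  refine ⟨?_, ?_, (), n, Or.inr ⟨rfl, rfl⟩⟩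
  · rintro c (⟨-, h⟩ | ⟨h, -⟩)
    · exact h
    · cases h
  · rintro a c (⟨h, -⟩ | ⟨-, rfl⟩)
    · cases h
    · exact ⟨le_rfl, rfl⟩

theorem Total.tick_bind {f : Unit → Alg β} {n n' : ℕ} {Q : β → ℕ → Prop}
    (hf : Total (f ()) n' fun b c => Q b (n + c)) : Total (tick n >>= f) (n + n') Q :=
  (total_tick n).bind fun _ _ hc => hc ▸ hf

/-- Nonemptiness of `s` serves the last clause of `Total`: with nothing to choose, an execution
would be stuck, although the time bound would hold vacuously. -/
theorem Total.pick_bind {s : Set α} {f : α → Alg β} {n : ℕ} {Q : β → ℕ → Prop}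
    (hs : s.Nonempty) (hf : ∀ a ∈ s, Total (f a) n Q) : Total (pick s >>= f) n Q := by
  have h : Total (pick s) 0 fun a c => a ∈ s ∧ c = 0 := by
    obtain ⟨a₀, h₀⟩ := hs
    refine ⟨?_, ?_, a₀, 0, rfl, Or.inr ⟨a₀, h₀, rfl⟩⟩
    · rintro c ⟨rfl, -⟩
      exact le_rfl
    · rintro a c ⟨rfl, h | ⟨b, hb, h⟩⟩
      · cases h
      · cases h
        exact ⟨le_rfl, hb, rfl⟩
  refine (h.bind (n' := n) (Q' := Q) ?_).mono (Nat.zero_add n).le fun _ _ _ h => h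
  rintro a c ⟨ha, rfl⟩
  simpa using hf a ha

/-- One iteration of a loop. -/
theorem Total.loop_step {body : σ → Alg (σ ⊕ β)} {s : σ} {n n' : ℕ} {Q' : σ ⊕ β → ℕ → Prop}
    {Q : β → ℕ → Prop} (hb : Total (body s) n Q')
    (hnext : ∀ s' c, Q' (.inl s') c → Total (loop body s') n' fun b c' => Q b (1 + c + c'))
    (hdone : ∀ b c, Q' (.inr b) c → Q b (1 + c)) : Total (loop body s) (1 + n + n') Q := by
  refine ⟨?_, ?_, ?_⟩
  · intro c h
    cases h with
    | start => omega
    | cut _ c h => have := hb.1 _ h; omega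
    | next _ s' _ c c' h h' =>
      obtain ⟨h₁, h₂⟩ := hb.2.1 _ _ h
      have := (hnext s' c h₂).1 c' h'
      omega
  · intro b c h
    cases h with
    | next _ s' _ c c' h h' =>
      obtain ⟨h₁, h₂⟩ := hb.2.1 _ _ h
      obtain ⟨h₃, h₄⟩ := (hnext s' c h₂).2.1 b c' h'
      exact ⟨by omega, h₄⟩
    | done _ _ c h =>
      obtain ⟨h₁, h₂⟩ := hb.2.1 _ _ h
      exact ⟨by omega, hdone b c h₂⟩
  · obtain ⟨a, c, h⟩ := hb.2.2
    cases a with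
    | inl s' =>
      obtain ⟨b, c', h'⟩ := (hnext s' c (hb.2.1 _ _ h).2).2.2
      exact ⟨b, _, .next s s' _ c c' h h'⟩
    | inr b => exact ⟨b, _, .done s b c h⟩

/-- A loop whose iterations are paid for by the decrease of a potential `P`. -/
theorem total_loop {body : σ → Alg (σ ⊕ β)} (I : σ → Prop) (P : σ → ℕ) {Q : β → Prop}
    (h : ∀ s, I s → ∃ n, 1 + n ≤ P s ∧ Total (body s) n fun r c =>
      match r with
      | .inl s' => I s' ∧ 1 + c + P s' ≤ P s
      | .inr b => Q b)
    (s : σ) (hs : I s) : Total (loop body s) (P s) fun b _ => Q b := by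
  -- The step charged for starting an iteration makes the potential drop strictly, so the induction
  -- also excludes infinite executions.
  induction hP : P s using Nat.strong_induction_on generalizing s with
  | _ m ih =>
    subst hP
    obtain ⟨n, hn, hb⟩ := h s hs
    have hnext : ∀ s' c, body s (some (.inl s')) c → 1 + c + P s' ≤ P s ∧
        Total (Alg.loop body s') (P s') fun b _ => Q b := fun s' c hc => by
      obtain ⟨-, hI, hle⟩ := hb.2.1 _ _ hc
      exact ⟨hle, ih (P s') (by omega) s' hI rfl⟩
    refine ⟨?_, ?_, ?_⟩
    · intro c hc
      cases hc with
      | start => omega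
      | cut _ c hc => have := hb.1 _ hc; omega
      | next _ s' _ c c' hc hc' =>
        obtain ⟨hle, ht⟩ := hnext s' c hc
        have := ht.1 c' hc'
        omega
    · intro b c hc
      cases hc with
      | next _ s' _ c c' hc hc' =>
        obtain ⟨hle, ht⟩ := hnext s' c hc
        obtain ⟨h₁, h₂⟩ := ht.2.1 b c' hc'
        exact ⟨by omega, h₂⟩
      | done _ _ c hc =>
        obtain ⟨h₁, h₂⟩ := hb.2.1 _ _ hc
        exact ⟨by omega, h₂⟩
    · obtain ⟨a, c, hc⟩ := hb.2.2
      cases a with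
      | inl s' =>
        obtain ⟨b, c', hc'⟩ := (hnext s' c hc).2.2.2
        exact ⟨b, _, .next s s' _ c c' hc hc'⟩
      | inr b => exact ⟨b, _, .done s b c hc⟩

/-- `total_loop` with a bound of the time of an iteration that depends on the loop state only. -/
theorem Total.loop {body : σ → Alg (σ ⊕ β)} (I : σ → Prop) (P : σ → ℕ) {Q : β → Prop}
    (h : ∀ s, I s → ∃ n, 1 + n ≤ P s ∧ Total (body s) n fun r _ =>
      match r with
      | .inl s' => I s' ∧ 1 + n + P s' ≤ P s
      | .inr b => Q b)
    (s : σ) (hs : I s) : Total (loop body s) (P s) fun b _ => Q b := by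
  refine total_loop I P (fun s hs => ?_) s hs
  obtain ⟨n, hn, hb⟩ := h s hs
  refine ⟨n, hn, hb.mono le_rfl ?_⟩
  rintro (s' | b) c hc hQ
  · exact ⟨hQ.1, le_trans (by omega) hQ.2⟩
  · exact hQ

/-- The invariant records the set of items already treated and the time spent so far. The time
argument makes lower bounds provable by the same induction as upper bounds, and the freshness of
each item lets the invariant count. -/
theorem total_forList [DecidableEq ι] {body : ι → σ → Alg σ} {b : ℕ} (I : Finset ι → σ → ℕ → Prop) :
    ∀ (l : List ι), l.Nodup → ∀ (D : Finset ι) (s : σ) (c : ℕ), (∀ i ∈ l, i ∉ D) → I D s c →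
      (∀ i ∈ l, ∀ D s c, i ∉ D → I D s c →
        Total (body i s) b fun s' c' => I (insert i D) s' (c + (1 + c'))) →
      Total (forList body l s) (l.length * (1 + b)) fun s' c' => I (D ∪ l.toFinset) s' (c + c')
  | [], _, D, s, c, _, hI, _ => Total.pure (by simpa using hI)
  | i :: l, hl, D, s, c, hD, hI, hb => by
    obtain ⟨hi, hl⟩ := List.nodup_cons.1 hl
    refine Total.mono (Total.tick_bind (n' := b + l.length * (1 + b))
      ((hb i (by simp) D s c (hD i (by simp)) hI).bind ?_)) ?_ fun _ _ _ h => h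
    · intro s' c' hI'
      refine (total_forList I l hl (insert i D) s' _ ?_ hI' fun j hj => hb j (by simp [hj])).mono
        le_rfl ?_
      · intro j hj hj'
        rcases Finset.mem_insert.1 hj' with rfl | h
        · exact hi hj
        · exact hD j (by simp [hj]) h
      · intro t c'' _ h
        have e : insert i D ∪ l.toFinset = D ∪ (i :: l).toFinset := by
          ext; simp
        rw [e] at h
        convert h using 1
        omega
    · simp only [List.length_cons]
      ring_nf
      omega

theorem total_forEach [DecidableEq ι] {X : Finset ι} {body : ι → σ → Alg σ} {b : ℕ}
    (I : Finset ι → σ → ℕ → Prop) (s : σ) (h₀ : I ∅ s 0)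
    (hb : ∀ i ∈ X, ∀ D s c, i ∉ D → I D s c →
      Total (body i s) b fun s' c' => I (insert i D) s' (c + (1 + c'))) :
    Total (forEach X body s) (X.card * (1 + b)) fun s' c => I X s' c := by
  refine Total.pick_bind ⟨X.toList, by simp⟩ fun l hl => ?_
  have hl : (l : Multiset ι) = X.val := hl
  have hm : ∀ i, i ∈ l ↔ i ∈ X := fun i => by
    rw [← Multiset.mem_coe, hl, Finset.mem_val]
  have hn : l.Nodup := by
    rw [← Multiset.coe_nodup, hl]; exact X.nodup
  have hc : l.length = X.card := by
    rw [← Multiset.coe_card, hl]; rfl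
  refine (total_forList I l hn ∅ s 0 (by simp) h₀ fun i hi => hb i ((hm i).1 hi)).mono
    (by rw [hc]) ?_
  intro s' c _ h
  have e : ∅ ∪ l.toFinset = X := by ext; simp [hm]
  rw [e] at h
  simpa using h

end Alg

/-! ### Search trees -/

namespace Ordnode

/-- Membership is decided by searching, so the order of the tree is needed: the leftmost key is
smaller than every key above it on its path, and the search for it always turns left. -/
theorem mem_of_findMin {t : Ordnode ℕ} (h : Valid t) {i : ℕ} (hi : t.findMin = some i) :
    i ∈ t := by
  have key : ∀ (t : Ordnode ℕ) (o₁ o₂), Valid' o₁ t o₂ → ∀ s l x r, t = node s l x r →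
      findMin' l x ∈ t := by
    intro t
    induction t with
    | nil => intro _ _ _ _ _ _ _ h; cases h
    | node s l x r ihl ihr =>
      rintro o₁ o₂ hv _ _ _ _ ⟨⟩
      change mem (findMin' l x) (node s l x r) = true
      cases l with
      | nil => simp [findMin', mem, cmpLE]
      | node s' l' x' r' =>
        have h₁ : findMin' l' x' ∈ node s' l' x' r' :=
          ihl _ _ hv.left _ _ _ _ rfl
        have h₂ : findMin' l' x' < x :=
          findMin'_all (P := (· < x)) l' x' hv.1.1.mem_lt.1 hv.1.1.mem_lt.2.1
        change mem (findMin' l' x') (node s (node s' l' x' r') x r) = true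
        rw [mem, cmpLE, if_pos h₂.le, if_neg h₂.not_ge]
        exact h₁
  cases t with
  | nil => cases hi
  | node s l x r =>
    simp only [findMin, Option.some.injEq] at hi
    subst hi
    exact key _ _ _ h _ _ _ _ rfl

/-- Validity, exact growth of the size by one, and preservation of `All` are proved in one
induction, because the lemmas on rebalancing need the validity and the new size of the modified
subtree. The exact size is what the lower bound counts with. -/
theorem insert_fresh_aux (x : ℕ) : ∀ {t : Ordnode ℕ} {o₁ o₂}, Valid' o₁ t o₂ →
    Bounded nil o₁ x → Bounded nil x o₂ → All (· ≠ x) t →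
    (Valid' o₁ (Ordnode.insert x t) o₂ ∧ size (Ordnode.insert x t) = size t + 1) ∧
      ∀ P : ℕ → Prop, All P t → P x → All P (Ordnode.insert x t)
  | nil, _, _, _, bl, br, _ => ⟨⟨valid'_singleton bl br, rfl⟩, fun P _ h => ⟨trivial, h, trivial⟩⟩
  | node sz l y r, o₁, o₂, h, bl, br, ha => by
    obtain ⟨hal, hy, har⟩ := ha
    rw [Ordnode.insert, cmpLE]
    split_ifs with h₁ h₂ <;> dsimp only
    · exact absurd (le_antisymm h₂ h₁) hy
    · obtain ⟨⟨vl, e⟩, hP⟩ := insert_fresh_aux x h.left bl (lt_of_le_not_ge h₁ h₂) hal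
      have H : (∃ l', Raised l' (size (Ordnode.insert x l)) ∧ BalancedSz l' (size r)) ∨
          ∃ r', Raised (size r) r' ∧ BalancedSz (size (Ordnode.insert x l)) r' :=
        Or.inl ⟨_, Or.inr e, h.3.1⟩
      refine ⟨⟨vl.balanceL h.right H, ?_⟩, fun P hPt hPx => ?_⟩
      · rw [size_balanceL vl.3 h.3.2.2 vl.2 h.2.2.2 H, h.2.size_eq, e]
        omega
      · rw [all_balanceL vl.3 h.3.2.2 vl.2 h.2.2.2 H]
        exact ⟨hP P hPt.1 hPx, hPt.2⟩
    · have hlt : y < x := not_le.1 h₁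
      obtain ⟨⟨vr, e⟩, hP⟩ := insert_fresh_aux x h.right hlt br har
      have H : (∃ l', Raised (size l) l' ∧ BalancedSz l' (size (Ordnode.insert x r))) ∨
          ∃ r', Raised r' (size (Ordnode.insert x r)) ∧ BalancedSz (size l) r' :=
        Or.inr ⟨_, Or.inr e, h.3.1⟩
      refine ⟨⟨h.left.balanceR vr H, ?_⟩, fun P hPt hPx => ?_⟩
      · rw [size_balanceR h.3.2.1 vr.3 h.2.2.1 vr.2 H, h.2.size_eq, e]
        omega
      · rw [all_balanceR h.3.2.1 vr.3 h.2.2.1 vr.2 H]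
        exact ⟨hPt.1, hPt.2.1, hP P hPt.2.2 hPx⟩

theorem size_insert_of_fresh {x : ℕ} {t : Ordnode ℕ} (h : Valid t) (hx : All (· ≠ x) t) :
    size (Ordnode.insert x t) = size t + 1 :=
  (insert_fresh_aux x h ⟨⟩ ⟨⟩ hx).1.2

theorem all_insert_of_fresh {x : ℕ} {t : Ordnode ℕ} (h : Valid t) (hx : All (· ≠ x) t)
    {P : ℕ → Prop} (ht : All P t) (hP : P x) : All P (Ordnode.insert x t) :=
  (insert_fresh_aux x h ⟨⟩ ⟨⟩ hx).2 P ht hP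

end Ordnode

/-! ### Logarithmic bounds for the cost of a search -/

/-- Searching in a balanced tree takes logarithmic time. -/
theorem four_pow_searchSteps_le (x : ℕ) : ∀ t : Ordnode ℕ, t.Sized → t.Balanced →
    4 ^ searchSteps x t ≤ 3 ^ searchSteps x t * (2 * (t.size + 1))
  | .nil, _, _ => by simp [searchSteps]
  | .node s l y r, hs, hb => by
    have hl := four_pow_searchSteps_le x l hs.2.1 hb.2.1
    have hr := four_pow_searchSteps_le x r hs.2.2 hb.2.2
    have hsz := hs.size_eq
    -- With balance factor `Ordnode.delta` = 3, a subtree has at most three quarters of the external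
    -- nodes (size plus one) of the tree.
    have h₁ : 4 * (l.size + 1) ≤ 3 * (s + 1) ∧ 4 * (r.size + 1) ≤ 3 * (s + 1) := by
      have := hs.1
      rcases hb.1 with h | ⟨h, h'⟩
      · omega
      · simp only [Ordnode.delta] at h h'
        omega
    rw [searchSteps]
    simp only [Ordnode.size_node]
    split_ifs
    · rw [pow_succ, pow_succ]
      nlinarith [pow_pos (show 0 < 3 by norm_num) (searchSteps x l)]
    · rw [pow_succ, pow_succ]
      nlinarith [pow_pos (show 0 < 3 by norm_num) (searchSteps x r)]
    · omega

/-- Three steps of the search shrink the tree by a factor (4/3)³ = 64/27 > 2, so three steps are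
enough per binary digit; 54 ≤ 64 is this comparison without fractions. -/
theorem searchSteps_le (x : ℕ) {t : Ordnode ℕ} (h : t.Valid) {n : ℕ} (hn : t.size ≤ n) :
    searchSteps x t ≤ 3 * Nat.log 2 (2 * (n + 1)) + 2 := by
  by_contra! hlt
  set q := Nat.log 2 (2 * (n + 1)) + 1 with hq
  have h₁ : 2 * (n + 1) < 2 ^ q := Nat.lt_pow_succ_log_self (by norm_num) _
  obtain ⟨d, hd⟩ := Nat.exists_eq_add_of_le (show 3 * q ≤ searchSteps x t by omega)
  have h₂ := four_pow_searchSteps_le x t h.2 h.3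
  rw [hd, pow_add, pow_add, pow_mul, pow_mul] at h₂
  norm_num at h₂
  have h₃ : 54 ^ q ≤ 64 ^ q := Nat.pow_le_pow_left (by norm_num) q
  have h₄ : (54 : ℕ) ^ q = 27 ^ q * 2 ^ q := by rw [← mul_pow]; norm_num
  have h₅ : 3 ^ d ≤ 4 ^ d := Nat.pow_le_pow_left (by norm_num) d
  have h₆ : 27 ^ q * 3 ^ d * (2 * (t.size + 1)) < 27 ^ q * 3 ^ d * 2 ^ q :=
    Nat.mul_lt_mul_of_pos_left (by omega) (by positivity)
  have h₇ : 27 ^ q * 3 ^ d * 2 ^ q ≤ 64 ^ q * 4 ^ d := by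
    calc 27 ^ q * 3 ^ d * 2 ^ q = 54 ^ q * 3 ^ d := by rw [h₄]; ring
      _ ≤ _ := Nat.mul_le_mul h₃ h₅
  omega

/-- An unsuccessful search in a balanced tree takes at least logarithmic time. -/
theorem size_lt_four_pow_searchSteps (x : ℕ) : ∀ t : Ordnode ℕ, t.Sized → t.Balanced →
    t.All (· ≠ x) → t.size + 1 ≤ 4 ^ searchSteps x t
  | .nil, _, _, _ => by simp [searchSteps]
  | .node s l y r, hs, hb, ha => by
    have hl := size_lt_four_pow_searchSteps x l hs.2.1 hb.2.1 ha.1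
    have hr := size_lt_four_pow_searchSteps x r hs.2.2 hb.2.2 ha.2.2
    have hy : y ≠ x := ha.2.1
    -- The same balance condition read in the other direction: each subtree keeps at least a quarter
    -- of the external nodes.
    have h₁ : s + 1 ≤ 4 * (l.size + 1) ∧ s + 1 ≤ 4 * (r.size + 1) := by
      have := hs.1
      rcases hb.1 with h | ⟨h, h'⟩
      · omega
      · simp only [Ordnode.delta] at h h'
        omega
    rw [searchSteps]
    simp only [Ordnode.size_node]
    split_ifs
    · rw [pow_succ]; omega
    · rw [pow_succ]; omega
    · omega

/-- Multiply n! by itself in reverse order: each of the n products (i + 1)(n − i) is at least n.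
This replaces Stirling's formula. -/
theorem pow_self_le_factorial_sq (n : ℕ) : n ^ n ≤ n.factorial ^ 2 := by
  have h : n.factorial ^ 2 = ∏ i ∈ Finset.range n, ((i + 1) * (n - i)) := by
    rw [Finset.prod_mul_distrib, Finset.prod_range_add_one_eq_factorial, sq]
    congr 1
    rw [← Finset.prod_range_add_one_eq_factorial, ← Finset.prod_range_reflect]
    refine Finset.prod_congr rfl fun i hi => ?_
    have := Finset.mem_range.1 hi
    omega
  calc n ^ n = ∏ _i ∈ Finset.range n, n := by simp
    _ ≤ _ := by
      rw [h]
      refine Finset.prod_le_prod' fun i hi => ?_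
      obtain ⟨d, hd⟩ := Nat.exists_eq_add_of_lt (Finset.mem_range.1 hi)
      have : n - i = d + 1 := by omega
      rw [this, hd]
      nlinarith [Nat.zero_le (i * d)]

/-! ### Splitting a block -/

/-! ### Markings -/

section Marking

variable {S A : Type}

theorem exists_isMarking (D : Finset S) (Y : Finset (Tr S A)) : ∃ M, IsMarking D Y M := by
  -- `Option` allows a choice for every state, also for those without a transition in `Y`.
  have h : ∀ s : S, ∃ e : Option (Tr S A), (∃ f ∈ Y, f.1 = s) → ∃ f ∈ Y, f.1 = s ∧ e = some f := by
    intro s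
    by_cases hs : ∃ f ∈ Y, f.1 = s
    · obtain ⟨f, hf, hs⟩ := hs
      exact ⟨some f, fun _ => ⟨f, hf, hs, rfl⟩⟩
    · exact ⟨none, fun h => absurd h hs⟩
  choose g hg using h
  refine ⟨Y.filter fun e => e.1 ∈ D ∧ g e.1 = some e, Finset.filter_subset _ _,
    fun e he => (Finset.mem_filter.1 he).2.1, fun s hs hY => ?_⟩
  obtain ⟨f, hf, rfl, he⟩ := hg s hY
  refine ⟨f, ⟨Finset.mem_filter.2 ⟨hf, hs, he⟩, rfl⟩, ?_⟩
  rintro f' ⟨hf', hs'⟩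
  have := (Finset.mem_filter.1 hf').2.2
  rw [hs', he] at this
  exact (Option.some.inj this).symm

variable {D : Finset S} {Y M : Finset (Tr S A)}

theorem IsMarking.exists_mem (h : IsMarking D Y M) {s : S} (hs : s ∈ D) (hY : ∃ e ∈ Y, e.1 = s) :
    ∃ e ∈ M, e.1 = s :=
  (h.2.2 s hs hY).exists

theorem IsMarking.card_le (h : IsMarking D Y M) : M.card ≤ D.card := by
  refine Finset.card_le_card_of_injOn (fun e => e.1) (fun e he => h.2.1 e he) ?_
  intro e he f hf hef
  exact (h.2.2 e.1 (h.2.1 e he) ⟨e, h.1 he, rfl⟩).unique ⟨he, rfl⟩ ⟨hf, hef.symm⟩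

end Marking

theorem replaceBlock_self {S : Type} {P : Finset (Finset S)} {B : Finset S} (hB : B ∈ P)
    (h₀ : B.Nonempty) : replaceBlock P B B ∅ = P := by
  ext X
  simp only [replaceBlock, Finset.mem_union, Finset.mem_erase, Finset.mem_insert,
    Finset.mem_singleton]
  constructor
  · rintro (⟨-, h⟩ | ⟨h, rfl | rfl⟩)
    · exact h
    · exact hB
    · exact absurd rfl h
  · intro h
    by_cases hX : X = B
    · subst hX
      exact Or.inr ⟨h₀.ne_empty, Or.inl rfl⟩
    · exact Or.inl ⟨hX, h⟩

namespace LTS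

variable {S A : Type} (G : LTS S A)

@[simp]
theorem mem_outT {X : Finset S} {e : Tr S A} : e ∈ G.outT X ↔ e ∈ G.trans ∧ e.1 ∈ X := by
  simp [outT]

@[simp]
theorem mem_inT {X : Finset S} {e : Tr S A} : e ∈ G.inT X ↔ e ∈ G.trans ∧ e.2.2 ∈ X := by
  simp [inT]

@[simp]
theorem mem_tauT {X Y : Finset S} {e : Tr S A} :
    e ∈ G.tauT X Y ↔ e ∈ G.trans ∧ e.2.1 = G.tau ∧ e.1 ∈ X ∧ e.2.2 ∈ Y := by
  simp [tauT]

@[simp]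
theorem mem_nonInert {B : Finset S} {e : Tr S A} :
    e ∈ G.nonInert B ↔ e ∈ G.trans ∧ e.1 ∈ B ∧ ¬ (e.2.1 = G.tau ∧ e.2.2 ∈ B) := by
  simp only [nonInert, inert, Finset.mem_sdiff, mem_outT, mem_tauT]
  tauto

@[simp]
theorem tauT_empty_right (X : Finset S) : G.tauT X ∅ = ∅ := by
  ext; simp

theorem mem_visible {e : Tr S A} : e ∈ G.visible ↔ e ∈ G.trans ∧ e.2.1 ≠ G.tau :=
  Finset.mem_filter

theorem outT_card_le (X : Finset S) : (G.outT X).card ≤ G.trans.card :=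
  Finset.card_le_card (Finset.filter_subset _ _)

theorem inT_card_le (X : Finset S) : (G.inT X).card ≤ G.trans.card :=
  Finset.card_le_card (Finset.filter_subset _ _)

theorem mem_bottom {B : Finset S} {s : S} :
    s ∈ G.bottom B ↔ s ∈ B ∧ ∀ e ∈ G.inert B, e.1 ≠ s := by
  simp [bottom]

/-- If all bottom states have a marked transition, then the block is not split, and this is found
out immediately. -/
theorem total_splitBlock_of_bottom {B : Finset S} {T M : Finset (Tr S A)}
    (h : ∀ s ∈ G.bottom B, ∃ e ∈ M, e.1 = s) :
    Total (G.splitBlock B T M) (M.card + 3) fun p _ => p = (B, ∅) := by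
  -- The `U`-coroutine starts with the unmarked bottom states. There are none here, so its first
  -- step already returns the empty set.
  have hU : G.bottom B \ (M.image fun e => e.1) = ∅ := by
    rw [Finset.sdiff_eq_empty_iff_subset]
    intro s hs
    obtain ⟨e, he, rfl⟩ := h s hs
    exact Finset.mem_image_of_mem _ he
  have hs : Total (G.split B T M) (M.card + 3) fun p _ => p = (B, ∅) := by
    refine (Total.tick_bind (n' := 1 + 1 + 0) ?_).weaken le_rfl
    refine Total.loop_step (Q' := fun r _ => r = .inr (B, ∅)) ?_ ?_ ?_
    · simp only [lockstep, hU, if_true]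
      refine Total.bind (n := 1) (n' := 0) (Q := fun r _ => r = .inr (B, ∅))
        (Total.tick_bind (n' := 0) ?_) ?_
      · simp only [stepU, ne_eq, not_true_eq_false, if_false, Finset.card_empty, mul_zero,
          Nat.zero_le, if_true, Finset.sdiff_empty]
        exact Total.pure rfl
      · rintro r c rfl
        exact Total.pure rfl
    · intro s' c h
      cases h
    · intro b c h
      exact Sum.inr.inj h
  refine Total.bind (n := M.card + 3) (n' := 0) hs ?_
  rintro _ c rfl
  simp only [Finset.card_empty, Nat.zero_le, if_true]
  refine Total.mono (Total.tick_bind (n' := 0) (Total.pure rfl)) ?_ fun _ _ _ h => h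
  have h₁ : G.inT ∅ = ∅ := by ext; simp
  have h₂ : G.outT ∅ = ∅ := by ext; simp
  simp [h₁, h₂]

/-- Splitting `{s₀, s₁}`, with the only inert transition `s₁ → s₀`, under a transition of `s₁`. -/
theorem total_splitBlock_pair {s₀ s₁ : S} (hne : s₀ ≠ s₁)
    (hin : G.inert {s₀, s₁} = {(s₁, G.tau, s₀)}) {e : Tr S A} (he : e.1 = s₁) :
    Total (G.splitBlock {s₀, s₁} {e} {e}) (9 + 2 * G.trans.card) fun p _ => p = ({s₁}, {s₀}) := by
  have hbot : G.bottom {s₀, s₁} \ {s₁} = {s₀} := by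
    ext s
    simp only [Finset.mem_sdiff, mem_bottom, hin, Finset.mem_insert, Finset.mem_singleton]
    constructor
    · rintro ⟨⟨h | h, -⟩, h'⟩
      · exact h
      · exact absurd h h'
    · rintro rfl
      exact ⟨⟨Or.inl rfl, by rintro _ rfl; exact hne.symm⟩, hne⟩
  have h2 : ({s₀, s₁} : Finset S).card = 2 := Finset.card_pair hne
  have hR : ({s₀, s₁} : Finset S) \ {s₁} = {s₀} := by
    ext s
    simp only [Finset.mem_sdiff, Finset.mem_insert, Finset.mem_singleton]
    constructor
    · rintro ⟨h | h, h'⟩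
      · exact h
      · exact absurd h h'
    · rintro rfl
      exact ⟨Or.inl rfl, hne⟩
  have hf₀ : (({(s₁, G.tau, s₀)} : Finset (Tr S A)).filter fun f => f.2.2 = s₀) =
      {(s₁, G.tau, s₀)} := by
    rw [Finset.filter_singleton, if_pos rfl]
  have hf₁ : (({(s₁, G.tau, s₀)} : Finset (Tr S A)).filter fun f => f.2.2 = s₁) = ∅ := by
    rw [Finset.filter_singleton, if_neg hne]
  -- Two steps for the initialisation and two rounds of 1 + 2 steps. In the first round the
  -- coroutines take s₀ and s₁; in the second the `U`-coroutine discards the inert transition from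
  -- s₁, which is in `R`, and the `R`-coroutine finishes. None is aborted, as one state is exactly
  -- half of the block.
  have hs : Total (G.split {s₀, s₁} {e} {e}) 8 fun p _ => p = ({s₁}, {s₀}) := by
    refine (Total.tick_bind (n' := 1 + 2 + (1 + 2 + 0)) ?_).weaken (by simp)
    simp only [Finset.image_singleton, he, hbot, sdiff_self, Finset.bot_eq_empty]
    refine Total.loop_step (Q' := fun r _ => r = Sum.inl (β := Finset S × Finset S)
        { R := {s₁}, U := {s₀}, doneR := {s₁}, doneU := {s₀}, todoT := ∅, inR := ∅,
          inU := {(s₁, G.tau, s₀)}, untested := fun _ => none, slow := none, liveR := true,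
          liveU := true }) ?_ ?_ ?_
    · simp only [lockstep, if_true]
      refine Total.bind (n := 1) (n' := 1) (Q := fun r _ => r = .inl
        { R := {s₁}, U := {s₀}, doneR := ∅, doneU := {s₀}, todoT := ∅, inR := ∅,
          inU := {(s₁, G.tau, s₀)}, untested := fun _ => none, slow := none, liveR := true,
          liveU := true })
        (Total.tick_bind (n' := 0) ?_) ?_
      · simp only [stepU, ne_eq, not_true_eq_false, if_false, Finset.card_singleton, h2, mul_one,
          le_refl, if_true, Finset.sdiff_empty, Finset.singleton_ne_empty, not_false_eq_true]
        refine Total.pick_bind ⟨s₀, by simp⟩ fun s hs => ?_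
        obtain rfl : s = s₀ := by simpa using hs
        refine Total.pure ?_
        simp [hin, hf₀]
      · rintro r c rfl
        refine Total.tick_bind (n' := 0) ?_
        simp only [stepR, ne_eq, not_true_eq_false, if_false, Finset.card_singleton, h2, mul_one,
          le_refl, if_true, Finset.sdiff_empty, Finset.singleton_ne_empty, not_false_eq_true]
        refine Total.pick_bind ⟨s₁, by simp⟩ fun s hs => ?_
        obtain rfl : s = s₁ := by simpa using hs
        refine Total.pure ?_
        simp [hin, hf₁]
    · rintro s' c h
      obtain rfl := Sum.inl.inj h
      refine Total.loop_step (Q' := fun r _ => r = .inr ({s₁}, {s₀})) ?_ ?_ ?_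
      · simp only [lockstep, if_true]
        refine Total.bind (n := 1) (n' := 1) (Q := fun r _ => r = .inl
          { R := {s₁}, U := {s₀}, doneR := {s₁}, doneU := {s₀}, todoT := ∅, inR := ∅,
            inU := ∅, untested := fun _ => none, slow := none, liveR := true,
            liveU := true })
          (Total.tick_bind (n' := 0) ?_) ?_
        · simp only [stepU, ne_eq, Finset.singleton_ne_empty, not_false_eq_true, if_true]
          refine Total.pick_bind ⟨(s₁, G.tau, s₀), by simp⟩ fun f hf => ?_
          obtain rfl : f = (s₁, G.tau, s₀) := by simpa using hf
          simp only [Finset.mem_singleton, if_true]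
          refine Total.pure ?_
          simp
        · rintro r c rfl
          refine Total.tick_bind (n' := 0) ?_
          simp only [stepR, ne_eq, not_true_eq_false, if_false, Finset.card_singleton, h2, mul_one,
            le_refl, if_true, sdiff_self, Finset.bot_eq_empty, hR]
          exact Total.pure rfl
      · intro s' c h
        cases h
      · intro b c h
        exact Sum.inr.inj h
    · intro b c h
      cases h
  refine (Total.bind (n := 8) (n' := 1 + 2 * G.trans.card) hs ?_).weaken (by omega)
  rintro _ c rfl
  refine Total.mono (Total.tick_bind (n' := 0) (Total.pure rfl)) ?_ fun _ _ _ h => h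
  -- Both parts have one state; the tie is resolved in favour of `U`, so s₀ is the state that is
  -- moved.
  have h₁ := G.inT_card_le {s₀}
  have h₂ := G.outT_card_le {s₀}
  simp
  omega

/-- The bottom states of a block that consists of one state without `τ`-loop. -/
theorem bottom_singleton {s : S} (h : (s, G.tau, s) ∉ G.trans) : G.bottom {s} = {s} := by
  ext t
  simp only [mem_bottom, inert, mem_tauT, Finset.mem_singleton]
  constructor
  · exact fun h => h.1
  · rintro rfl
    refine ⟨rfl, ?_⟩
    rintro ⟨u, a, v⟩ ⟨he, h₁, h₂, h₃⟩
    obtain rfl : a = G.tau := h₁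
    obtain rfl : u = t := h₂
    obtain rfl : v = u := h₃
    exact absurd he h

/-- The contraction does not change a system without nontrivial components and `τ`-loops. -/
theorem contract_eq {same : S → S → Prop}
    (h : ∀ s t, (G.sccSetoid same).r s t → s = t) (hl : ∀ s, (s, G.tau, s) ∉ G.trans) :
    G.contract same = G := by
  -- The representative is related to the state itself, hence equal to it; the filter in the
  -- contraction then finds no `τ`-loop to remove.
  have hr : ∀ s, G.rep same s = s := fun s => h _ _ (Quotient.mk_out (s := G.sccSetoid same) s)
  have h₁ : (G.contract same).states = G.states := by
    ext s; simp [contract, hr]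
  have h₂ : (G.contract same).trans = G.trans := by
    ext ⟨s, a, t⟩
    simp only [contract, hr, Finset.mem_filter, Finset.mem_image, not_and]
    constructor
    · rintro ⟨⟨e, he, h⟩, -⟩
      exact h ▸ he
    · intro he
      refine ⟨⟨_, he, rfl⟩, ?_⟩
      rintro rfl rfl
      exact hl _ he
  have h₃ : (G.contract same).tau = G.tau := rfl
  generalize G.contract same = H at h₁ h₂ h₃
  cases H; cases G
  simp_all

end LTS

/-! ### The parts of GJKW17 -/

namespace LTS

variable {S : Type} (G : LTS S Unit)

/-- With an empty `U`, no transition becomes non-inert, and postprocessing is skipped. -/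
theorem total_refineBlock_of_bottom (cons : List (Finset S)) {P : Finset (Finset S)}
    {B : Finset S} {T M : Finset (Tr S Unit)} (hB : B ∈ P) (h₀ : B.Nonempty)
    (h : ∀ s ∈ G.bottom B, ∃ e ∈ M, e.1 = s) :
    Total (G.refineBlock cons P B T M) (M.card + 3) fun p _ => p = (P, B) := by
  refine (G.total_splitBlock_of_bottom (T := T) h).bind (n' := 0) ?_
  rintro _ c rfl
  simp only [postprocess, tauT_empty_right, ne_eq, not_true_eq_false, if_false,
    replaceBlock_self hB h₀]
  exact Total.pure rfl

/-- Refinement of a block `D` that is not split. -/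
theorem total_refineUnder_of_bottom (cons : List (Finset S)) {P : Finset (Finset S)}
    {SpB C D : Finset S} (hD : D ∈ P) (h₀ : D.Nonempty)
    (h₁ : ∀ s ∈ G.bottom D, ∃ e ∈ (G.outT D).filter (fun e => e.2.2 ∈ SpB), e.1 = s)
    (h₂ : (G.nonInert D).filter (fun e => e.2.2 ∈ C) ≠ ∅ →
      ∀ s ∈ G.bottom D, ∃ e ∈ (G.nonInert D).filter (fun e => e.2.2 ∈ C), e.1 = s) :
    Total (G.refineUnder cons SpB C D P)
      (4 * ((G.outT D).filter fun e => e.2.2 ∈ SpB).card + 6) fun P' _ => P' = P := by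
  refine Total.pick_bind (exists_isMarking _ _) fun M hM => ?_
  have hM : IsMarking _ _ M := hM
  -- At most one transition is marked per state with a transition to the splitter. So the initial
  -- marking and both splits together cost at most 2 + 1 + 1 times the number of transitions to the
  -- splitter, plus 3 for each split.
  have hc : M.card ≤ ((G.outT D).filter fun e => e.2.2 ∈ SpB).card :=
    hM.card_le.trans Finset.card_image_le
  refine (Total.tick_bind 
    (n' := ((G.outT D).filter fun e => e.2.2 ∈ SpB).card + 3 + (M.card + 3)) ?_).weaken (by omega)
  refine (G.total_refineBlock_of_bottom cons hD h₀ h₁).bind ?_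
  rintro _ c rfl
  dsimp only
  split_ifs with hT₂
  · have hMT : M ∩ (G.nonInert D).filter (fun e => e.2.2 ∈ C) = M :=
      Finset.inter_eq_left.2 hM.1
    rw [hMT]
    refine Total.bind (n' := 0) (G.total_refineBlock_of_bottom cons hD h₀ fun s hs => ?_) ?_
    · refine hM.exists_mem ?_ (h₂ hT₂ s hs)
      obtain ⟨e, he, rfl⟩ := h₁ s hs
      exact Finset.mem_image_of_mem _ he
    · rintro _ c rfl
      exact Total.pure rfl
  · exact Total.pure rfl

/-- An iteration of the main loop in which `p.2 ⊆ x.cons.getD p.1 ∅` is used as splitter. -/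
def iteration (x : KState S) (p : ℕ × Finset S) :
    Alg (KState S ⊕ (Finset (Finset S) × List (Finset S))) := do
  let C := x.cons.getD p.1 ∅ \ p.2
  let cons := x.cons.set p.1 C ++ [p.2]
  tick (p.2.card + (G.inT p.2).card)
  let P₁ ← forEach
    (x.blocks.filter fun D => D ≠ p.2 ∧ ∃ e ∈ G.inT p.2, e.1 ∈ D)
    (fun D P => G.refineUnder cons p.2 C D P) x.blocks
  let T := (G.outT p.2).filter fun e => e.2.2 ∈ C
  tick (G.outT p.2).card
  let P₂ ← if T ≠ ∅ then (do
      let M ← pick {M | IsMarking (G.bottom p.2) T M}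
      let (P₂, _) ← G.refineBlock cons P₁ p.2 T M
      pure P₂)
    else pure P₁
  pure (.inl { blocks := P₂, cons := cons, trace := x.trace ++ [p.2] })

/-- The pairs of a constellation and a small block in it. -/
def smallBlocks (x : KState S) : Set (ℕ × Finset S) :=
  {p | p.1 < x.cons.length ∧ p.2 ∈ x.blocks ∧
    p.2 ⊆ x.cons.getD p.1 ∅ ∧ 2 * p.2.card ≤ (x.cons.getD p.1 ∅).card}

/-- The body of the main loop. -/
def bodyK (x : KState S) : Alg (KState S ⊕ (Finset (Finset S) × List (Finset S))) :=
  if ∃ i < x.cons.length, 1 < (x.blocks.filter fun B => B ⊆ x.cons.getD i ∅).card then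
    pick (smallBlocks x) >>= G.iteration x
  else
    pure (.inr (x.blocks, x.trace))

/-- Cutting the loop body after the choice of the splitter allows an iteration to be analysed for a
fixed splitter. -/
theorem refineK_eq : G.refineK = loop G.bodyK := rfl

/-- The state after an iteration that leaves the partition `P`. -/
def nextK (x : KState S) (p : ℕ × Finset S) (P : Finset (Finset S)) : KState S where
  blocks := P
  cons := x.cons.set p.1 (x.cons.getD p.1 ∅ \ p.2) ++ [p.2]
  trace := x.trace ++ [p.2]

/-- The time charged to the use of `b` as splitter. -/
def weight (b : Finset S) : ℕ := 24 * (G.inT b).card + (G.outT b).card + 8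

variable {G}

/-- There is only one label in a Kripke graph, so a transition is determined by its end points. -/
theorem card_filter_out_le {D X : Finset S} (hD : D.card ≤ 2) (hX : X.card ≤ 2) :
    ((G.outT D).filter fun e => e.2.2 ∈ X).card ≤ 4 := by
  have h : ((G.outT D).filter fun e => e.2.2 ∈ X) ⊆ D ×ˢ ({()} : Finset Unit) ×ˢ X := by
    rintro ⟨u, a, v⟩ he
    simp only [Finset.mem_filter, mem_outT] at he
    simp [he.1.2, he.2]
  refine (Finset.card_le_card h).trans ?_
  rw [Finset.card_product, Finset.card_product, Finset.card_singleton, one_mul]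
  exact Nat.mul_le_mul hD hX

/-- Distinct blocks are disjoint, so an incoming transition of the splitter belongs to the block of
its source only. Thus work per predecessor block can be charged to the incoming transitions. -/
theorem card_predecessors_le {P : Finset (Finset S)}
    (hd : ∀ B ∈ P, ∀ B' ∈ P, ∀ s, s ∈ B → s ∈ B' → B = B') (X : Finset S) :
    (P.filter fun D => D ≠ X ∧ ∃ e ∈ G.inT X, e.1 ∈ D).card ≤ (G.inT X).card := by
  refine Finset.card_le_card_of_forall_subsingleton (fun D e => e.1 ∈ D) ?_ ?_
  · intro D hD
    obtain ⟨e, he, h⟩ := (Finset.mem_filter.1 hD).2.2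
    exact ⟨e, he, h⟩
  · rintro e - D ⟨hD, h⟩ D' ⟨hD', h'⟩
    exact hd D (Finset.mem_filter.1 hD).1 D' (Finset.mem_filter.1 hD').1 e.1 h h'

/-- The last part of an iteration, in which the splitter is not split. -/
theorem total_refineSplitter {P : Finset (Finset S)} (cons : List (Finset S))
    {B : Finset S} {T : Finset (Tr S Unit)} (hB : B ∈ P) (h₀ : B.Nonempty) (h2 : B.card ≤ 2)
    (h : T ≠ ∅ → ∀ s ∈ G.bottom B, ∃ e ∈ T, e.1 = s) {α : Type} {f : Finset (Finset S) → Alg α}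
    {n : ℕ} {Q : α → ℕ → Prop} (hf : ∀ c, Total (f P) n fun b c' => Q b (c + c')) :
    Total (if T ≠ ∅ then ((do
        let M ← pick {M | IsMarking (G.bottom B) T M}
        let (P₂, _) ← G.refineBlock cons P B T M
        pure P₂) >>= f)
      else (pure P >>= f)) (5 + n) Q := by
  split_ifs with hT
  · refine Total.bind (Q := fun P' _ => P' = P)
      (Total.pick_bind (exists_isMarking _ _) fun M hM => ?_) ?_
    · have hM : IsMarking _ _ M := hM
      have hc : M.card ≤ 2 := hM.card_le.trans ((Finset.card_filter_le _ _).trans h2)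
      refine Total.weaken (Total.bind (n' := 0) (G.total_refineBlock_of_bottom cons hB h₀
        fun s hs => hM.exists_mem hs (h hT s hs)) ?_) (show M.card + 3 + 0 ≤ 5 by omega)
      rintro _ c rfl
      exact Total.pure rfl
    · rintro _ c rfl
      exact hf c
  · refine Total.bind (Q := fun P' _ => P' = P) (Total.pure rfl) ?_
    rintro _ c rfl
    exact hf c

/-- An iteration of the main loop in which no block is split. -/
theorem total_iteration_of_bottom {x : KState S} {p : ℕ × Finset S}
    (hd : ∀ B ∈ x.blocks, ∀ B' ∈ x.blocks, ∀ s, s ∈ B → s ∈ B' → B = B')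
    (h₀ : ∀ B ∈ x.blocks, B.Nonempty) (h2 : ∀ B ∈ x.blocks, B.card ≤ 2) (hp : p.2 ∈ x.blocks)
    (h : ∀ D ∈ x.blocks, D ≠ p.2 → (∃ e ∈ G.inT p.2, e.1 ∈ D) → ∀ s ∈ G.bottom D,
      (∃ e ∈ (G.outT D).filter (fun e => e.2.2 ∈ p.2), e.1 = s) ∧
      ((G.nonInert D).filter (fun e => e.2.2 ∈ x.cons.getD p.1 ∅ \ p.2) ≠ ∅ →
        ∃ e ∈ (G.nonInert D).filter (fun e => e.2.2 ∈ x.cons.getD p.1 ∅ \ p.2), e.1 = s))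
    (h' : (G.outT p.2).filter (fun e => e.2.2 ∈ x.cons.getD p.1 ∅ \ p.2) ≠ ∅ →
      ∀ s ∈ G.bottom p.2,
        ∃ e ∈ (G.outT p.2).filter (fun e => e.2.2 ∈ x.cons.getD p.1 ∅ \ p.2), e.1 = s) :
    1 + (G.weight p.2 - 1) = G.weight p.2 ∧
    Total (G.iteration x p) (G.weight p.2 - 1) fun r _ => r = .inl (nextK x p x.blocks) := by
  refine ⟨by simp only [weight]; omega, ?_⟩
  have hD := card_predecessors_le (G := G) hd p.2
  have hn := Nat.mul_le_mul_right (1 + 22) hD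
  -- This explains the constants in `weight`: each incoming transition is visited once and pays 1 +
  -- 22 for a predecessor block, where 22 = 4 · 4 + 6. The constant 8 consists of the start of the
  -- iteration, at most 2 states of the splitter, and 5 steps for refining the splitter itself.
  have hw : G.weight p.2 - 1 = (2 + (G.inT p.2).card) +
      ((G.inT p.2).card * (1 + 22) + ((G.outT p.2).card + (5 + 0))) := by
    simp only [weight]; omega
  rw [hw]
  refine Total.weaken (Total.tick_bind (Total.bind (total_forEach (b := 22)
    (fun _ P _ => P = x.blocks) x.blocks rfl ?_) ?_)) (Nat.add_le_add
      (Nat.add_le_add_right (h2 _ hp) _) (Nat.add_le_add_right hn _))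
  · rintro D hD _ P c - rfl
    obtain ⟨hD, hne, hin⟩ := Finset.mem_filter.1 hD
    refine Total.weaken (G.total_refineUnder_of_bottom _ hD (h₀ D hD)
      (fun s hs => (h D hD hne hin s hs).1) (fun hT s hs => (h D hD hne hin s hs).2 hT)) ?_
    have := card_filter_out_le (G := G) (h2 D hD) (h2 _ hp)
    omega
  · rintro _ c rfl
    exact Total.tick_bind (total_refineSplitter _ hp (h₀ _ hp) (h2 _ hp) h'
      fun _ => Total.pure rfl)

/-! #### Postprocessing of a single new bottom state -/

/-- The source of the factor log k, in both directions. All keys are new, so an insertion into a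
tree with d keys multiplies 4 ^ (time) by at least d + 1, and these factors build up the factorial;
the order of insertion does not matter. -/
theorem total_insertAll {N : Finset S} {R : Finset ℕ} {y : PState S} (hy : y.tree = .nil)
    (hp : y.pending = ∅) :
    Total (forEach R (fun i (y : PState S) => do
      tick (searchSteps i y.tree)
      pure { y with tree := Ordnode.insert i y.tree, pending := insert (N, i) y.pending }) y)
      (R.card * (1 + (3 * Nat.log 2 (2 * (R.card + 1)) + 2)))
      fun z c => z.blocks = y.blocks ∧ z.tree.Valid ∧ z.tree.size = R.card ∧
        (∀ p ∈ z.pending, p.1 = N ∧ p.2 ∈ R) ∧ R.card.factorial ≤ 4 ^ c := by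
  refine Total.mono (total_forEach (b := 3 * Nat.log 2 (2 * (R.card + 1)) + 2)
    (fun D z c => D ⊆ R ∧ z.blocks = y.blocks ∧ z.tree.Valid ∧ z.tree.size = D.card ∧
      z.tree.All (· ∈ D) ∧ (∀ p ∈ z.pending, p.1 = N ∧ p.2 ∈ R) ∧ D.card.factorial ≤ 4 ^ c)
    y ?_ ?_) le_rfl ?_
  · refine ⟨Finset.empty_subset _, rfl, ?_, ?_, ?_, ?_, ?_⟩
    · rw [hy]; exact Ordnode.valid_nil
    · rw [hy]; rfl
    · rw [hy]; trivial
    · simp [hp]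
    · simp
  · rintro i hi D z c hiD ⟨hDR, hb, hv, hsz, hall, hpe, hf⟩
    have hs : searchSteps i z.tree ≤ 3 * Nat.log 2 (2 * (R.card + 1)) + 2 :=
      searchSteps_le i hv (hsz.trans_le (Finset.card_le_card hDR))
    refine Total.weaken (Total.tick_bind (n' := 0) (Total.pure ?_)) hs
    have hfresh : z.tree.All (· ≠ i) := hall.imp fun a ha => by rintro rfl; exact hiD ha
    refine ⟨Finset.insert_subset hi hDR, hb, Ordnode.insert.valid i hv, ?_, ?_, ?_, ?_⟩
    · rw [Finset.card_insert_of_notMem hiD, ← hsz]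
      exact Ordnode.size_insert_of_fresh hv hfresh
    · exact Ordnode.all_insert_of_fresh hv hfresh
        (hall.imp fun a ha => Finset.mem_insert_of_mem ha) (Finset.mem_insert_self _ _)
    · intro p hp
      rcases Finset.mem_insert.1 hp with rfl | hp
      · exact ⟨rfl, hi⟩
      · exact hpe p hp
    · rw [Finset.card_insert_of_notMem hiD, Nat.factorial_succ]
      have h₁ := size_lt_four_pow_searchSteps i z.tree hv.2 hv.3 hfresh
      rw [hsz] at h₁
      calc (D.card + 1) * D.card.factorial ≤ 4 ^ searchSteps i z.tree * 4 ^ c :=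
            Nat.mul_le_mul h₁ hf
        _ = 4 ^ (c + searchSteps i z.tree) := by rw [← pow_add, add_comm]
        _ ≤ _ := Nat.pow_le_pow_right (by norm_num) (by omega)
  · rintro z c - ⟨-, h₁, h₂, h₃, -, h₄, h₅⟩
    exact ⟨h₁, h₂, h₃, h₄, h₅⟩

theorem mem_of_mem_splitPending {cons : List (Finset S)} {N : Finset S}
    {pend : Finset (Finset S × ℕ)} {p : Finset S × ℕ}
    (h : p ∈ G.splitPending cons N N ∅ pend) : p ∈ pend := by
  simp only [splitPending, Finset.mem_union, Finset.mem_filter, Finset.mem_image] at h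
  rcases h with ⟨h, -⟩ | ⟨⟨q, ⟨hq, rfl⟩, rfl⟩ | ⟨q, ⟨hq, rfl⟩, rfl⟩, h⟩
  · exact h
  · exact hq
  · refine absurd ?_ h
    ext e
    simp [toCons]

/-- The only state is a bottom state, and it has a marked transition because the slice is nonempty;
hence the block survives at a cost of 1 + 3 steps. -/
theorem total_postStep_singleton {cons : List (Finset S)} {s : S} {i : ℕ} {x : PState S}
    (hl : (s, G.tau, s) ∉ G.trans) (hb : {s} ∈ x.blocks) (hi : G.toCons cons {s} i ≠ ∅) :
    Total (G.postStep cons {s} i x) 4 fun y _ => y.blocks = x.blocks ∧ y.tree = x.tree ∧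
      ∀ p ∈ y.pending, p ∈ x.pending.erase ({s}, i) := by
  refine Total.pick_bind (exists_isMarking _ _) fun M hM => ?_
  have hM : IsMarking _ _ M := hM
  rw [G.bottom_singleton hl] at hM
  have hc : M.card ≤ 1 := hM.card_le
  refine Total.weaken (Total.bind (n' := 0) (G.total_splitBlock_of_bottom ?_) ?_)
    (show M.card + 3 + 0 ≤ 4 by omega)
  · rw [G.bottom_singleton hl]
    intro t ht
    refine hM.exists_mem ht ?_
    obtain ⟨e, he⟩ := Finset.nonempty_iff_ne_empty.2 hi
    have h₁ : e.1 = s := by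
      simp only [toCons, Finset.mem_filter, mem_nonInert, Finset.mem_singleton] at he
      exact he.1.2.1
    exact ⟨e, he, h₁.trans (Finset.mem_singleton.1 ht).symm⟩
  · rintro _ c rfl
    simp only [tauT_empty_right, ne_eq, not_true_eq_false, if_false,
      replaceBlock_self hb (Finset.singleton_nonempty s)]
    exact Total.pure ⟨rfl, rfl, fun p hp => mem_of_mem_splitPending hp⟩

/-- A block with one state cannot be split, so no key is ever added to the tree. Each key costs one
step of the outer loop, at most 6 for the inner loop, and a deletion in logarithmic time. -/
theorem total_postLoop_singleton {cons : List (Finset S)} {s : S} {x : PState S} {n : ℕ}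
    (hl : (s, G.tau, s) ∉ G.trans) (hb : {s} ∈ x.blocks) (hv : x.tree.Valid)
    (hn : x.tree.size ≤ n) (hp : ∀ p ∈ x.pending, p.1 = {s} ∧ G.toCons cons {s} p.2 ≠ ∅) :
    Total (G.postLoop cons x) (1 + n * (9 + 3 * Nat.log 2 (2 * (n + 1))))
      fun y _ => y.blocks = x.blocks := by
  set d := 3 * Nat.log 2 (2 * (n + 1)) + 2 with hd
  refine Total.weaken (Total.loop (Q := fun y : PState S => y.blocks = x.blocks)
    (fun y : PState S => y.blocks = x.blocks ∧ y.tree.Valid ∧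
      y.tree.size ≤ n ∧ ∀ p ∈ y.pending, p.1 = {s} ∧ G.toCons cons {s} p.2 ≠ ∅)
    (fun y => 1 + y.tree.size * (7 + d)) ?_ x ⟨rfl, hv, hn, hp⟩) ?_
  swap
  · have := Nat.mul_le_mul_right (7 + d) hn
    have e : 9 + 3 * Nat.log 2 (2 * (n + 1)) = 7 + d := by omega
    rw [e]
    exact Nat.add_le_add_left this 1
  rintro y ⟨hyb, hyv, hyn, hyp⟩
  cases hm : y.tree.findMin with
  | none =>
    refine ⟨0, by omega, ?_⟩
    exact Total.pure hyb
  | some i =>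
    have hmem : i ∈ y.tree := Ordnode.mem_of_findMin hyv hm
    have hpos : 0 < y.tree.size := Ordnode.pos_size_of_mem hyv.2 hmem
    have hle : 7 + d + (y.tree.size - 1) * (7 + d) = y.tree.size * (7 + d) := by
      conv_rhs => rw [← Nat.sub_add_cancel hpos]
      ring
    refine ⟨6 + (d + 0), by omega, ?_⟩
    refine Total.bind (Q := fun z _ => z.blocks = x.blocks ∧ z.tree = y.tree ∧
      ∀ p ∈ z.pending, p.1 = {s} ∧ G.toCons cons {s} p.2 ≠ ∅) ?_ ?_
    · refine Total.weaken (Total.loop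
        (Q := fun z : PState S => z.blocks = x.blocks ∧ z.tree = y.tree ∧
          ∀ p ∈ z.pending, p.1 = {s} ∧ G.toCons cons {s} p.2 ≠ ∅)
        (fun z : PState S => z.blocks = x.blocks ∧ z.tree = y.tree ∧
          ∀ p ∈ z.pending, p.1 = {s} ∧ G.toCons cons {s} p.2 ≠ ∅)
        -- Only the pair with block {s} can be pending for `i`. Handling it costs 1 + 4 steps and
        -- erases it; the remaining step is the final test.
        (fun z => 1 + if ({s}, i) ∈ z.pending then 5 else 0) ?_ y ⟨hyb, rfl, hyp⟩)
        (by split_ifs <;> omega)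
      rintro z ⟨hzb, hzt, hzp⟩
      by_cases hB : ∃ B, (B, i) ∈ z.pending
      · have hsi : ({s}, i) ∈ z.pending := by
          obtain ⟨B, hB⟩ := hB
          obtain rfl : B = {s} := (hzp _ hB).1
          exact hB
        refine ⟨4 + 0, by simp [hsi], ?_⟩
        simp only [if_pos hB]
        refine Total.pick_bind ⟨_, hsi⟩ fun B hB => ?_
        have hB : (B, i) ∈ z.pending := hB
        obtain ⟨rfl, hi⟩ : B = {s} ∧ G.toCons cons {s} i ≠ ∅ := hzp _ hB
        refine Total.bind (total_postStep_singleton hl (by rwa [hzb]) hi) ?_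
        rintro w c ⟨hwb, hwt, hwp⟩
        refine Total.pure ⟨⟨hwb.trans hzb, hwt.trans hzt, fun p hp =>
          hzp p (Finset.mem_of_mem_erase (hwp p hp))⟩, ?_⟩
        have h₁ : ({s}, i) ∉ w.pending := fun h => Finset.notMem_erase _ _ (hwp _ h)
        simp [hsi, h₁]
      · refine ⟨0, by omega, ?_⟩
        simp only [if_neg hB]
        exact Total.pure ⟨hzb, hzt, hzp⟩
    · rintro z c ⟨hzb, hzt, hzp⟩
      have hs : searchSteps i z.tree ≤ d := by
        rw [hzt]; exact searchSteps_le i hyv hyn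
      refine Total.weaken (Total.tick_bind (n' := 0) (Total.pure ?_)) (Nat.add_le_add_right hs 0)
      have hsz : (Ordnode.erase i y.tree).size = y.tree.size - 1 :=
        Ordnode.size_erase_of_mem hyv hmem
      simp only [hzt]
      refine ⟨⟨hzb, Ordnode.erase.valid i hyv, by omega, hzp⟩, ?_⟩
      rw [hsz]
      omega

/-- The time for splitting `{s₀, s₁}` and postprocessing with `n` constellations. -/
def splitTime (m n : ℕ) : ℕ :=
  3 * m + 15 + n * (12 + 6 * Nat.log 2 (2 * (n + 1)))

theorem splitTime_mono {m m' n n' : ℕ} (hm : m ≤ m') (hn : n ≤ n') :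
    splitTime m n ≤ splitTime m' n' := by
  unfold splitTime
  gcongr

/-- The block `{s₀, s₁}` is split into `{s₁}` and `{s₀}`, and `s₁` becomes a bottom state. -/
theorem total_refineBlock_pair {s₀ s₁ : S} (hne : s₀ ≠ s₁)
    (hin : G.inert {s₀, s₁} = {(s₁, G.tau, s₀)}) (hl : (s₁, G.tau, s₁) ∉ G.trans)
    {e : Tr S Unit} (he : e.1 = s₁) (cons : List (Finset S)) (P : Finset (Finset S)) :
    Total (G.refineBlock cons P {s₀, s₁} {e} {e}) (splitTime G.trans.card cons.length)
      fun p c => p = (replaceBlock P {s₀, s₁} {s₁} {s₀}, ∅) ∧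
        (G.reachCons cons {s₁}).card.factorial ≤ 4 ^ c := by
  set P' := replaceBlock P {s₀, s₁} {s₁} {s₀} with hP'
  have hs₁ : {s₁} ∈ P' := by simp [hP', replaceBlock]
  set R := G.reachCons cons {s₁} with hR
  have hRc : R.card ≤ cons.length :=
    (Finset.card_filter_le _ _).trans (Finset.card_range _).le
  have hE : G.tauT {s₁} {s₀} = {(s₁, G.tau, s₀)} := by
    have h₀ : (s₁, G.tau, s₀) ∈ G.inert {s₀, s₁} := by rw [hin]; exact Finset.mem_singleton_self _
    have h₁ : (s₁, G.tau, s₀) ∈ G.trans := (G.mem_tauT.1 h₀).1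
    ext ⟨u, a, v⟩
    simp only [mem_tauT, Finset.mem_singleton, Prod.mk.injEq]
    constructor
    · rintro ⟨-, h₂, h₃, h₄⟩
      exact ⟨h₃, h₂, h₄⟩
    · rintro ⟨rfl, -, rfl⟩
      exact ⟨h₁, trivial, rfl, rfl⟩
  set d := 3 * Nat.log 2 (2 * (cons.length + 1)) with hd
  have hlog : Nat.log 2 (2 * (R.card + 1)) ≤ Nat.log 2 (2 * (cons.length + 1)) :=
    Nat.log_mono_right (by omega)
  have hb₁ : R.card * (1 + (3 * Nat.log 2 (2 * (R.card + 1)) + 2)) ≤ cons.length * (3 + d) :=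
    Nat.mul_le_mul hRc (by omega)
  -- The summands are, in order: the split itself, the separation of the new bottom state (which
  -- takes the whole block {s₁}), the insertions into the tree, and the loop that empties the tree.
  have htime : splitTime G.trans.card cons.length = (9 + 2 * G.trans.card) +
      ((1 + ((1 + 3) + (G.trans.card + (cons.length * (3 + d) + 0)))) +
        ((1 + cons.length * (9 + d)) + 0)) := by
    simp only [splitTime, hd]
    ring
  rw [htime]
  refine (G.total_splitBlock_pair hne hin he).bind ?_
  rintro _ c₀ rfl
  have hE₀ : G.tauT {s₁} {s₀} ≠ ∅ := by rw [hE]; exact Finset.singleton_ne_empty _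
  simp only [postprocess, if_pos hE₀]
  refine Total.bind (Q := fun z c => z.2 = ∅ ∧ z.1.blocks = P' ∧ z.1.tree.Valid ∧
    z.1.tree.size = R.card ∧ (∀ p ∈ z.1.pending, p.1 = {s₁} ∧ p.2 ∈ R) ∧
    R.card.factorial ≤ 4 ^ c) ?_ ?_
  · rw [newBottomK, hE]
    refine Total.tick_bind (n := 1) (Total.bind (n := 1 + 3) (G.total_splitBlock_of_bottom ?_) ?_)
    · rw [G.bottom_singleton hl]
      intro t ht
      exact ⟨_, Finset.mem_singleton_self _, (Finset.mem_singleton.1 ht).symm⟩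
    · rintro _ c₁ rfl
      refine Total.weaken (Total.tick_bind (Total.bind (n' := 0) (total_insertAll rfl ?_) ?_))
        (Nat.add_le_add (G.outT_card_le _) (Nat.add_le_add_right hb₁ 0))
      · ext; simp [splitPending]
      · rintro z c₂ ⟨hzb, hzv, hzs, hzp, hzf⟩
        refine Total.pure ⟨rfl, ?_, hzv, hzs, hzp, hzf.trans ?_⟩
        · rw [hzb]
          exact replaceBlock_self hs₁ (Finset.singleton_nonempty _)
        · exact Nat.pow_le_pow_right (by norm_num) (by omega)
  · rintro ⟨z, R'⟩ c₁ ⟨hz, hzb, hzv, hzs, hzp, hzf⟩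
    obtain rfl : R' = ∅ := hz
    refine Total.bind (total_postLoop_singleton (n := cons.length) hl (by rwa [hzb]) hzv
      (hzs.trans_le hRc) fun p hp => ⟨(hzp p hp).1, ?_⟩) ?_
    · exact (Finset.mem_filter.1 (hzp p hp).2).2
    · rintro y c₂ hy
      refine Total.pure ⟨?_, hzf.trans (Nat.pow_le_pow_right (by norm_num) (by omega))⟩
      rw [hy, hzb]

end LTS

/-! ### GJKW17 on the family of examples -/

/-- The transition graph of the embedding of `A_k`: its states are the two original ones and the
states `α i = ⟨aᵢ, s₀⟩` (`⟨a₀, s₁⟩` for `i = 0`). -/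
structure IsExampleGraph {S : Type} (k : ℕ) (G : LTS S Unit) (s₀ s₁ : S) (α : Fin (k + 1) → S) :
    Prop where
  ne : s₀ ≠ s₁
  inj : Function.Injective α
  ne₀ : ∀ i, α i ≠ s₀
  ne₁ : ∀ i, α i ≠ s₁
  mem_states : ∀ s, s ∈ G.states ↔ s = s₀ ∨ s = s₁ ∨ ∃ i, s = α i
  mem_trans : ∀ e, e ∈ G.trans ↔ (e.1 = s₁ ∧ e.2.2 = s₀) ∨ (e.1 = s₁ ∧ ∃ i, e.2.2 = α i) ∨
    (e.1 = s₀ ∧ ∃ j : Fin k, e.2.2 = α j.succ) ∨ (∃ j : Fin k, e.1 = α j.succ ∧ e.2.2 = s₀) ∨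
    (e.1 = α 0 ∧ e.2.2 = s₁)

/-- The partition in which `s₀` and `s₁` are in one block. -/
def coarse {S : Type} {k : ℕ} (s₀ s₁ : S) (α : Fin (k + 1) → S) : Finset (Finset S) :=
  insert {s₀, s₁} (Finset.univ.image fun i => {α i})

/-- The partition into singletons. -/
def fine {S : Type} {k : ℕ} (s₀ s₁ : S) (α : Fin (k + 1) → S) : Finset (Finset S) :=
  insert {s₀} (insert {s₁} (Finset.univ.image fun i => {α i}))

/-! ### The two partitions that occur -/

section Partitions

variable {S : Type} {k : ℕ} {s₀ s₁ : S} {α : Fin (k + 1) → S} {B : Finset S}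

theorem mem_coarse : B ∈ coarse s₀ s₁ α ↔ B = {s₀, s₁} ∨ ∃ i, B = {α i} := by
  simp [coarse, eq_comm]

theorem mem_fine : B ∈ fine s₀ s₁ α ↔ B = {s₀} ∨ B = {s₁} ∨ ∃ i, B = {α i} := by
  simp [fine, eq_comm]

theorem exists_eq_singleton_of_mem_fine (h : B ∈ fine s₀ s₁ α) : ∃ s, B = {s} := by
  rcases mem_fine.1 h with h | h | ⟨i, h⟩
  · exact ⟨_, h⟩
  · exact ⟨_, h⟩
  · exact ⟨_, h⟩

theorem mem_insert_of_mem_coarse (h : B ∈ coarse s₀ s₁ α) :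
    B ∈ insert {s₀, s₁} (fine s₀ s₁ α) := by
  rcases mem_coarse.1 h with h | h
  · exact Finset.mem_insert.2 (Or.inl h)
  · exact Finset.mem_insert.2 (Or.inr (mem_fine.2 (Or.inr (Or.inr h))))

theorem card_splitters_le : (insert {s₀, s₁} (fine s₀ s₁ α)).card ≤ k + 4 := by
  have h₁ : (Finset.univ.image fun i => ({α i} : Finset S)).card ≤ k + 1 :=
    Finset.card_image_le.trans (by simp)
  have h₂ := Finset.card_insert_le ({s₁} : Finset S) (Finset.univ.image fun i => {α i})
  have h₃ := Finset.card_insert_le ({s₀} : Finset S)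
    (insert {s₁} (Finset.univ.image fun i => {α i}))
  have h₄ := Finset.card_insert_le ({s₀, s₁} : Finset S) (fine s₀ s₁ α)
  unfold fine at *
  omega

theorem pair_notMem_fine (hne : s₀ ≠ s₁) : {s₀, s₁} ∉ fine s₀ s₁ α := by
  intro h
  obtain ⟨s, hs⟩ := exists_eq_singleton_of_mem_fine h
  have := Finset.card_pair hne
  rw [hs, Finset.card_singleton] at this
  omega

theorem coarse_ne_fine (hne : s₀ ≠ s₁) : coarse s₀ s₁ α ≠ fine s₀ s₁ α := by
  intro h
  apply pair_notMem_fine (α := α) hne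
  rw [← h, mem_coarse]
  exact Or.inl rfl

end Partitions

/-! ### Transitions, bottom states and weights in the embedding of `A_k` -/

namespace IsExampleGraph

variable {S : Type} {k : ℕ} {G : LTS S Unit} {s₀ s₁ : S} {α : Fin (k + 1) → S}

theorem loopless (hG : IsExampleGraph k G s₀ s₁ α) (s : S) (a : Unit) : (s, a, s) ∉ G.trans := by
  rw [hG.mem_trans]
  rintro (⟨h, h'⟩ | ⟨h, i, h'⟩ | ⟨h, j, h'⟩ | ⟨j, h, h'⟩ | ⟨h, h'⟩)
  · exact hG.ne (h'.symm.trans h)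
  · exact hG.ne₁ i (h'.symm.trans h)
  · exact hG.ne₀ _ (h'.symm.trans h)
  · exact hG.ne₀ _ (h.symm.trans h')
  · exact hG.ne₁ _ (h.symm.trans h')

theorem mem_trans_fst (hG : IsExampleGraph k G s₀ s₁ α)
    (i : Fin (k + 1)) : (s₁, (), α i) ∈ G.trans :=
  (hG.mem_trans _).2 (Or.inr (Or.inl ⟨rfl, i, rfl⟩))

theorem mem_trans_zero (hG : IsExampleGraph k G s₀ s₁ α)
    (j : Fin k) : (s₀, (), α j.succ) ∈ G.trans :=
  (hG.mem_trans _).2 (Or.inr (Or.inr (Or.inl ⟨rfl, j, rfl⟩)))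

theorem trans_card_le (hG : IsExampleGraph k G s₀ s₁ α) : G.trans.card ≤ 3 * k + 3 := by
  have h : G.trans ⊆ {(s₁, (), s₀), (α 0, (), s₁)} ∪
      ((Finset.univ.image fun i => (s₁, (), α i)) ∪
        ((Finset.univ.image fun j : Fin k => (s₀, (), α j.succ)) ∪
          (Finset.univ.image fun j : Fin k => (α j.succ, (), s₀)))) := by
    rintro ⟨u, a, v⟩ he
    rw [hG.mem_trans] at he
    simp only [Finset.mem_union, Finset.mem_insert, Finset.mem_singleton, Finset.mem_image,
      Finset.mem_univ, true_and]
    rcases he with ⟨rfl, rfl⟩ | ⟨rfl, i, rfl⟩ | ⟨rfl, j, rfl⟩ | ⟨j, rfl, rfl⟩ | ⟨rfl, rfl⟩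
    · exact Or.inl (Or.inl rfl)
    · exact Or.inr (Or.inl ⟨i, rfl⟩)
    · exact Or.inr (Or.inr (Or.inl ⟨j, rfl⟩))
    · exact Or.inr (Or.inr (Or.inr ⟨j, rfl⟩))
    · exact Or.inl (Or.inr rfl)
  refine (Finset.card_le_card h).trans ?_
  refine (Finset.card_union_le _ _).trans ?_
  have h₁ := Finset.card_union_le (Finset.univ.image fun i => (s₁, (), α i))
    ((Finset.univ.image fun j : Fin k => (s₀, (), α j.succ)) ∪
      (Finset.univ.image fun j : Fin k => (α j.succ, (), s₀)))
  have h₂ := Finset.card_union_le (Finset.univ.image fun j : Fin k => (s₀, (), α j.succ))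
      (Finset.univ.image fun j : Fin k => (α j.succ, (), s₀))
  have h₃ : ({(s₁, (), s₀), (α 0, (), s₁)} : Finset (Tr S Unit)).card ≤ 2 := Finset.card_le_two
  have h₄ : (Finset.univ.image fun i => (s₁, (), α i)).card ≤ k + 1 :=
    Finset.card_image_le.trans (by simp)
  have h₅ : (Finset.univ.image fun j : Fin k => (s₀, (), α j.succ)).card ≤ k :=
    Finset.card_image_le.trans (by simp)
  have h₆ : (Finset.univ.image fun j : Fin k => (α j.succ, (), s₀)).card ≤ k :=
    Finset.card_image_le.trans (by simp)
  omega

theorem inert_pair (hG : IsExampleGraph k G s₀ s₁ α) : G.inert {s₀, s₁} = {(s₁, G.tau, s₀)} := by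
  ext ⟨u, a, v⟩
  simp only [LTS.inert, LTS.mem_tauT, hG.mem_trans, Finset.mem_insert, Finset.mem_singleton,
    Prod.mk.injEq]
  constructor
  · rintro ⟨h, -, hu, hv⟩
    rcases h with ⟨h, h'⟩ | ⟨h, i, rfl⟩ | ⟨h, i, rfl⟩ | ⟨j, rfl, h⟩ | ⟨rfl, h⟩
    · exact ⟨h, trivial, h'⟩
    · exact (hv.elim (hG.ne₀ _) (hG.ne₁ _)).elim
    · exact (hv.elim (hG.ne₀ _) (hG.ne₁ _)).elim
    · exact (hu.elim (hG.ne₀ _) (hG.ne₁ _)).elim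
    · exact (hu.elim (hG.ne₀ _) (hG.ne₁ _)).elim
  · rintro ⟨rfl, -, rfl⟩
    exact ⟨Or.inl ⟨rfl, rfl⟩, trivial, Or.inr rfl, Or.inl rfl⟩

theorem bottom_pair (hG : IsExampleGraph k G s₀ s₁ α) : G.bottom {s₀, s₁} = {s₀} := by
  ext s
  simp only [LTS.mem_bottom, hG.inert_pair, Finset.mem_insert, Finset.mem_singleton]
  constructor
  · rintro ⟨h | h, h'⟩
    · exact h
    · exact absurd h.symm (h' _ rfl)
  · rintro rfl
    exact ⟨Or.inl rfl, by rintro _ rfl; exact hG.ne.symm⟩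

theorem bottom_single (hG : IsExampleGraph k G s₀ s₁ α) (s : S) : G.bottom {s} = {s} :=
  G.bottom_singleton (hG.loopless s _)

theorem pair_ne (hG : IsExampleGraph k G s₀ s₁ α)
    (i : Fin (k + 1)) : ({s₀, s₁} : Finset S) ≠ {α i} := by
  intro h
  have := Finset.card_pair hG.ne
  rw [h, Finset.card_singleton] at this
  omega

theorem notMem_pair (hG : IsExampleGraph k G s₀ s₁ α)
    (i : Fin (k + 1)) : α i ∉ ({s₀, s₁} : Finset S) := by
  simp [hG.ne₀ i, hG.ne₁ i]

theorem coarse_disjoint (hG : IsExampleGraph k G s₀ s₁ α)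
    : ∀ B ∈ coarse s₀ s₁ α, ∀ B' ∈ coarse s₀ s₁ α, ∀ s, s ∈ B → s ∈ B' →
    B = B' := by
  intro B hB B' hB' s hs hs'
  rcases mem_coarse.1 hB with rfl | ⟨i, rfl⟩ <;> rcases mem_coarse.1 hB' with rfl | ⟨j, rfl⟩
  · rfl
  · rw [Finset.mem_singleton.1 hs'] at hs
    exact absurd hs (hG.notMem_pair j)
  · rw [Finset.mem_singleton.1 hs] at hs'
    exact absurd hs' (hG.notMem_pair i)
  · rw [← Finset.mem_singleton.1 hs, ← Finset.mem_singleton.1 hs']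

theorem fine_disjoint : ∀ B ∈ fine s₀ s₁ α, ∀ B' ∈ fine s₀ s₁ α, ∀ s, s ∈ B → s ∈ B' →
    B = B' := by
  intro B hB B' hB' s hs hs'
  obtain ⟨t, rfl⟩ := exists_eq_singleton_of_mem_fine hB
  obtain ⟨t', rfl⟩ := exists_eq_singleton_of_mem_fine hB'
  rw [← Finset.mem_singleton.1 hs, ← Finset.mem_singleton.1 hs']

theorem replaceBlock_coarse (hG : IsExampleGraph k G s₀ s₁ α) :
    replaceBlock (coarse s₀ s₁ α) {s₀, s₁} {s₁} {s₀} = fine s₀ s₁ α := by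
  ext B
  simp only [replaceBlock, Finset.mem_union, Finset.mem_erase, mem_coarse, mem_fine,
    Finset.mem_insert, Finset.mem_singleton]
  constructor
  · rintro (⟨h, h' | h'⟩ | ⟨-, h | h⟩)
    · exact absurd h' h
    · exact Or.inr (Or.inr h')
    · exact Or.inr (Or.inl h)
    · exact Or.inl h
  · rintro (rfl | rfl | ⟨i, rfl⟩)
    · exact Or.inr ⟨Finset.singleton_ne_empty _, Or.inr rfl⟩
    · exact Or.inr ⟨Finset.singleton_ne_empty _, Or.inl rfl⟩
    · exact Or.inl ⟨(hG.pair_ne i).symm, Or.inr ⟨i, rfl⟩⟩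

theorem splitters_nonempty {B : Finset S} (hB : B ∈ insert {s₀, s₁} (fine s₀ s₁ α)) :
    B.Nonempty ∧ B.card ≤ 2 := by
  rcases Finset.mem_insert.1 hB with rfl | h
  · exact ⟨Finset.insert_nonempty _ _, Finset.card_le_two⟩
  · obtain ⟨s, rfl⟩ := exists_eq_singleton_of_mem_fine h
    exact ⟨Finset.singleton_nonempty s, by simp⟩

theorem weight_le (hG : IsExampleGraph k G s₀ s₁ α) (b : Finset S) : G.weight b ≤ 75 * k + 83 := by
  have h₁ := G.inT_card_le b
  have h₂ := G.outT_card_le b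
  have h₃ := hG.trans_card_le
  unfold LTS.weight
  omega

theorem inT_single (hG : IsExampleGraph k G s₀ s₁ α)
    (i : Fin (k + 1)) : G.inT {α i} ⊆ {(s₁, (), α i), (s₀, (), α i)} := by
  rintro ⟨u, a, v⟩ he
  simp only [LTS.mem_inT, hG.mem_trans, Finset.mem_singleton] at he
  simp only [Finset.mem_insert, Finset.mem_singleton, Prod.mk.injEq]
  obtain ⟨h, rfl⟩ := he
  rcases h with ⟨h, h'⟩ | ⟨h, j, h'⟩ | ⟨h, j, h'⟩ | ⟨j, h, h'⟩ | ⟨h, h'⟩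
  · exact absurd h' (hG.ne₀ _)
  · exact Or.inl ⟨h, trivial, rfl⟩
  · exact Or.inr ⟨h, trivial, rfl⟩
  · exact absurd h' (hG.ne₀ _)
  · exact absurd h' (hG.ne₁ _)

theorem weight_single_le (hG : IsExampleGraph k G s₀ s₁ α)
    (i : Fin (k + 1)) : G.weight {α i} ≤ 58 := by
  have h₁ : (G.inT {α i}).card ≤ 2 :=
    (Finset.card_le_card (hG.inT_single i)).trans Finset.card_le_two
  have h₂ : (G.outT {α i}) ⊆ {(α i, (), s₀), (α i, (), s₁)} := by
    rintro ⟨u, a, v⟩ he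
    simp only [LTS.mem_outT, hG.mem_trans, Finset.mem_singleton] at he
    simp only [Finset.mem_insert, Finset.mem_singleton, Prod.mk.injEq]
    obtain ⟨h, rfl⟩ := he
    rcases h with ⟨h, h'⟩ | ⟨h, j, h'⟩ | ⟨h, j, h'⟩ | ⟨j, h, h'⟩ | ⟨h, h'⟩
    · exact absurd h (hG.ne₁ _)
    · exact absurd h (hG.ne₁ _)
    · exact absurd h (hG.ne₀ _)
    · exact Or.inl ⟨rfl, trivial, h'⟩
    · exact Or.inr ⟨rfl, trivial, h'⟩
  have h₃ := (Finset.card_le_card h₂).trans Finset.card_le_two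
  unfold LTS.weight
  omega

/-- Only the blocks {s₀, s₁}, {s₀} and {s₁} can have linear weight; each of the k + 1 blocks {α i}
has bounded weight. So 3(75k + 83) + 58(k + 1), without a logarithm. -/
theorem sum_weight_le (hG : IsExampleGraph k G s₀ s₁ α) :
    ∑ b ∈ insert {s₀, s₁} (fine s₀ s₁ α), G.weight b ≤ 283 * k + 307 := by
  have hi : ∀ (X : Finset (Finset S)) (b : Finset S),
      ∑ c ∈ insert b X, G.weight c ≤ G.weight b + ∑ c ∈ X, G.weight c := by
    intro X b
    by_cases h : b ∈ X
    · rw [Finset.insert_eq_of_mem h]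
      omega
    · rw [Finset.sum_insert h]
  have h₁ := hi (fine s₀ s₁ α) {s₀, s₁}
  have h₂ := hi (insert {s₁} (Finset.univ.image fun i => {α i})) {s₀}
  have h₃ := hi (Finset.univ.image fun i => {α i}) {s₁}
  have h₄ : ∑ c ∈ Finset.univ.image (fun i => ({α i} : Finset S)), G.weight c ≤ (k + 1) * 58 := by
    refine (Finset.sum_le_card_nsmul _ _ 58 ?_).trans ?_
    · intro b hb
      obtain ⟨i, -, rfl⟩ := Finset.mem_image.1 hb
      exact hG.weight_single_le i
    · rw [smul_eq_mul]
      exact Nat.mul_le_mul_right _ (Finset.card_image_le.trans (by simp))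
  have h₅ := hG.weight_le {s₀, s₁}
  have h₆ := hG.weight_le {s₀}
  have h₇ := hG.weight_le {s₁}
  have e : fine s₀ s₁ α = insert {s₀} (insert {s₁} (Finset.univ.image fun i => {α i})) := rfl
  rw [← e] at h₂
  omega

/-! #### Iterations -/

/-- The transition s₁ → α 0 is the only one that can distinguish s₁ from s₀; every other non-inert
transition of the block ends in some α j.succ, which s₀ reaches as well. -/
theorem nonInert_pair (hG : IsExampleGraph k G s₀ s₁ α) {C : Finset S} {e : Tr S Unit}
    (he : e ∈ (G.nonInert {s₀, s₁}).filter fun e => e.2.2 ∈ C) :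
    (e.1 = s₁ ∧ e.2.2 = α 0 ∧ α 0 ∈ C) ∨ ∃ j : Fin k, e.2.2 = α j.succ ∧ α j.succ ∈ C := by
  simp only [Finset.mem_filter, LTS.mem_nonInert, hG.mem_trans, Finset.mem_insert,
    Finset.mem_singleton] at he
  obtain ⟨⟨h, hu, hv⟩, hC⟩ := he
  rcases h with ⟨h, h'⟩ | ⟨h, i, h'⟩ | ⟨h, j, h'⟩ | ⟨j, h, h'⟩ | ⟨h, h'⟩
  · exact absurd ⟨trivial, Or.inl h'⟩ hv
  · refine Fin.cases (fun h' => ?_) (fun j h' => ?_) i h'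
    · exact Or.inl ⟨h, h', h' ▸ hC⟩
    · exact Or.inr ⟨j, h', h' ▸ hC⟩
  · exact Or.inr ⟨j, h', h' ▸ hC⟩
  · exact absurd ⟨trivial, Or.inl h'⟩ hv
  · exact absurd ⟨trivial, Or.inr h'⟩ hv

theorem mem_nonInert_pair (hG : IsExampleGraph k G s₀ s₁ α)
    {C : Finset S} {j : Fin k} (hj : α j.succ ∈ C) :
    ∃ e ∈ (G.nonInert {s₀, s₁}).filter fun e => e.2.2 ∈ C, e.1 = s₀ := by
  refine ⟨(s₀, (), α j.succ), ?_, rfl⟩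
  exact Finset.mem_filter.2 ⟨G.mem_nonInert.2 ⟨hG.mem_trans_zero j, by simp,
    fun h => hG.notMem_pair _ h.2⟩, hj⟩

/-- With all blocks singletons, no block is split. -/
theorem total_iteration_fine (hG : IsExampleGraph k G s₀ s₁ α)
    {x : KState S} {p : ℕ × Finset S} (hx : x.blocks = fine s₀ s₁ α)
    (hp : p.2 ∈ x.blocks) :
    1 + (G.weight p.2 - 1) = G.weight p.2 ∧
    Total (G.iteration x p) (G.weight p.2 - 1)
      fun r _ => r = .inl (LTS.nextK x p (fine s₀ s₁ α)) := by
  rw [← hx]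
  have hsub : ∀ B ∈ x.blocks, B ∈ insert {s₀, s₁} (fine s₀ s₁ α) := fun B hB =>
    Finset.mem_insert_of_mem (hx ▸ hB)
  refine LTS.total_iteration_of_bottom (by rw [hx]; exact fine_disjoint)
    (fun B hB => (splitters_nonempty (hsub B hB)).1)
    (fun B hB => (splitters_nonempty (hsub B hB)).2) hp ?_ ?_
  · rintro D hD - hin s hs
    obtain ⟨t, rfl⟩ := exists_eq_singleton_of_mem_fine (hx ▸ hD)
    rw [hG.bottom_single] at hs
    obtain rfl := Finset.mem_singleton.1 hs
    constructor
    · obtain ⟨e, he, h⟩ := hin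
      rw [LTS.mem_inT] at he
      exact ⟨e, Finset.mem_filter.2 ⟨G.mem_outT.2 ⟨he.1, h⟩, he.2⟩, Finset.mem_singleton.1 h⟩
    · intro hne
      obtain ⟨e, he⟩ := Finset.nonempty_iff_ne_empty.2 hne
      exact ⟨e, he, Finset.mem_singleton.1 (G.mem_nonInert.1 (Finset.mem_filter.1 he).1).2.1⟩
  · intro hne s hs
    obtain ⟨t, ht⟩ := exists_eq_singleton_of_mem_fine (hx ▸ hp)
    rw [ht, hG.bottom_single] at hs
    obtain rfl := Finset.mem_singleton.1 hs
    obtain ⟨e, he⟩ := Finset.nonempty_iff_ne_empty.2 hne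
    refine ⟨e, he, ?_⟩
    have := (G.mem_outT.1 (Finset.mem_filter.1 he).1).2
    rw [ht] at this
    exact Finset.mem_singleton.1 this

/-- The block `{s₀, s₁}` is not split if the remaining constellation, like the splitter, does not
distinguish its states. -/
theorem total_iteration_coarse (hG : IsExampleGraph k G s₀ s₁ α)
    {x : KState S} {p : ℕ × Finset S} (hx : x.blocks = coarse s₀ s₁ α)
    (hp : p.2 ∈ x.blocks) (h₀ : p.2 ≠ {α 0})
    (hC : α 0 ∈ x.cons.getD p.1 ∅ \ p.2 → ∃ j : Fin k, α j.succ ∈ x.cons.getD p.1 ∅ \ p.2) :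
    1 + (G.weight p.2 - 1) = G.weight p.2 ∧
    Total (G.iteration x p) (G.weight p.2 - 1)
      fun r _ => r = .inl (LTS.nextK x p (coarse s₀ s₁ α)) := by
  rw [← hx]
  have hsub : ∀ B ∈ x.blocks, B ∈ insert {s₀, s₁} (fine s₀ s₁ α) := fun B hB =>
    mem_insert_of_mem_coarse (hx ▸ hB)
  refine LTS.total_iteration_of_bottom (by rw [hx]; exact hG.coarse_disjoint)
    (fun B hB => (splitters_nonempty (hsub B hB)).1)
    (fun B hB => (splitters_nonempty (hsub B hB)).2) hp ?_ ?_
  · intro D hD hne hin s hs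
    rcases mem_coarse.1 (hx ▸ hD) with rfl | ⟨i, rfl⟩
    · rw [hG.bottom_pair] at hs
      obtain rfl := Finset.mem_singleton.1 hs
      constructor
      · rcases mem_coarse.1 (hx ▸ hp) with h | ⟨i, h⟩
        · exact absurd h.symm hne
        · revert h
          refine Fin.cases (fun h => absurd h h₀) (fun j h => ?_) i
          refine ⟨(s, (), α j.succ), ?_, rfl⟩
          rw [h]
          exact Finset.mem_filter.2 ⟨G.mem_outT.2 ⟨hG.mem_trans_zero j, by simp⟩, by simp⟩
      · intro hne
        obtain ⟨e, he⟩ := Finset.nonempty_iff_ne_empty.2 hne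
        rcases hG.nonInert_pair he with ⟨-, -, h⟩ | ⟨j, -, h⟩
        · obtain ⟨j, hj⟩ := hC h
          exact hG.mem_nonInert_pair hj
        · exact hG.mem_nonInert_pair h
    · rw [hG.bottom_single] at hs
      obtain rfl := Finset.mem_singleton.1 hs
      constructor
      · obtain ⟨e, he, h⟩ := hin
        rw [LTS.mem_inT] at he
        exact ⟨e, Finset.mem_filter.2 ⟨G.mem_outT.2 ⟨he.1, h⟩, he.2⟩, Finset.mem_singleton.1 h⟩
      · intro hne
        obtain ⟨e, he⟩ := Finset.nonempty_iff_ne_empty.2 hne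
        exact ⟨e, he, Finset.mem_singleton.1 (G.mem_nonInert.1 (Finset.mem_filter.1 he).1).2.1⟩
  · intro hne s hs
    obtain ⟨e, he⟩ := Finset.nonempty_iff_ne_empty.2 hne
    rcases mem_coarse.1 (hx ▸ hp) with h | ⟨i, h⟩
    · rw [h, hG.bottom_pair] at hs
      obtain rfl := Finset.mem_singleton.1 hs
      -- The splitter is the block {s₀, s₁} itself; a transition to the rest of the constellation
      -- leaves the splitter and hence is not inert.
      have he' : e ∈ (G.nonInert {s, s₁}).filter
          fun e => e.2.2 ∈ x.cons.getD p.1 ∅ \ p.2 := by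
        simp only [Finset.mem_filter, LTS.mem_outT, h] at he
        simp only [Finset.mem_filter, LTS.mem_nonInert, h]
        exact ⟨⟨he.1.1, he.1.2, fun h' => (Finset.mem_sdiff.1 he.2).2 h'.2⟩, he.2⟩
      obtain ⟨j, hj⟩ : ∃ j : Fin k, α j.succ ∈ x.cons.getD p.1 ∅ \ p.2 := by
        rcases hG.nonInert_pair he' with ⟨-, -, h⟩ | ⟨j, -, h⟩
        · exact hC h
        · exact ⟨j, h⟩
      obtain ⟨f, hf, hfs⟩ := hG.mem_nonInert_pair hj
      refine ⟨f, ?_, hfs⟩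
      simp only [Finset.mem_filter, LTS.mem_nonInert] at hf
      simp only [Finset.mem_filter, LTS.mem_outT, h] at hf ⊢
      exact ⟨⟨hf.1.1, hf.1.2.1⟩, hf.2⟩
    · rw [h, hG.bottom_single] at hs
      obtain rfl := Finset.mem_singleton.1 hs
      refine ⟨e, he, ?_⟩
      have := (G.mem_outT.1 (Finset.mem_filter.1 he).1).2
      rw [h] at this
      exact Finset.mem_singleton.1 this

/-- The block `{s₀, s₁}` is split under the splitter `{α 0}`, or after the splitter `{α i}` under
the remaining constellation, if this contains `α 0` only. -/
theorem total_refineUnder_split (hG : IsExampleGraph k G s₀ s₁ α)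
    (cons : List (Finset S)) {C : Finset S} {i : Fin (k + 1)}
    (h : i = 0 ∨ (α 0 ∈ C ∧ ∀ j : Fin k, α j.succ ∉ C)) :
    Total (G.refineUnder cons {α i} C {s₀, s₁} (coarse s₀ s₁ α))
      (15 + LTS.splitTime G.trans.card cons.length) fun P c => P = fine s₀ s₁ α ∧
        (G.reachCons cons {s₁}).card.factorial ≤ 4 ^ c := by
  have hV : ({s₀, s₁} : Finset S) ∈ coarse s₀ s₁ α := mem_coarse.2 (Or.inl rfl)
  have hsplit := fun {e : Tr S Unit} (he : e.1 = s₁) => LTS.total_refineBlock_pair hG.ne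
    hG.inert_pair (hG.loopless _ _) he cons (coarse s₀ s₁ α)
  rw [hG.replaceBlock_coarse] at hsplit
  refine Total.pick_bind (exists_isMarking _ _) fun M hM => ?_
  have hM : IsMarking _ _ M := hM
  have h4 : ((G.outT {s₀, s₁}).filter fun e => e.2.2 ∈ ({α i} : Finset S)).card ≤ 4 :=
    LTS.card_filter_out_le Finset.card_le_two (by simp)
  have hc : M.card ≤ ((G.outT {s₀, s₁}).filter fun e => e.2.2 ∈ ({α i} : Finset S)).card :=
    hM.card_le.trans Finset.card_image_le
  have hmem₁ : (s₁, (), α i) ∈ (G.outT {s₀, s₁}).filter fun e => e.2.2 ∈ ({α i} : Finset S) := by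
    exact Finset.mem_filter.2 ⟨G.mem_outT.2 ⟨hG.mem_trans_fst i, by simp⟩, by simp⟩
  -- The constant 15 is 4 + 4 for the initial marking and 4 + 3 for a first refinement that may
  -- leave the block intact.
  refine (Total.tick_bind (n' := 7 + LTS.splitTime G.trans.card cons.length) ?_).weaken
    (by omega)
  by_cases hi : i = 0
  · subst hi
    have hT : ((G.outT {s₀, s₁}).filter fun e => e.2.2 ∈ ({α 0} : Finset S)) =
        {(s₁, (), α 0)} := by
      refine Finset.Subset.antisymm ?_ (Finset.singleton_subset_iff.2 hmem₁)
      rintro ⟨u, a, v⟩ he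
      simp only [Finset.mem_filter, LTS.mem_outT, hG.mem_trans, Finset.mem_singleton] at he
      obtain ⟨⟨h, -⟩, rfl⟩ := he
      rw [Finset.mem_singleton, Prod.mk.injEq, Prod.mk.injEq]
      rcases h with ⟨h, h'⟩ | ⟨h, i, h'⟩ | ⟨h, j, h'⟩ | ⟨j, h, h'⟩ | ⟨h, h'⟩
      · exact absurd h' (hG.ne₀ _)
      · exact ⟨h, rfl, rfl⟩
      · exact absurd (hG.inj h').symm (Fin.succ_ne_zero j)
      · exact absurd h' (hG.ne₀ _)
      · exact absurd h' (hG.ne₁ _)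
    rw [hT]
    refine Total.weaken (Total.bind (n' := 0) (hsplit rfl) ?_) (by omega)
    rintro _ c ⟨rfl, hf⟩
    -- All of {s₁} has been separated as the block with the new bottom state, so the part that
    -- remains for the second refinement is empty.
    have hT₂ : ((G.nonInert ∅).filter fun e => e.2.2 ∈ C) = ∅ := by ext; simp
    simp only [hT₂, ne_eq, not_true_eq_false, if_false]
    exact Total.pure ⟨rfl, hf.trans (Nat.pow_le_pow_right (by norm_num) (by omega))⟩
  · obtain ⟨j, rfl⟩ := Fin.exists_succ_eq_of_ne_zero hi
    obtain ⟨h₀, hj⟩ := h.resolve_left hi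
    have hmem₀ : (s₀, (), α j.succ) ∈
        (G.outT {s₀, s₁}).filter fun e => e.2.2 ∈ ({α j.succ} : Finset S) := by
      exact Finset.mem_filter.2 ⟨G.mem_outT.2 ⟨hG.mem_trans_zero j, by simp⟩, by simp⟩
    have hT₂ : ((G.nonInert {s₀, s₁}).filter fun e => e.2.2 ∈ C) = {(s₁, (), α 0)} := by
      ext ⟨u, a, v⟩
      constructor
      · intro he
        rcases hG.nonInert_pair he with ⟨h₁, h₂, -⟩ | ⟨j', -, h⟩
        · obtain rfl : u = s₁ := h₁
          obtain rfl : v = α 0 := h₂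
          exact Finset.mem_singleton_self _
        · exact absurd h (hj j')
      · intro he
        rw [Finset.mem_singleton.1 he]
        exact Finset.mem_filter.2 ⟨G.mem_nonInert.2 ⟨hG.mem_trans_fst 0, by simp,
          fun h => hG.notMem_pair _ h.2⟩, h₀⟩
    -- The marking was chosen before the first refinement; it contains this transition because s₁
    -- also has a transition to the splitter.
    have hM₂ : M ∩ {(s₁, (), α 0)} = {(s₁, (), α 0)} := by
      rw [hT₂] at hM
      obtain ⟨e, he, -⟩ := hM.exists_mem (s := s₁) (Finset.mem_image.2 ⟨_, hmem₁, rfl⟩)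
        ⟨_, Finset.mem_singleton_self _, rfl⟩
      have := Finset.mem_singleton.1 (hM.1 he)
      rw [Finset.inter_eq_right, Finset.singleton_subset_iff, ← this]
      exact he
    refine Total.weaken (Total.bind (n' := LTS.splitTime G.trans.card cons.length + 0)
      (G.total_refineBlock_of_bottom cons hV
      (Finset.insert_nonempty _ _) fun s hs => ?_) ?_) (Nat.add_le_add (Nat.add_le_add_right h4 3)
      le_rfl)
    · rw [hG.bottom_pair] at hs
      exact ⟨_, hmem₀, (Finset.mem_singleton.1 hs).symm⟩
    · rintro _ c rfl
      simp only [hT₂, hM₂, ne_eq, Finset.singleton_ne_empty, not_false_eq_true, if_true]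
      refine Total.bind (hsplit rfl) ?_
      rintro _ c ⟨rfl, hf⟩
      exact Total.pure ⟨rfl, hf.trans (Nat.pow_le_pow_right (by norm_num) (by omega))⟩

/-- A splitter {α i} has no predecessor block except {s₀, s₁}, so exactly one refinement takes
place. -/
theorem total_iteration_split (hG : IsExampleGraph k G s₀ s₁ α)
    {x : KState S} {p : ℕ × Finset S} {i : Fin (k + 1)}
    (hx : x.blocks = coarse s₀ s₁ α) (hp : p.2 = {α i})
    (h : i = 0 ∨ (α 0 ∈ x.cons.getD p.1 ∅ \ p.2 ∧
      ∀ j : Fin k, α j.succ ∉ x.cons.getD p.1 ∅ \ p.2)) :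
    Total (G.iteration x p)
      (G.weight p.2 - 1 + LTS.splitTime G.trans.card
        (LTS.nextK x p (fine s₀ s₁ α)).cons.length)
      fun r c => r = .inl (LTS.nextK x p (fine s₀ s₁ α)) ∧
        (G.reachCons (LTS.nextK x p (fine s₀ s₁ α)).cons {s₁}).card.factorial ≤ 4 ^ c := by
  obtain ⟨n, X⟩ := p
  dsimp only at hp
  subst hp
  have hin : (s₁, (), α i) ∈ G.inT {α i} := by
    exact G.mem_inT.2 ⟨hG.mem_trans_fst i, by simp⟩
  -- At least one incoming transition is needed for the weight of the splitter to cover the 15 steps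
  -- around the split.
  have hpos : 0 < (G.inT {α i}).card := Finset.card_pos.2 ⟨_, hin⟩
  have hD : (x.blocks.filter fun D => D ≠ {α i} ∧ ∃ e ∈ G.inT {α i}, e.1 ∈ D) =
      {{s₀, s₁}} := by
    ext D
    simp only [Finset.mem_filter, Finset.mem_singleton, hx]
    constructor
    · rintro ⟨hD, -, e, he, heD⟩
      rcases mem_coarse.1 hD with h | ⟨j, rfl⟩
      · exact h
      · have := hG.inT_single i he
        rw [Finset.mem_singleton] at heD
        simp only [Finset.mem_insert, Finset.mem_singleton] at this
        rcases this with rfl | rfl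
        · exact absurd heD.symm (hG.ne₁ j)
        · exact absurd heD.symm (hG.ne₀ j)
    · rintro rfl
      exact ⟨mem_coarse.2 (Or.inl rfl), hG.pair_ne i, _, hin, by simp⟩
  set cons := (LTS.nextK x (n, {α i}) (fine s₀ s₁ α)).cons with hcons
  set z := LTS.splitTime G.trans.card cons.length with hz
  have hfine : ({α i} : Finset S) ∈ fine s₀ s₁ α := mem_fine.2 (Or.inr (Or.inr ⟨i, rfl⟩))
  refine Total.weaken (n := (({α i} : Finset S).card + (G.inT {α i}).card) + (1 * (1 + (15 + z)) +
    ((G.outT {α i}).card + (5 + 0)))) ?_ (by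
      rw [Finset.card_singleton]
      simp only [LTS.weight]
      omega)
  simp only [LTS.iteration, hD]
  refine Total.tick_bind (Total.bind (total_forEach (b := 15 + z)
    (fun D P c => (D = ∅ ∧ P = coarse s₀ s₁ α) ∨ ({s₀, s₁} ∈ D ∧ P = fine s₀ s₁ α ∧
      (G.reachCons cons {s₁}).card.factorial ≤ 4 ^ c)) x.blocks (Or.inl ⟨rfl, hx⟩) ?_) ?_)
  · rintro D hD E P c hDE (⟨-, rfl⟩ | ⟨hE, -⟩)
    · obtain rfl := Finset.mem_singleton.1 hD
      refine (hG.total_refineUnder_split cons h).mono le_rfl ?_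
      rintro P c' - ⟨rfl, hf⟩
      exact Or.inr ⟨Finset.mem_insert_self _ _, rfl,
        hf.trans (Nat.pow_le_pow_right (by norm_num) (by omega))⟩
    · rw [Finset.mem_singleton.1 hD] at hDE
      exact absurd hE hDE
  · rintro P c (⟨h, -⟩ | ⟨-, rfl, hf⟩)
    · exact absurd h (Finset.singleton_ne_empty _)
    · refine Total.tick_bind (LTS.total_refineSplitter _ hfine (Finset.singleton_nonempty _)
        (by simp) ?_ fun c' => Total.pure ⟨rfl, hf.trans
          (Nat.pow_le_pow_right (by norm_num) (by omega))⟩)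
      intro hne s hs
      rw [hG.bottom_single] at hs
      obtain rfl := Finset.mem_singleton.1 hs
      obtain ⟨e, he⟩ := Finset.nonempty_iff_ne_empty.2 hne
      exact ⟨e, he, Finset.mem_singleton.1 (G.mem_outT.1 (Finset.mem_filter.1 he).1).2⟩

end IsExampleGraph

/-! #### The main loop -/

section Main

variable {S : Type}

/-- Constellations are identified by position: the remainder keeps the old position and the splitter
is appended, so earlier numbers keep their meaning. -/
theorem getD_nextK {x : KState S} {p : ℕ × Finset S} (P : Finset (Finset S))
    (hp : p.1 < x.cons.length) (j : ℕ) :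
    (LTS.nextK x p P).cons.getD j ∅ =
      if j = p.1 then x.cons.getD p.1 ∅ \ p.2 else if j = x.cons.length then p.2
      else x.cons.getD j ∅ := by
  simp only [LTS.nextK, List.getD_eq_getElem?_getD]
  rcases lt_trichotomy j x.cons.length with h | h | h
  · rw [List.getElem?_append_left (by simpa using h), List.getElem?_set]
    by_cases hj : p.1 = j
    · subst hj
      simp [h]
    · simp [hj, Ne.symm hj, h.ne]
  · subst h
    rw [List.getElem?_append_right (by simp)]
    simp [hp.ne']
  · rw [List.getElem?_append_right (by simpa using h.le)]
    have h₁ : j ≠ p.1 := by omega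
    have h₂ : j - x.cons.length ≠ 0 := by omega
    simp only [h₁, h.ne', if_false, List.length_set]
    rw [List.getElem?_eq_none (by simp; omega), List.getElem?_eq_none h.le]

theorem bodyK_some {G : LTS S Unit} {x : KState S}
    {r : KState S ⊕ (Finset (Finset S) × List (Finset S))} {c : ℕ} (h : G.bodyK x (some r) c) :
    (∃ p ∈ LTS.smallBlocks x, G.iteration x p (some r) c) ∨ r = .inr (x.blocks, x.trace) := by
  unfold LTS.bodyK at h
  split_ifs at h
  · rcases h with ⟨h, -⟩ | ⟨p, c₁, c₂, ⟨rfl, h | ⟨q, hq, h⟩⟩, h₂, rfl⟩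
    · cases h
    · cases h
    · cases h
      rw [zero_add]
      exact Or.inl ⟨p, hq, h₂⟩
  · obtain ⟨-, h | h⟩ := h
    · cases h
    · exact Or.inr (Option.some.inj h)

theorem bodyK_of_iteration {G : LTS S Unit} {x : KState S} {p : ℕ × Finset S}
    {r : KState S ⊕ (Finset (Finset S) × List (Finset S))} {c : ℕ}
    (hx : ∃ i < x.cons.length, 1 < (x.blocks.filter fun B => B ⊆ x.cons.getD i ∅).card)
    (hp : p ∈ LTS.smallBlocks x) (h : G.iteration x p (some r) c) : G.bodyK x (some r) c := by
  unfold LTS.bodyK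
  rw [if_pos hx]
  exact Or.inr ⟨p, 0, c, ⟨rfl, Or.inr ⟨p, hp, rfl⟩⟩, h, (zero_add c).symm⟩

/-- Invariant of the main loop. -/
structure MainInvariant {k : ℕ} (s₀ s₁ : S) (α : Fin (k + 1) → S) (x : KState S) : Prop where
  blocks : x.blocks = coarse s₀ s₁ α ∨ x.blocks = fine s₀ s₁ α
  disjoint : ∀ i j, i ≠ j → Disjoint (x.cons.getD i ∅) (x.cons.getD j ∅)
  nodup : x.trace.Nodup
  used : ∀ b ∈ x.trace, b ∈ insert {s₀, s₁} (fine s₀ s₁ α)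
  own : ∀ b ∈ x.trace, ∀ i, ∀ s ∈ b, s ∈ x.cons.getD i ∅ → x.cons.getD i ∅ ⊆ b
  length : x.cons.length = x.trace.length + 1
  stable : x.blocks = coarse s₀ s₁ α → ∀ i, α 0 ∈ x.cons.getD i ∅ →
    ∃ j : Fin k, α j.succ ∈ x.cons.getD i ∅

/-- A bound of the remaining time. -/
def potential {k : ℕ} (G : LTS S Unit) (s₀ s₁ : S) (α : Fin (k + 1) → S) (x : KState S) : ℕ :=
  ∑ b ∈ (insert {s₀, s₁} (fine s₀ s₁ α)).filter (fun b => b ∉ x.trace), G.weight b +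
    (if x.blocks = coarse s₀ s₁ α then LTS.splitTime G.trans.card (k + 5) else 0) + 1

variable {k : ℕ} {G : LTS S Unit} {s₀ s₁ : S} {α : Fin (k + 1) → S} {x : KState S}
  {p : ℕ × Finset S}

theorem MainInvariant.mem_splitters (hx : MainInvariant s₀ s₁ α x) {B : Finset S}
    (hB : B ∈ x.blocks) : B ∈ insert {s₀, s₁} (fine s₀ s₁ α) := by
  rcases hx.blocks with h | h
  · exact mem_insert_of_mem_coarse (h ▸ hB)
  · exact Finset.mem_insert_of_mem (h ▸ hB)

/-- Once a block has been used as splitter, any constellation meeting it is contained in it. The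
block cannot then be at most half of such a constellation, so it is never chosen again. -/
theorem MainInvariant.fresh (hx : MainInvariant s₀ s₁ α x) (hp : p ∈ LTS.smallBlocks x) :
    p.2 ∉ x.trace := by
  intro h
  obtain ⟨-, hb, hsub, hcard⟩ := hp
  obtain ⟨s, hs⟩ := (IsExampleGraph.splitters_nonempty (hx.mem_splitters hb)).1
  have h₁ := Finset.card_le_card (hx.own _ h p.1 s hs (hsub hs))
  have h₂ := Finset.card_pos.2 ⟨s, hs⟩
  omega

/-- Only `stable` depends on the resulting partition. If the pair stays whole, α 0 cannot lie in the
new constellation, because the splitter is neither {α 0} nor able to contain α 0 otherwise, and the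
hypothesis `hs` covers the remainder. -/
theorem MainInvariant.next (hx : MainInvariant s₀ s₁ α x) (hp : p ∈ LTS.smallBlocks x)
    {P : Finset (Finset S)} (hP : P = coarse s₀ s₁ α ∨ P = fine s₀ s₁ α)
    (hs : P = coarse s₀ s₁ α → x.blocks = coarse s₀ s₁ α ∧ p.2 ≠ {α 0} ∧
      (α 0 ∈ x.cons.getD p.1 ∅ \ p.2 → ∃ j : Fin k, α j.succ ∈ x.cons.getD p.1 ∅ \ p.2))
    (hα : ∀ i, α i ∉ ({s₀, s₁} : Finset S)) :
    MainInvariant s₀ s₁ α (LTS.nextK x p P) := by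
  have hfresh := hx.fresh hp
  obtain ⟨hlen, hb, hsub, hcard⟩ := hp
  have hself : ∀ j, j ≠ p.1 → Disjoint p.2 (x.cons.getD j ∅) := fun j hj =>
    (hx.disjoint p.1 j hj.symm).mono_left hsub
  have hrest : ∀ j, j ≠ p.1 → Disjoint (x.cons.getD p.1 ∅ \ p.2) (x.cons.getD j ∅) := fun j hj =>
    (hx.disjoint p.1 j hj.symm).mono_left Finset.sdiff_subset
  refine ⟨hP, ?_, ?_, ?_, ?_, ?_, ?_⟩
  · have key : ∀ i j, i < j → Disjoint ((LTS.nextK x p P).cons.getD i ∅)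
        ((LTS.nextK x p P).cons.getD j ∅) := by
      intro i j hij
      rw [getD_nextK P hlen, getD_nextK P hlen]
      split_ifs with h₁ h₂ h₃ h₄ h₅ h₆ h₇
      · omega
      · exact Finset.sdiff_disjoint
      · exact hrest j h₂
      · omega
      · omega
      · exact hself j h₅
      · exact (hrest i h₁).symm
      · exact (hself i h₁).symm
      · exact hx.disjoint i j hij.ne
    intro i j hij
    rcases lt_or_gt_of_ne hij with h | h
    · exact key i j h
    · exact (key j i h).symm
  · refine List.Nodup.append hx.nodup (List.nodup_singleton _) ?_
    intro b hb hb'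
    exact hfresh (List.mem_singleton.1 hb' ▸ hb)
  · intro b hb'
    rcases List.mem_append.1 hb' with h | h
    · exact hx.used b h
    · rw [List.mem_singleton.1 h]
      exact hx.mem_splitters hb
  · intro b hb' i s hsb
    rw [getD_nextK P hlen]
    rcases List.mem_append.1 hb' with h | h
    · have hown := hx.own b h
      split_ifs with h₁ h₂
      · intro h'
        exact Finset.sdiff_subset.trans (hown p.1 s hsb (Finset.mem_sdiff.1 h').1)
      · intro h'
        exact hsub.trans (hown p.1 s hsb (hsub h'))
      · exact hown i s hsb
    · obtain rfl := List.mem_singleton.1 h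
      split_ifs with h₁ h₂
      · intro h'
        exact absurd hsb (Finset.mem_sdiff.1 h').2
      · exact fun _ => subset_rfl
      · intro h'
        exact absurd h' (Finset.disjoint_left.1 (hself i h₁) hsb)
  · simp [LTS.nextK, hx.length]
  · intro hPc i
    obtain ⟨hxb, h₀, hC⟩ := hs hPc
    rw [getD_nextK P hlen]
    split_ifs with h₁ h₂
    · exact hC
    · intro h'
      rcases mem_coarse.1 (hxb ▸ hb) with h | ⟨i, h⟩
      · rw [h] at h'
        exact absurd h' (hα 0)
      · rw [h, Finset.mem_singleton] at h'
        rw [h, ← h'] at h₀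
        exact absurd rfl h₀
    · exact hx.stable hxb i

/-- A fresh splitter leaves the set of unused ones, and its weight is released to pay for the
iteration. -/
theorem MainInvariant.sum_next (hx : MainInvariant s₀ s₁ α x) (hp : p ∈ LTS.smallBlocks x)
    (P : Finset (Finset S)) :
    G.weight p.2 + ∑ b ∈ (insert {s₀, s₁} (fine s₀ s₁ α)).filter
        (fun b => b ∉ (LTS.nextK x p P).trace), G.weight b =
      ∑ b ∈ (insert {s₀, s₁} (fine s₀ s₁ α)).filter (fun b => b ∉ x.trace), G.weight b := by
  have h₁ : p.2 ∈ (insert {s₀, s₁} (fine s₀ s₁ α)).filter (fun b => b ∉ x.trace) :=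
    Finset.mem_filter.2 ⟨hx.mem_splitters hp.2.1, hx.fresh hp⟩
  have h₂ : (insert {s₀, s₁} (fine s₀ s₁ α)).filter
        (fun b => b ∉ (LTS.nextK x p P).trace) =
      ((insert {s₀, s₁} (fine s₀ s₁ α)).filter (fun b => b ∉ x.trace)).erase p.2 := by
    ext b
    simp only [LTS.nextK, List.mem_append, List.mem_singleton, Finset.mem_filter,
      Finset.mem_erase]
    tauto
  rw [h₂]
  exact Finset.add_sum_erase _ _ h₁

/-- The initial constellation plus one for each of at most k + 4 distinct splitters. -/
theorem MainInvariant.length_cons_le (hx : MainInvariant s₀ s₁ α x) :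
    x.cons.length ≤ k + 5 := by
  rw [hx.length]
  have h : x.trace.toFinset ⊆ insert {s₀, s₁} (fine s₀ s₁ α) := fun b hb =>
    hx.used b (List.mem_toFinset.1 hb)
  have := Finset.card_le_card h
  rw [List.toFinset_card_of_nodup hx.nodup] at this
  have := card_splitters_le (s₀ := s₀) (s₁ := s₁) (α := α)
  omega

/-- An iteration preserves the invariant and is paid for by the potential; if `{s₀, s₁}` is split,
all constellations reachable from `s₁` are inserted into the search tree. -/
theorem IsExampleGraph.total_iteration (hG : IsExampleGraph k G s₀ s₁ α)
    (hx : MainInvariant s₀ s₁ α x) (hp : p ∈ LTS.smallBlocks x) :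
    ∃ n, 1 + n ≤ potential G s₀ s₁ α x ∧ Total (G.iteration x p) n fun r c =>
      ∃ P, r = .inl (LTS.nextK x p P) ∧ MainInvariant s₀ s₁ α (LTS.nextK x p P) ∧
        1 + c + potential G s₀ s₁ α (LTS.nextK x p P) ≤ potential G s₀ s₁ α x ∧
        (x.blocks = coarse s₀ s₁ α → P = coarse s₀ s₁ α ∨
          ((p.2 = {α 0} ∨ ∀ j : Fin k, α j.succ ∉ x.cons.getD p.1 ∅ \ p.2) ∧
            (G.reachCons (LTS.nextK x p P).cons {s₁}).card.factorial ≤ 4 ^ c)) := by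
  have hne := coarse_ne_fine (α := α) hG.ne
  have hpot : ∀ P, (LTS.nextK x p P).blocks = P := fun _ => rfl
  have hsum := hx.sum_next (G := G) hp
  rcases hx.blocks with hxb | hxb
  · by_cases hcalm : p.2 ≠ {α 0} ∧
      (α 0 ∈ x.cons.getD p.1 ∅ \ p.2 → ∃ j : Fin k, α j.succ ∈ x.cons.getD p.1 ∅ \ p.2)
    · have hinv := hx.next hp (Or.inl rfl) (fun _ => ⟨hxb, hcalm⟩) hG.notMem_pair
      obtain ⟨hw, ht⟩ := hG.total_iteration_coarse hxb hp.2.1 hcalm.1 hcalm.2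
      have hs := hsum (coarse s₀ s₁ α)
      refine ⟨_, ?_, ht.mono le_rfl ?_⟩
      · rw [hw, potential]
        omega
      · rintro _ c hc rfl
        refine ⟨_, rfl, hinv, ?_, fun _ => Or.inl rfl⟩
        simp only [potential, hpot, if_pos hxb, if_true]
        omega
    -- The splitter {s₀, s₁} is impossible here: by `stable`, the constellation of α 0 contains some
    -- α j.succ, and removing {s₀, s₁} would leave it there.
    · obtain ⟨i, hi, hcase⟩ : ∃ i, p.2 = {α i} ∧ (i = 0 ∨ (α 0 ∈ x.cons.getD p.1 ∅ \ p.2 ∧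
          ∀ j : Fin k, α j.succ ∉ x.cons.getD p.1 ∅ \ p.2)) := by
        by_cases h₀ : p.2 = {α 0}
        · exact ⟨0, h₀, Or.inl rfl⟩
        · have h₁ : α 0 ∈ x.cons.getD p.1 ∅ \ p.2 ∧
              ∀ j : Fin k, α j.succ ∉ x.cons.getD p.1 ∅ \ p.2 := by
            by_contra h
            refine hcalm ⟨h₀, fun h' => ?_⟩
            by_contra h''
            exact h ⟨h', fun j hj => h'' ⟨j, hj⟩⟩
          rcases mem_coarse.1 (hxb ▸ hp.2.1) with h | ⟨i, h⟩
          · obtain ⟨j, hj⟩ := hx.stable hxb p.1 (Finset.mem_sdiff.1 h₁.1).1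
            refine absurd (Finset.mem_sdiff.2 ⟨hj, ?_⟩) (h₁.2 j)
            rw [h]
            exact hG.notMem_pair _
          · exact ⟨i, h, Or.inr h₁⟩
      have hinv := hx.next hp (Or.inr rfl) (fun h => absurd h.symm hne) hG.notMem_pair
      have ht := hG.total_iteration_split hxb hi hcase
      have hs := hsum (fine s₀ s₁ α)
      have hz := LTS.splitTime_mono (le_refl G.trans.card) hinv.length_cons_le
      have hw : 1 + (G.weight p.2 - 1) = G.weight p.2 := by simp only [LTS.weight]; omega
      refine ⟨_, ?_, ht.mono le_rfl ?_⟩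
      · rw [potential, if_pos hxb]
        omega
      · rintro _ c hc ⟨rfl, hf⟩
        refine ⟨_, rfl, hinv, ?_, fun _ => Or.inr ⟨?_, hf⟩⟩
        · simp only [potential, hpot, if_pos hxb, if_neg hne.symm]
          omega
        · rcases hcase with rfl | h
          · exact Or.inl hi
          · exact Or.inr h.2
  · have hinv := hx.next hp (Or.inr rfl) (fun h => absurd h.symm hne) hG.notMem_pair
    obtain ⟨hw, ht⟩ := hG.total_iteration_fine hxb hp.2.1
    have hs := hsum (fine s₀ s₁ α)
    refine ⟨_, ?_, ht.mono le_rfl ?_⟩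
    · rw [hw, potential]
      omega
    · rintro _ c hc rfl
      refine ⟨_, rfl, hinv, ?_, fun h => absurd (h.symm.trans hxb) hne⟩
      simp only [potential, hpot, hxb, if_neg hne.symm]
      omega

/-- Of two disjoint blocks in one constellation, the smaller has at most half of its states. -/
theorem IsExampleGraph.smallBlocks_nonempty (hG : IsExampleGraph k G s₀ s₁ α)
    (hx : MainInvariant s₀ s₁ α x)
    (h : ∃ i < x.cons.length, 1 < (x.blocks.filter fun B => B ⊆ x.cons.getD i ∅).card) :
    (LTS.smallBlocks x).Nonempty := by
  obtain ⟨i, hi, h⟩ := h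
  obtain ⟨B, hB, B', hB', hne⟩ := Finset.one_lt_card.1 h
  rw [Finset.mem_filter] at hB hB'
  have hd : Disjoint B B' := by
    rw [Finset.disjoint_left]
    intro s hs hs'
    refine hne ?_
    rcases hx.blocks with hb | hb
    · exact hG.coarse_disjoint B (hb ▸ hB.1) B' (hb ▸ hB'.1) s hs hs'
    · exact IsExampleGraph.fine_disjoint B (hb ▸ hB.1) B' (hb ▸ hB'.1) s hs hs'
  have hc := Finset.card_le_card (Finset.union_subset hB.2 hB'.2)
  rw [Finset.card_union_of_disjoint hd] at hc
  rcases le_total B.card B'.card with hle | hle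
  · exact ⟨(i, B), hi, hB.1, hB.2, by dsimp only; omega⟩
  · exact ⟨(i, B'), hi, hB'.1, hB'.2, by dsimp only; omega⟩

theorem IsExampleGraph.total_refineK (hG : IsExampleGraph k G s₀ s₁ α)
    (hx : MainInvariant s₀ s₁ α x) :
    Total (G.refineK x) (potential G s₀ s₁ α x) fun _ _ => True := by
  rw [LTS.refineK_eq]
  refine total_loop (Q := fun _ => True) (MainInvariant s₀ s₁ α) (potential G s₀ s₁ α) ?_ x hx
  intro x hx
  refine ⟨potential G s₀ s₁ α x - 1, by rw [potential]; omega, ?_⟩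
  unfold LTS.bodyK
  split_ifs with h
  · refine Total.pick_bind (hG.smallBlocks_nonempty hx h) fun p hp => ?_
    obtain ⟨n, hn, ht⟩ := hG.total_iteration hx hp
    refine ht.mono (by omega) ?_
    rintro _ c - ⟨P, rfl, hinv, hle, -⟩
    exact ⟨hinv, hle⟩
  · exact Total.pure trivial

/-- This lets a condition on the final list of splitters be read off at every earlier moment of the
execution. -/
theorem IsExampleGraph.trace_prefix (hG : IsExampleGraph k G s₀ s₁ α)
    (hx : MainInvariant s₀ s₁ α x) {out : Finset (Finset S) × List (Finset S)} {t : ℕ}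
    (h : G.refineK x (some out) t) : x.trace <+: out.2 := by
  rw [LTS.refineK_eq] at h
  generalize hr : some out = r at h
  change LoopExec _ _ _ _ at h
  induction h with
  | start => cases hr
  | cut => cases hr
  | next s s' r c c' hb _ ih =>
    rcases bodyK_some hb with ⟨p, hp, hi⟩ | h
    · obtain ⟨n, -, ht⟩ := hG.total_iteration hx hp
      obtain ⟨-, P, h, hinv, -⟩ := ht.2.1 _ _ hi
      obtain rfl := Sum.inl.inj h
      exact (List.prefix_append _ _).trans (ih hinv hr)
    · cases h
  | done s b c hb =>
    obtain rfl := Option.some.inj hr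
    rcases bodyK_some hb with ⟨p, hp, hi⟩ | h
    · obtain ⟨n, -, ht⟩ := hG.total_iteration hx hp
      obtain ⟨-, P, h, -⟩ := ht.2.1 _ _ hi
      cases h
    · rw [Sum.inr.inj h]

/-- The blocks `{α j}` in the first constellation can be used as splitters in any order. -/
theorem IsExampleGraph.exists_execution (hG : IsExampleGraph k G s₀ s₁ α) (l : List (Fin k))
    (hx : MainInvariant s₀ s₁ α x) (hl : l.Nodup) (h₀ : α 0 ∈ x.cons.getD 0 ∅)
    (h : ∀ j ∈ l, α j.succ ∈ x.cons.getD 0 ∅) :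
    ∃ out t, G.refineK x (some out) t ∧ x.trace ++ l.map (fun j => {α j.succ}) <+: out.2 := by
  induction l generalizing x with
  | nil =>
    obtain ⟨out, t, ht⟩ := (hG.total_refineK hx).2.2
    exact ⟨out, t, ht, by simpa using hG.trace_prefix hx ht⟩
  | cons j l ih =>
    have hlen : 0 < x.cons.length := by rw [hx.length]; omega
    have hb : ∀ i, ({α i} : Finset S) ∈ x.blocks := by
      intro i
      rcases hx.blocks with h | h
      · rw [h, mem_coarse]; exact Or.inr ⟨i, rfl⟩
      · rw [h, mem_fine]; exact Or.inr (Or.inr ⟨i, rfl⟩)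
    have hα : α 0 ≠ α j.succ := fun h => (Fin.succ_ne_zero j) (hG.inj h).symm
    have hj := h j (by simp)
    have hp : ((0, {α j.succ}) : ℕ × Finset S) ∈ LTS.smallBlocks x := by
      refine ⟨hlen, hb _, Finset.singleton_subset_iff.2 hj, ?_⟩
      -- The state α 0 stays in the first constellation, so that {α j.succ} is at most half of it.
      have hsub : {α 0, α j.succ} ⊆ x.cons.getD 0 ∅ := by
        intro s hs
        rcases Finset.mem_insert.1 hs with rfl | hs
        · exact h₀
        · rw [Finset.mem_singleton.1 hs]; exact hj
      have := Finset.card_le_card hsub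
      rw [Finset.card_pair hα] at this
      simpa using this
    have hcond : ∃ i < x.cons.length,
        1 < (x.blocks.filter fun B => B ⊆ x.cons.getD i ∅).card := by
      refine ⟨0, hlen, Finset.one_lt_card.2 ⟨{α 0}, Finset.mem_filter.2 ⟨hb 0,
        Finset.singleton_subset_iff.2 h₀⟩, {α j.succ}, Finset.mem_filter.2 ⟨hb _,
        Finset.singleton_subset_iff.2 hj⟩, fun h => hα (Finset.singleton_injective h)⟩⟩
    obtain ⟨n, -, ht⟩ := hG.total_iteration hx hp
    obtain ⟨r, c, hr⟩ := ht.2.2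
    obtain ⟨-, P, rfl, hinv, -⟩ := ht.2.1 _ _ hr
    obtain ⟨hjl, hl⟩ := List.nodup_cons.1 hl
    have hmem : ∀ s ∈ x.cons.getD 0 ∅, s ≠ α j.succ →
        s ∈ (LTS.nextK x (0, {α j.succ}) P).cons.getD 0 ∅ := by
      intro s hs hne
      rw [getD_nextK P hlen, if_pos rfl]
      exact Finset.mem_sdiff.2 ⟨hs, fun h => hne (Finset.mem_singleton.1 h)⟩
    obtain ⟨out, t, ht', hpre⟩ := ih hinv hl (hmem _ h₀ hα) fun i hi =>
      hmem _ (h i (by simp [hi])) fun he => hjl (Fin.succ_injective _ (hG.inj he) ▸ hi)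
    refine ⟨out, _, .next x _ _ c t (bodyK_of_iteration hcond hp hr) ht', ?_⟩
    simpa [LTS.nextK] using hpre

/-- If the first `k` splitters are the blocks `{α j}`, then `k` constellations are inserted into
the search tree when `{s₀, s₁}` is split. -/
theorem IsExampleGraph.factorial_le (hG : IsExampleGraph k G s₀ s₁ α)
    (hx : MainInvariant s₀ s₁ α x) (hxb : x.blocks = coarse s₀ s₁ α)
    {out : Finset (Finset S) × List (Finset S)} {t : ℕ} (h : G.refineK x (some out) t)
    (hout : (out.2.take k).Perm ((List.finRange k).map fun j => {α j.succ}))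
    (hcons : ∃ C, x.cons = C :: x.trace ∧ ∀ s ∈ G.states, (∀ b ∈ x.trace, s ∉ b) → s ∈ C)
    (htr : ∀ b ∈ x.trace, ∃ j : Fin k, b = {α j.succ}) : k.factorial ≤ 4 ^ t := by
  -- While {s₀, s₁} is whole, fewer than k splitters have been used. Otherwise every α j.succ would
  -- be in a constellation of its own, whereas `stable` puts one of them together with α 0 in
  -- constellation 0.
  have hnotall : ∀ {x : KState S}, MainInvariant s₀ s₁ α x → x.blocks = coarse s₀ s₁ α →
      (∃ C, x.cons = C :: x.trace ∧ ∀ s ∈ G.states, (∀ b ∈ x.trace, s ∉ b) → s ∈ C) →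
      (∀ b ∈ x.trace, ∃ j : Fin k, b = {α j.succ}) → x.trace <+: out.2 →
      x.trace.length < k := by
    rintro x hx hxb ⟨C, hC, hCs⟩ htr hpre
    by_contra! hlen
    have htake : out.2.take k = x.trace.take k := by
      obtain ⟨r, hr⟩ := hpre
      rw [← hr, List.take_append_of_le_length hlen]
    have hall : ∀ j : Fin k, {α j.succ} ∈ x.trace := fun j => by
      refine List.mem_of_mem_take (i := k) ?_
      rw [← htake, hout.mem_iff]
      exact List.mem_map.2 ⟨j, List.mem_finRange j, rfl⟩
    have h₀ : α 0 ∈ x.cons.getD 0 ∅ := by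
      rw [hC]
      refine hCs _ ((hG.mem_states _).2 (Or.inr (Or.inr ⟨0, rfl⟩))) fun b hb h => ?_
      obtain ⟨j, rfl⟩ := htr b hb
      exact Fin.succ_ne_zero j (hG.inj (Finset.mem_singleton.1 h)).symm
    obtain ⟨j, hj⟩ := hx.stable hxb 0 h₀
    obtain ⟨m, hm, hmj⟩ := List.getElem_of_mem (hall j)
    have hd := hx.disjoint 0 (m + 1) (by omega)
    refine Finset.disjoint_left.1 hd hj ?_
    rw [hC, List.getD_cons_succ, List.getD_eq_getElem _ _ hm, hmj]
    exact Finset.mem_singleton_self _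
  rw [LTS.refineK_eq] at h
  generalize hr : some out = r at h
  change LoopExec _ _ _ _ at h
  induction h with
  | start => cases hr
  | cut => cases hr
  | next s s' r c c' hb hrest ih =>
    subst hr
    rcases bodyK_some hb with ⟨p, hp, hi⟩ | h
    swap
    · cases h
    obtain ⟨n, -, ht⟩ := hG.total_iteration hx hp
    obtain ⟨-, P, h, hinv, -, hsplit⟩ := ht.2.1 _ _ hi
    obtain rfl := Sum.inl.inj h
    have hpre := hG.trace_prefix hinv hrest
    have hlt := hnotall hx hxb hcons htr ((List.prefix_append _ _).trans hpre)
    obtain ⟨j, hj⟩ : ∃ j : Fin k, p.2 = {α j.succ} := by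
      have hmem : p.2 ∈ out.2.take k := by
        obtain ⟨r, hr⟩ := hpre
        rw [← hr, List.mem_take_iff_getElem]
        refine ⟨s.trace.length, ?_, ?_⟩
        · simp [LTS.nextK]; omega
        · simp [LTS.nextK]
      rw [hout.mem_iff] at hmem
      obtain ⟨j, -, hj⟩ := List.mem_map.1 hmem
      exact ⟨j, hj.symm⟩
    obtain ⟨C, hC, hCs⟩ := hcons
    obtain ⟨i, X⟩ := p
    dsimp only at hj
    subst hj
    -- All constellations but the first are singletons, and no block fills at most half of a
    -- singleton.
    obtain rfl : i = 0 := by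
      by_contra hi0
      obtain ⟨m, rfl⟩ := Nat.exists_eq_succ_of_ne_zero hi0
      obtain ⟨h₁, -, -, h₂⟩ := hp
      dsimp only at h₁ h₂
      rw [hC, List.length_cons] at h₁
      have hm : m < s.trace.length := by omega
      rw [hC, List.getD_cons_succ, List.getD_eq_getElem _ _ hm] at h₂
      obtain ⟨j', hj'⟩ := htr _ (List.getElem_mem hm)
      rw [hj'] at h₂
      simp at h₂
    have hcons' : (LTS.nextK s (0, {α j.succ}) P).cons =
        (C \ {α j.succ}) :: (LTS.nextK s (0, {α j.succ}) P).trace := by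
      simp [LTS.nextK, hC]
    have hCs' : ∀ u ∈ G.states, (∀ b ∈ (LTS.nextK s (0, {α j.succ}) P).trace, u ∉ b) →
        u ∈ C \ {α j.succ} := by
      intro u hu hb
      refine Finset.mem_sdiff.2 ⟨hCs u hu fun b hb' => hb b ?_, hb _ ?_⟩
      · exact List.mem_append_left _ hb'
      · simp [LTS.nextK]
    have htr' : ∀ b ∈ (LTS.nextK s (0, {α j.succ}) P).trace, ∃ j : Fin k, b = {α j.succ} := by
      intro b hb
      rcases List.mem_append.1 hb with h | h
      · exact htr b h
      · exact ⟨j, List.mem_singleton.1 h⟩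
    rcases hsplit hxb with rfl | ⟨hcase, hf⟩
    · refine (ih hinv rfl ⟨_, hcons', hCs'⟩ htr' rfl).trans
        (Nat.pow_le_pow_right (by norm_num) (by omega))
    -- The split happens now. As the splitter is not {α 0}, the reason must be that the remainder
    -- contains no α j'.succ.
    · have hout : ∀ j' : Fin k, α j'.succ ∉ C \ {α j.succ} := by
        rcases hcase with h | h
        · exact absurd (hG.inj (Finset.singleton_injective h)) (Fin.succ_ne_zero j)
        · simpa [hC] using h
      -- Thus every α j'.succ has been a splitter, forms a constellation and is a successor of s₁;
      -- distinct j' give distinct constellations, so at least k keys are inserted.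
      have hreach : ∀ j' : Fin k, ∃ m ∈ G.reachCons (LTS.nextK s (0, {α j.succ}) P).cons {s₁},
          (LTS.nextK s (0, {α j.succ}) P).cons.getD m ∅ = {α j'.succ} := by
        intro j'
        have hex : {α j'.succ} ∈ (LTS.nextK s (0, {α j.succ}) P).trace := by
          by_contra hno
          refine hout j' (hCs' _ ((hG.mem_states _).2 (Or.inr (Or.inr ⟨_, rfl⟩)))
            fun b hb hmem => ?_)
          obtain ⟨i, rfl⟩ := htr' b hb
          rw [Finset.mem_singleton.1 hmem] at hno
          exact hno hb
        obtain ⟨m, hm, hmj⟩ := List.getElem_of_mem hex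
        have hget : (LTS.nextK s (0, {α j.succ}) P).cons.getD (m + 1) ∅ = {α j'.succ} := by
          rw [hcons', List.getD_cons_succ, List.getD_eq_getElem _ _ hm, hmj]
        refine ⟨m + 1, ?_, hget⟩
        refine Finset.mem_filter.2 ⟨Finset.mem_range.2 ?_, ?_⟩
        · rw [hcons', List.length_cons]
          omega
        · refine Finset.ne_empty_of_mem (a := (s₁, (), α j'.succ)) ?_
          refine Finset.mem_filter.2 ⟨G.mem_nonInert.2 ⟨hG.mem_trans_fst _, by simp, ?_⟩, ?_⟩
          · exact fun h => hG.ne₁ _ (Finset.mem_singleton.1 h.2)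
          · rw [hget]; exact Finset.mem_singleton_self _
      choose f hf₁ hf₂ using hreach
      have hinj : Function.Injective f := fun a b hab => by
        have : ({α a.succ} : Finset S) = {α b.succ} := by rw [← hf₂ a, ← hf₂ b, hab]
        exact Fin.succ_injective _ (hG.inj (Finset.singleton_injective this))
      have hcard : k ≤ (G.reachCons (LTS.nextK s (0, {α j.succ}) P).cons {s₁}).card := by
        have := Finset.card_le_card_of_injOn (s := (Finset.univ : Finset (Fin k))) f
          (fun a _ => hf₁ a) hinj.injOn
        simpa using this
      exact (Nat.factorial_le hcard).trans (hf.trans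
        (Nat.pow_le_pow_right (by norm_num) (by omega)))
  | done s b c hb =>
    obtain rfl := Option.some.inj hr
    rcases bodyK_some hb with ⟨p, hp, hi⟩ | h
    · obtain ⟨n, -, ht⟩ := hG.total_iteration hx hp
      obtain ⟨-, P, h, -⟩ := ht.2.1 _ _ hi
      cases h
    · obtain rfl := Sum.inr.inj h
      -- The loop cannot end with the pair unsplit: fewer than k splitters would have been used in
      -- total.
      have := hnotall hx hxb hcons htr (List.prefix_refl _)
      have hlen := hout.length_eq
      simp at hlen
      omega

end Main

/-! #### The embedding of `A_k` -/

theorem LTS.reachers_eq {S A : Type} (G : LTS S A) {B : Finset S} {T : Finset (Tr S A)}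
    (h : ∀ s ∈ B, ∃ e ∈ T, e.1 = s) : G.reachers B T = B := by
  refine Finset.filter_true_of_mem fun s hs => ?_
  obtain ⟨e, he, rfl⟩ := h s hs
  exact ⟨e, he, .refl⟩

/-! ### The state at the start of the main loop -/

section Initial

variable {S AP : Type} {k : ℕ} {G : LTS S Unit} {s₀ s₁ : S} {α : Fin (k + 1) → S}

/-- Each state has a non-inert transition of its own, so the initial partition is the one by labels.
For s₀ this uses k ≥ 1. -/
theorem IsExampleGraph.initialBlocks_eq (hG : IsExampleGraph k G s₀ s₁ α) (hk : 1 ≤ k)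
    (K : Kripke S AP) (hl : K.label s₀ = K.label s₁) (hα : ∀ i, K.label (α i) ≠ K.label s₀)
    (hi : ∀ i j, K.label (α i) = K.label (α j) → i = j) :
    K.initialBlocks G = coarse s₀ s₁ α := by
  have hV : ∀ s, s = s₀ ∨ s = s₁ →
      (G.states.filter fun t => K.label t = K.label s) = {s₀, s₁} := by
    intro s hs
    have hs' : K.label s = K.label s₀ := by rcases hs with rfl | rfl <;> simp [hl]
    ext t
    simp only [Finset.mem_filter, hG.mem_states, Finset.mem_insert, Finset.mem_singleton, hs']
    constructor
    · rintro ⟨h | h | ⟨i, rfl⟩, h'⟩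
      · exact Or.inl h
      · exact Or.inr h
      · exact absurd h' (hα i)
    · rintro (rfl | rfl)
      · exact ⟨Or.inl rfl, rfl⟩
      · exact ⟨Or.inr (Or.inl rfl), hl.symm⟩
  have hS : ∀ i, (G.states.filter fun t => K.label t = K.label (α i)) = {α i} := by
    intro i
    ext t
    simp only [Finset.mem_filter, hG.mem_states, Finset.mem_singleton]
    constructor
    · rintro ⟨rfl | rfl | ⟨j, rfl⟩, h'⟩
      · exact absurd h'.symm (hα i)
      · exact absurd (hl.trans h').symm (hα i)
      · rw [hi _ _ h']
    · rintro rfl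
      exact ⟨Or.inr (Or.inr ⟨i, rfl⟩), rfl⟩
  have hRV : G.reachers {s₀, s₁} (G.nonInert {s₀, s₁}) = {s₀, s₁} := by
    refine G.reachers_eq fun s hs => ?_
    rcases Finset.mem_insert.1 hs with rfl | hs
    · exact ⟨_, G.mem_nonInert.2 ⟨hG.mem_trans_zero ⟨0, hk⟩, by simp,
        fun h => hG.notMem_pair _ h.2⟩, rfl⟩
    · obtain rfl := Finset.mem_singleton.1 hs
      exact ⟨_, G.mem_nonInert.2 ⟨hG.mem_trans_fst 0, by simp,
        fun h => hG.notMem_pair _ h.2⟩, rfl⟩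
  have hRS : ∀ i, G.reachers {α i} (G.nonInert {α i}) = {α i} := by
    intro i
    refine G.reachers_eq fun s hs => ?_
    obtain rfl := Finset.mem_singleton.1 hs
    refine Fin.cases ?_ (fun j => ?_) i
    · exact ⟨(α 0, (), s₁), G.mem_nonInert.2 ⟨(hG.mem_trans _).2
        (Or.inr (Or.inr (Or.inr (Or.inr ⟨rfl, rfl⟩)))), by simp,
        fun h => hG.ne₁ _ (Finset.mem_singleton.1 h.2).symm⟩, rfl⟩
    · exact ⟨(α j.succ, (), s₀), G.mem_nonInert.2 ⟨(hG.mem_trans _).2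
        (Or.inr (Or.inr (Or.inr (Or.inl ⟨j, rfl, rfl⟩)))), by simp,
        fun h => hG.ne₀ _ (Finset.mem_singleton.1 h.2).symm⟩, rfl⟩
  have hself : ∀ (B X : Finset S), B.Nonempty → G.reachers B (G.nonInert B) = B →
      ((X ≠ ∅ ∧ (X = G.reachers B (G.nonInert B) ∨ X = B \ G.reachers B (G.nonInert B))) ↔
        X = B) := by
    intro B X h₀ h
    rw [h, sdiff_self, Finset.bot_eq_empty]
    constructor
    · rintro ⟨h₁, h₂ | h₂⟩
      · exact h₂
      · exact absurd h₂ h₁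
    · rintro rfl
      exact ⟨h₀.ne_empty, Or.inl rfl⟩
  ext X
  simp only [Kripke.initialBlocks, Finset.mem_erase, Finset.mem_biUnion, Finset.mem_image,
    Finset.mem_insert, Finset.mem_singleton, mem_coarse]
  constructor
  · rintro ⟨h₀, _, ⟨s, hs, rfl⟩, hX⟩
    rcases (hG.mem_states s).1 hs with h | h | ⟨i, rfl⟩
    · rw [hV s (Or.inl h)] at hX
      exact Or.inl ((hself _ X (Finset.insert_nonempty _ _) hRV).1 ⟨h₀, hX⟩)
    · rw [hV s (Or.inr h)] at hX
      exact Or.inl ((hself _ X (Finset.insert_nonempty _ _) hRV).1 ⟨h₀, hX⟩)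
    · rw [hS i] at hX
      exact Or.inr ⟨i, (hself _ X (Finset.singleton_nonempty _) (hRS i)).1 ⟨h₀, hX⟩⟩
  · rintro (h | ⟨i, h⟩)
    · have := (hself _ X (Finset.insert_nonempty _ _) hRV).2 h
      exact ⟨this.1, _, ⟨s₀, (hG.mem_states _).2 (Or.inl rfl), hV s₀ (Or.inl rfl)⟩, this.2⟩
    · have := (hself _ X (Finset.singleton_nonempty _) (hRS i)).2 h
      exact ⟨this.1, _, ⟨α i, (hG.mem_states _).2 (Or.inr (Or.inr ⟨i, rfl⟩)), hS i⟩, this.2⟩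

theorem IsExampleGraph.states_card_le (hG : IsExampleGraph k G s₀ s₁ α) :
    G.states.card ≤ k + 3 := by
  have h : G.states ⊆ {s₀, s₁} ∪ Finset.univ.image α := by
    intro s hs
    rcases (hG.mem_states s).1 hs with rfl | rfl | ⟨i, rfl⟩ <;> simp
  have h₁ := Finset.card_union_le {s₀, s₁} (Finset.univ.image α)
  have h₂ : ({s₀, s₁} : Finset S).card ≤ 2 := Finset.card_le_two
  have h₃ : (Finset.univ.image α).card ≤ k + 1 := Finset.card_image_le.trans (by simp)
  have := Finset.card_le_card h
  omega

theorem IsExampleGraph.mainInvariant_initial (hG : IsExampleGraph k G s₀ s₁ α) (hk : 1 ≤ k) :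
    MainInvariant s₀ s₁ α { blocks := coarse s₀ s₁ α, cons := [G.states], trace := [] } := by
  have hget : ∀ i, i ≠ 0 → ([G.states] : List (Finset S)).getD i ∅ = ∅ := by
    intro i hi
    obtain ⟨m, rfl⟩ := Nat.exists_eq_succ_of_ne_zero hi
    simp
  refine ⟨Or.inl rfl, ?_, List.nodup_nil, by simp, by simp, rfl, ?_⟩
  · intro i j hij
    by_cases hi : i = 0
    · rw [hget j (by omega)]
      exact Finset.disjoint_empty_right _
    · rw [hget i hi]
      exact Finset.disjoint_empty_left _
  · intro _ i hi
    by_cases h : i = 0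
    · subst h
      exact ⟨⟨0, hk⟩, (hG.mem_states _).2 (Or.inr (Or.inr ⟨_, rfl⟩))⟩
    · dsimp only at hi
      rw [hget i h] at hi
      simp at hi

end Initial

section Embedding

variable {k : ℕ}

/-- The state `⟨aᵢ, t⟩` of the embedding of `A_k`. -/
def actionState (k : ℕ) (i : Fin (k + 1)) : Fin 2 ⊕ (Option (Fin (k + 1)) × Fin 2) :=
  Sum.inr (some i, if i = 0 then 1 else 0)

theorem actionState_zero : actionState k 0 = Sum.inr (some 0, 1) := by
  simp [actionState]

theorem actionState_succ (j : Fin k) : actionState k j.succ = Sum.inr (some j.succ, 0) := by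
  simp [actionState, Fin.succ_ne_zero]

theorem mem_exampleLTS_trans {e : Tr (Fin 2) (Option (Fin (k + 1)))} :
    e ∈ (exampleLTS k).trans ↔ e = (1, none, 0) ∨ e = (1, some 0, 1) ∨
      (∃ j : Fin k, e = (1, some j.succ, 0)) ∨ ∃ j : Fin k, e = (0, some j.succ, 0) := by
  simp [exampleLTS, eq_comm]

theorem mem_exampleLTS_visible {e : Tr (Fin 2) (Option (Fin (k + 1)))} :
    e ∈ (exampleLTS k).visible ↔ e = (1, some 0, 1) ∨
      (∃ j : Fin k, e = (1, some j.succ, 0)) ∨ ∃ j : Fin k, e = (0, some j.succ, 0) := by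
  have ht : (exampleLTS k).tau = none := rfl
  simp only [LTS.visible, Finset.mem_filter, mem_exampleLTS_trans, ht]
  constructor
  · rintro ⟨rfl | h | h, h'⟩
    · exact absurd rfl h'
    · exact Or.inl h
    · exact Or.inr h
  · rintro (rfl | ⟨j, rfl⟩ | ⟨j, rfl⟩)
    · exact ⟨Or.inr (Or.inl rfl), by simp⟩
    · exact ⟨Or.inr (Or.inr (Or.inl ⟨j, rfl⟩)), by simp⟩
    · exact ⟨Or.inr (Or.inr (Or.inr ⟨j, rfl⟩)), by simp⟩

theorem mem_exampleLTS_tauT {e : Tr (Fin 2) (Option (Fin (k + 1)))} :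
    e ∈ (exampleLTS k).tauT (exampleLTS k).states (exampleLTS k).states ↔ e = (1, none, 0) := by
  have ht : (exampleLTS k).tau = none := rfl
  have hs : ∀ s, s ∈ (exampleLTS k).states := fun s => Finset.mem_univ s
  simp only [LTS.mem_tauT, mem_exampleLTS_trans, ht, hs, and_true]
  constructor
  · rintro ⟨h | rfl | ⟨j, rfl⟩ | ⟨j, rfl⟩, h'⟩
    · exact h
    all_goals simp at h'
  · rintro rfl
    exact ⟨Or.inl rfl, rfl⟩

theorem isExampleGraph_embed (k : ℕ) :
    IsExampleGraph k (exampleLTS k).embed.graph (Sum.inl 0) (Sum.inl 1) (actionState k) where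
  ne := by simp
  inj := fun i j h => by
    simpa [actionState] using congrArg (fun x => x.elim (fun _ => none) (·.1)) h
  ne₀ := fun i => by simp [actionState]
  ne₁ := fun i => by simp [actionState]
  mem_states := fun s => by
    have hs : ∀ s, s ∈ (exampleLTS k).states := fun s => Finset.mem_univ s
    simp only [Kripke.graph, LTS.embed, Finset.mem_union, Finset.mem_image, hs, true_and,
      mem_exampleLTS_visible]
    constructor
    · rintro (⟨i, rfl⟩ | ⟨e, rfl | ⟨j, rfl⟩ | ⟨j, rfl⟩, rfl⟩)
      · fin_cases i
        · exact Or.inl rfl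
        · exact Or.inr (Or.inl rfl)
      · exact Or.inr (Or.inr ⟨0, actionState_zero.symm⟩)
      · exact Or.inr (Or.inr ⟨j.succ, (actionState_succ j).symm⟩)
      · exact Or.inr (Or.inr ⟨j.succ, (actionState_succ j).symm⟩)
    · rintro (rfl | rfl | ⟨i, rfl⟩)
      · exact Or.inl ⟨0, rfl⟩
      · exact Or.inl ⟨1, rfl⟩
      · refine Or.inr (Fin.cases ?_ (fun j => ?_) i)
        · exact ⟨_, Or.inl rfl, actionState_zero.symm⟩
        · exact ⟨_, Or.inr (Or.inl ⟨j, rfl⟩), (actionState_succ j).symm⟩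
  mem_trans := fun e => by
    obtain ⟨u, a, v⟩ := e
    simp only [Kripke.graph, LTS.embed, Finset.mem_union, Finset.mem_image,
      mem_exampleLTS_visible, mem_exampleLTS_tauT]
    constructor
    · rintro ⟨_, ((⟨e, rfl | ⟨j, rfl⟩ | ⟨j, rfl⟩, rfl⟩ | ⟨e, rfl | ⟨j, rfl⟩ | ⟨j, rfl⟩, rfl⟩) |
        ⟨e, rfl, rfl⟩), h⟩ <;> cases h
      · exact Or.inr (Or.inl ⟨rfl, 0, actionState_zero.symm⟩)
      · exact Or.inr (Or.inl ⟨rfl, j.succ, (actionState_succ j).symm⟩)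
      · exact Or.inr (Or.inr (Or.inl ⟨rfl, j, (actionState_succ j).symm⟩))
      · exact Or.inr (Or.inr (Or.inr (Or.inr ⟨actionState_zero.symm, rfl⟩)))
      · exact Or.inr (Or.inr (Or.inr (Or.inl ⟨j, (actionState_succ j).symm, rfl⟩)))
      · exact Or.inr (Or.inr (Or.inr (Or.inl ⟨j, (actionState_succ j).symm, rfl⟩)))
      · exact Or.inl ⟨rfl, rfl⟩
    · rintro (⟨rfl, rfl⟩ | ⟨rfl, i, rfl⟩ | ⟨rfl, j, rfl⟩ | ⟨j, rfl, rfl⟩ | ⟨rfl, rfl⟩)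
      · exact ⟨_, Or.inr ⟨_, rfl, rfl⟩, rfl⟩
      · refine Fin.cases ?_ (fun j => ?_) i
        · exact ⟨_, Or.inl (Or.inl ⟨_, Or.inl rfl, rfl⟩), by rw [actionState_zero]⟩
        · exact ⟨_, Or.inl (Or.inl ⟨_, Or.inr (Or.inl ⟨j, rfl⟩), rfl⟩), by rw [actionState_succ]⟩
      · exact ⟨_, Or.inl (Or.inl ⟨_, Or.inr (Or.inr ⟨j, rfl⟩), rfl⟩), by rw [actionState_succ]⟩
      · exact ⟨_, Or.inl (Or.inr ⟨_, Or.inr (Or.inr ⟨j, rfl⟩), rfl⟩), by rw [actionState_succ]⟩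
      · exact ⟨_, Or.inl (Or.inr ⟨_, Or.inl rfl, rfl⟩), by rw [actionState_zero]⟩

/-- The only transition between equally labelled states is s₁ → s₀, so there is no cycle to
contract. -/
theorem contract_embed (k : ℕ) :
    ((exampleLTS k).embed.graph.contract fun s t =>
      (exampleLTS k).embed.label s = (exampleLTS k).embed.label t) =
      (exampleLTS k).embed.graph := by
  have hG := isExampleGraph_embed k
  refine LTS.contract_eq _ ?_ fun s => hG.loopless s _
  have key : ∀ s t, Relation.ReflTransGen (fun u v => (exampleLTS k).embed.label u =
      (exampleLTS k).embed.label v ∧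
        (u, (exampleLTS k).embed.graph.tau, v) ∈ (exampleLTS k).embed.graph.trans) s t →
      s = t ∨ (s = Sum.inl 1 ∧ t = Sum.inl 0) := by
    intro s t h
    induction h with
    | refl => exact Or.inl rfl
    | @tail u v _ h ih =>
      have huv : u = Sum.inl 1 ∧ v = Sum.inl 0 := by
        obtain ⟨h₁, h₂⟩ := h
        rcases (hG.mem_trans _).1 h₂ with
          ⟨h, h'⟩ | ⟨h, i, h'⟩ | ⟨h, j, h'⟩ | ⟨j, h, h'⟩ | ⟨h, h'⟩ <;>
          dsimp only at h h'
        · exact ⟨h, h'⟩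
        all_goals
          rw [h, h'] at h₁
          simp [LTS.embed, actionState] at h₁
      rcases ih with rfl | ⟨rfl, rfl⟩
      · exact Or.inr huv
      · exact absurd huv.1 (by simp)
  rintro s t ⟨h₁, h₂⟩
  rcases key s t h₁ with h | ⟨rfl, rfl⟩
  · exact h
  · rcases key _ _ h₂ with h | ⟨h, -⟩
    · exact h.symm
    · exact absurd h (by simp)

end Embedding

theorem Alg.tick_bind_some {β : Type} {f : Unit → Alg β} {n c : ℕ} {b : β} :
    (tick n >>= f) (some b) c ↔ ∃ c', f () (some b) c' ∧ c = n + c' := by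
  constructor
  · rintro (⟨h, -⟩ | ⟨⟨⟩, c₁, c₂, ⟨h, -⟩ | ⟨-, rfl⟩, h₂, rfl⟩)
    · cases h
    · cases h
    · exact ⟨c₂, h₂, rfl⟩
  · rintro ⟨c', h, rfl⟩
    exact Or.inr ⟨(), n, c', Or.inr ⟨rfl, rfl⟩, h, rfl⟩

/-! ### Sizes -/

theorem exampleLTS_states_card (k : ℕ) : (exampleLTS k).states.card = 2 := rfl

theorem exampleLTS_trans_card (k : ℕ) : (exampleLTS k).trans.card = 2 * k + 2 := by
  have h₁ : (Finset.univ.image fun i : Fin k =>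
      ((1, some i.succ, 0) : Tr (Fin 2) (Option (Fin (k + 1))))).card = k := by
    rw [Finset.card_image_of_injective _ fun i j h => by simpa using h]
    simp
  have h₀ : (Finset.univ.image fun i : Fin k =>
      ((0, some i.succ, 0) : Tr (Fin 2) (Option (Fin (k + 1))))).card = k := by
    rw [Finset.card_image_of_injective _ fun i j h => by simpa using h]
    simp
  unfold exampleLTS
  dsimp only
  rw [Finset.card_union_of_disjoint, Finset.card_union_of_disjoint, h₁, h₀, Finset.card_pair]
  · omega
  · simp
  · rw [Finset.disjoint_left]
    intro e he he'
    simp only [Finset.mem_insert, Finset.mem_singleton, Finset.mem_image, Finset.mem_univ,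
      true_and] at he he'
    obtain ⟨j, rfl⟩ := he'
    simp [Fin.succ_ne_zero] at he
  · rw [Finset.disjoint_left]
    intro e he he'
    simp only [Finset.mem_union, Finset.mem_insert, Finset.mem_singleton, Finset.mem_image,
      Finset.mem_univ, true_and] at he he'
    obtain ⟨j, rfl⟩ := he'
    simp at he

theorem Kripke.graph_trans_card {S AP : Type} (K : Kripke S AP) :
    K.graph.trans.card = K.trans.card := by
  refine Finset.card_image_of_injective _ ?_
  rintro ⟨a, b⟩ ⟨c, d⟩ h
  simpa using h

/-! ### Running time of GJKW17 on `A_k` -/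

section GJKW17

variable {k : ℕ}

/-- The initial state of the main loop. -/
def exampleInit (k : ℕ) : KState (Fin 2 ⊕ (Option (Fin (k + 1)) × Fin 2)) where
  blocks := coarse (Sum.inl 0) (Sum.inl 1) (actionState k)
  cons := [(exampleLTS k).embed.graph.states]
  trace := []

/-- The steps before the main loop. -/
def preparationTime (k : ℕ) : ℕ :=
  (exampleLTS k).states.card + (exampleLTS k).trans.card +
    ((exampleLTS k).embed.states.card + (exampleLTS k).embed.trans.card +
    ((exampleLTS k).embed.graph.states.card + (exampleLTS k).embed.graph.trans.card))

theorem gjkw17_eq (hk : 1 ≤ k) : (exampleLTS k).gjkw17 = (do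
    tick ((exampleLTS k).states.card + (exampleLTS k).trans.card)
    tick ((exampleLTS k).embed.states.card + (exampleLTS k).embed.trans.card)
    tick ((exampleLTS k).embed.graph.states.card + (exampleLTS k).embed.graph.trans.card)
    (exampleLTS k).embed.graph.refineK (exampleInit k)) := by
  have hG := isExampleGraph_embed k
  have hb := hG.initialBlocks_eq hk (exampleLTS k).embed rfl
    (fun i => by simp [LTS.embed, actionState]) (fun i j h => by
      simpa [LTS.embed, actionState] using h)
  unfold LTS.gjkw17 exampleInit
  simp only [contract_embed k, hb]

theorem gjkw17_some (hk : 1 ≤ k) {out t} : (exampleLTS k).gjkw17 (some out) t ↔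
    ∃ t', (exampleLTS k).embed.graph.refineK (exampleInit k) (some out) t' ∧
      t = preparationTime k + t' := by
  rw [gjkw17_eq hk]
  simp only [Alg.tick_bind_some, preparationTime]
  constructor
  · rintro ⟨_, ⟨_, ⟨c, h, rfl⟩, rfl⟩, rfl⟩
    exact ⟨c, h, by omega⟩
  · rintro ⟨c, h, rfl⟩
    exact ⟨_, ⟨_, ⟨c, h, rfl⟩, rfl⟩, by omega⟩

theorem preparationTime_le (k : ℕ) : preparationTime k ≤ 10 * k + 16 := by
  have hG := isExampleGraph_embed k
  have h₁ := hG.states_card_le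
  have h₂ := hG.trans_card_le
  have h₃ := (exampleLTS k).embed.graph_trans_card
  have h₄ : (exampleLTS k).embed.graph.states = (exampleLTS k).embed.states := rfl
  have h₅ := exampleLTS_trans_card k
  have h₆ := exampleLTS_states_card k
  unfold preparationTime
  rw [h₄] at h₁ ⊢
  omega

/-- The linear part adds the preparation, 10k + 16, all weights, 283k + 307, the linear part 9k + 24
of the split, and 1. -/
theorem gjkw17_le (hk : 1 ≤ k) {r t} (h : (exampleLTS k).gjkw17 r t) :
    t ≤ 302 * k + 348 + (k + 5) * (12 + 6 * Nat.log 2 (2 * (k + 6))) := by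
  have hG := isExampleGraph_embed k
  have ht : Total ((exampleLTS k).embed.graph.refineK (exampleInit k)) _ fun _ _ => True :=
    hG.total_refineK (hG.mainInvariant_initial hk)
  have hle : t ≤ preparationTime k + potential (exampleLTS k).embed.graph (Sum.inl 0) (Sum.inl 1)
      (actionState k) (exampleInit k) := by
    rw [gjkw17_eq hk] at h
    refine (Total.le (Total.tick_bind (Q := fun _ _ => True)
      (Total.tick_bind (Total.tick_bind ht))) h).trans ?_
    rw [preparationTime, exampleInit]
    omega
  have h₁ := preparationTime_le k
  have h₂ : potential (exampleLTS k).embed.graph (Sum.inl 0) (Sum.inl 1)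
      (actionState k) (exampleInit k) ≤ 283 * k + 307 + LTS.splitTime (3 * k + 3) (k + 5) + 1 := by
    unfold potential
    refine Nat.add_le_add_right (Nat.add_le_add ?_ ?_) 1
    · exact (Finset.sum_le_sum_of_subset (Finset.filter_subset _ _)).trans hG.sum_weight_le
    · rw [if_pos (show (exampleInit k).blocks =
        coarse (Sum.inl 0) (Sum.inl 1) (actionState k) from rfl)]
      exact LTS.splitTime_mono hG.trans_card_le le_rfl
  have h₃ : LTS.splitTime (3 * k + 3) (k + 5) =
      9 * k + 24 + (k + 5) * (12 + 6 * Nat.log 2 (2 * (k + 6))) := by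
    rw [LTS.splitTime]
    ring
  omega

theorem gjkw17_handlesFirst (hk : 1 ≤ k) :
    ∃ out t, (exampleLTS k).gjkw17 (some out) t ∧ HandlesFirst k out.2 := by
  have hG := isExampleGraph_embed k
  have hα : ∀ i, actionState k i ∈ (exampleInit k).cons.getD 0 ∅ := fun i =>
    (hG.mem_states _).2 (Or.inr (Or.inr ⟨i, rfl⟩))
  obtain ⟨out, t, h, hpre⟩ := hG.exists_execution (List.finRange k)
    (hG.mainInvariant_initial hk) (List.nodup_finRange k) (hα 0) fun j _ => hα _
  refine ⟨out, _, (gjkw17_some hk).2 ⟨t, h, rfl⟩, ?_⟩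
  obtain ⟨r, hr⟩ := hpre
  rw [HandlesFirst, ← hr, List.nil_append, List.take_left' (by simp)]
  simp only [actionState_succ]
  exact List.Perm.refl _

theorem factorial_le_of_handlesFirst (hk : 1 ≤ k) {out t}
    (h : (exampleLTS k).gjkw17 (some out) t) (hout : HandlesFirst k out.2) :
    k.factorial ≤ 4 ^ t := by
  have hG := isExampleGraph_embed k
  obtain ⟨t', ht', rfl⟩ := (gjkw17_some hk).1 h
  refine (hG.factorial_le (hG.mainInvariant_initial hk) rfl ht' ?_ ⟨_, rfl, fun s hs _ => hs⟩
    (by simp)).trans (Nat.pow_le_pow_right (by norm_num) (by omega))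
  simp only [actionState_succ]
  exact hout

/-! #### Asymptotic bounds -/

theorem le_mul_log (hk : 2 ≤ k) : (k : ℝ) ≤ 2 * (k * Real.log k) := by
  have hk' : (2 : ℝ) ≤ k := by exact_mod_cast hk
  have h₁ : Real.log 2 ≤ Real.log k := Real.log_le_log (by norm_num) hk'
  have h₂ := Real.log_two_gt_d9
  nlinarith

theorem upper_le_mul_log (hk : 2 ≤ k) :
    ((302 * k + 348 + (k + 5) * (12 + 6 * Nat.log 2 (2 * (k + 6))) : ℕ) : ℝ) ≤
      2000 * (k * Real.log k) := by
  have hk' : (2 : ℝ) ≤ k := by exact_mod_cast hk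
  have h₁ : Real.log 2 ≤ Real.log k := Real.log_le_log (by norm_num) hk'
  have h₂ := Real.log_two_gt_d9
  have h₃ := le_mul_log hk
  have h₄ : (Nat.log 2 (2 * (k + 6)) : ℝ) ≤ 6 * Real.log k := by
    -- The exponent 4 is forced by k = 2, where both sides of 2(k + 6) ≤ k⁴ equal 16; and 4 / log 2
    -- < 6.
    have h : 2 ^ Nat.log 2 (2 * (k + 6)) ≤ k ^ 4 :=
      (Nat.pow_log_le_self 2 (by omega)).trans (by nlinarith [pow_le_pow_left₀ (by norm_num) hk 3])
    have h' : ((2 : ℝ) ^ Nat.log 2 (2 * (k + 6))) ≤ (k : ℝ) ^ 4 := by exact_mod_cast h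
    have := Real.log_le_log (by positivity) h'
    rw [Real.log_pow, Real.log_pow] at this
    push_cast at this
    nlinarith [(Nat.cast_nonneg (Nat.log 2 (2 * (k + 6))) : (0 : ℝ) ≤ _)]
  push_cast
  have h₅ : ((k : ℝ) + 5) * (12 + 6 * (Nat.log 2 (2 * (k + 6)) : ℝ)) ≤
      (4 * k) * (60 * Real.log k) := by
    refine mul_le_mul (by linarith) (by linarith) (by positivity) (by positivity)
  nlinarith

/-- From k^k ≤ (k!)² ≤ 16^t, taking logarithms; log 16 = 4 log 2 is below 4. -/
theorem lower_mul_log {t : ℕ} (hk : 2 ≤ k) (h : k.factorial ≤ 4 ^ t) :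
    (k : ℝ) * Real.log k ≤ 4 * t := by
  have h₁ : k ^ k ≤ 16 ^ t := (pow_self_le_factorial_sq k).trans (by
    calc k.factorial ^ 2 ≤ (4 ^ t) ^ 2 := Nat.pow_le_pow_left h 2
      _ = 16 ^ t := by rw [← pow_mul, mul_comm, pow_mul]; norm_num)
  have h₂ : (k : ℝ) ^ k ≤ 16 ^ t := by exact_mod_cast h₁
  have h₃ := Real.log_le_log (by positivity) h₂
  rw [Real.log_pow, Real.log_pow, show (16 : ℝ) = 2 ^ 4 by norm_num, Real.log_pow] at h₃
  have h₄ := Real.log_two_lt_d9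
  push_cast at h₃
  nlinarith [(Nat.cast_nonneg t : (0 : ℝ) ≤ t)]

/-- Use 2k + 2 ≤ 3k and 2(k + 2) ≤ k³, with equality in the second at k = 2. -/
theorem size_mul_log_le (hk : 2 ≤ k) :
    ((exampleLTS k).trans.card : ℝ) * (Real.log (Fintype.card (Option (Fin (k + 1)))) +
      Real.log (exampleLTS k).states.card) ≤ 9 * (k * Real.log k) := by
  have hk' : (2 : ℝ) ≤ k := by exact_mod_cast hk
  have hlog : 0 ≤ Real.log k := Real.log_nonneg (by linarith)
  rw [exampleLTS_states_card, exampleLTS_trans_card]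
  have h₁ : Real.log (Fintype.card (Option (Fin (k + 1)))) + Real.log (2 : ℕ) ≤
      3 * Real.log k := by
    rw [← Real.log_mul (Nat.cast_ne_zero.2 (by simp)) (by norm_num), ← Nat.cast_ofNat (n := 3),
      ← Real.log_pow]
    refine Real.log_le_log (by simp; positivity) ?_
    simp only [Fintype.card_option, Fintype.card_fin]
    push_cast
    nlinarith [mul_self_nonneg ((k : ℝ) - 2), sq_nonneg (k : ℝ)]
  push_cast at h₁ ⊢
  calc (2 * (k : ℝ) + 2) * _ ≤ (3 * k) * (3 * Real.log k) := by
        refine mul_le_mul (by linarith) h₁ ?_ (by positivity)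
        have : (0 : ℝ) ≤ Real.log (Fintype.card (Option (Fin (k + 1)))) :=
          Real.log_natCast_nonneg _
        have := Real.log_nonneg (show (1 : ℝ) ≤ 2 by norm_num)
        positivity
    _ = _ := by ring

theorem gjkw17_not_linearithmic : ¬ ∃ C : ℝ, ∀ (S A : Type) [Fintype A] (G : LTS S A),
    2 ≤ G.states.card → G.states.card ≤ G.trans.card + 1 →
    ∀ r t, G.gjkw17 r t → (t : ℝ) ≤ C * (G.trans.card * Real.log G.states.card) := by
  rintro ⟨C, hC⟩
  -- A bound with constant `C` would give k log k ≤ 4t ≤ 4 |C| · 3k, that is log k ≤ 12 |C|.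
  set k := max 2 ⌈Real.exp (12 * |C| + 1)⌉₊ with hk
  have hk2 : 2 ≤ k := le_max_left _ _
  have hk' : (2 : ℝ) ≤ k := by exact_mod_cast hk2
  obtain ⟨out, t, h, hout⟩ := gjkw17_handlesFirst (k := k) (by omega)
  have h₁ := hC _ _ (exampleLTS k) (exampleLTS_states_card k).ge
    (by rw [exampleLTS_states_card, exampleLTS_trans_card]; omega) _ _ h
  have h₂ := lower_mul_log hk2 (factorial_le_of_handlesFirst (by omega) h hout)
  have h₃ : 12 * |C| + 1 ≤ Real.log k := by
    rw [Real.le_log_iff_exp_le (by linarith)]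
    exact (Nat.le_ceil _).trans (by exact_mod_cast le_max_right _ _)
  rw [exampleLTS_states_card, exampleLTS_trans_card] at h₁
  push_cast at h₁
  have h₄ := Real.log_two_lt_d9
  have h₅ := Real.log_two_gt_d9
  have h₆ : C * ((2 * k + 2) * Real.log 2) ≤ |C| * (3 * k) := by
    refine mul_le_mul (le_abs_self C) ?_ (by positivity) (abs_nonneg C)
    nlinarith
  nlinarith [mul_le_mul_of_nonneg_left h₃ (show (0 : ℝ) ≤ k by linarith)]

end GJKW17

/-! ### The parts of JGKW19 -/

section Harmless

variable {S A : Type} {G : LTS S A}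

/-- A splitter whose block is not split. -/
def Harmless (G : LTS S A) (P : Finset (Finset S)) (p : Splitter S A) : Prop :=
  ∃ B ∈ P, (∀ e ∈ p.slice, e.1 ∈ B) ∧ p.slice.Nonempty ∧ p.marked ⊆ p.slice ∧
    (∀ s ∈ G.bottom B, ∃ e ∈ p.marked, e.1 = s) ∧ p.marked.card ≤ 2

theorem Splitter.restrict_eq {p : Splitter S A} {X : Finset S} (h : ∀ e ∈ p.slice, e.1 ∈ X)
    (hm : p.marked ⊆ p.slice) : p.restrict X = p := by
  cases p
  simp only [Splitter.restrict, Splitter.mk.injEq, Finset.filter_eq_self, and_true]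
  exact ⟨h, fun e he => h e (hm he)⟩

/-- Restricting a slice to its own block changes nothing, and the empty restriction is filtered out.
-/
theorem splitSplitters_eq {P : Finset (Finset S)}
    (hd : ∀ B ∈ P, ∀ B' ∈ P, ∀ s, s ∈ B → s ∈ B' → B = B') {B : Finset S} (hB : B ∈ P) (o : Bool)
    {L : List (Splitter S A)} (hL : ∀ p ∈ L, Harmless G P p) : splitSplitters B ∅ o L = L := by
  have key : ∀ p ∈ L, (if ∃ e ∈ p.slice, e.1 ∈ B ∪ ∅ then
      (if o then [p.restrict B, p.restrict ∅] else [p.restrict ∅, p.restrict B]).filter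
        fun q => q.slice ≠ ∅ else [p]) = [p] := by
    intro p hp
    obtain ⟨B', hB', hs, hne, hm, -⟩ := hL p hp
    split_ifs with h ho
    · obtain ⟨e, he, heB⟩ := h
      rw [Finset.union_empty] at heB
      obtain rfl := hd B hB B' hB' e.1 heB (hs e he)
      rw [Splitter.restrict_eq hs hm]
      simp [Splitter.restrict, hne.ne_empty]
    · obtain ⟨e, he, heB⟩ := h
      rw [Finset.union_empty] at heB
      obtain rfl := hd B hB B' hB' e.1 heB (hs e he)
      rw [Splitter.restrict_eq hs hm]
      simp [Splitter.restrict, hne.ne_empty]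
    · rfl
  unfold splitSplitters
  clear hL
  induction L with
  | nil => rfl
  | cons p L ih =>
    rw [List.flatMap_cons, key p (by simp), ih fun q hq => key q (by simp [hq])]
    rfl

/-- Handling splitters that split no block. -/
theorem total_stabilize_of_harmless {P : Finset (Finset S)} {Q : Finset (Finset (Tr S A))}
    (hd : ∀ B ∈ P, ∀ B' ∈ P, ∀ s, s ∈ B → s ∈ B' → B = B') (h₀ : ∀ B ∈ P, B.Nonempty)
    (Y : Finset (Tr S A)) {L : List (Splitter S A)} (hL : ∀ p ∈ L, Harmless G P p) :
    Total (G.stabilize Y ⟨P, Q, L⟩) (1 + L.length * 6) fun J _ => J = ⟨P, Q, []⟩ := by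
  refine Total.loop (Q := fun J : JState S A => J = ⟨P, Q, []⟩)
    (fun J : JState S A => J.blocks = P ∧ J.bunches = Q ∧ ∀ p ∈ J.splitters, Harmless G P p)
    (fun J => 1 + J.splitters.length * 6) ?_ ⟨P, Q, L⟩ ⟨rfl, rfl, hL⟩
  rintro ⟨P', Q', L⟩ ⟨rfl, rfl, hL⟩
  cases L with
  | nil => exact ⟨0, by simp, Total.pure rfl⟩
  | cons p L =>
    have hL' : ∀ q ∈ L, Harmless G P' q := fun q hq => hL q (by simp [hq])
    obtain ⟨B, hB, hs, hne, hm, hbot, hc⟩ := hL p (by simp)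
    refine ⟨5 + 0, by simp only [List.length_cons]; omega, ?_⟩
    refine Total.pick_bind ⟨B, hB, ?_⟩ ?_
    · obtain ⟨e, he⟩ := hne
      exact ⟨e, he, hs e he⟩
    · rintro B' ⟨hB', e, he, heB⟩
      obtain rfl := hd B hB B' hB' e.1 (hs e he) heB
      refine Total.weaken (Total.bind (G.total_splitBlock_of_bottom hbot) ?_)
        (Nat.add_le_add_right (show p.marked.card + 3 ≤ 5 by omega) 0)
      rintro _ c rfl
      refine Total.pick_bind ⟨true, trivial⟩ fun o _ => ?_
      -- With `U` empty, a primary splitter would remove only an empty slice, and the list contains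
      -- none.
      have hfilter : (L.filter fun q => q.slice ≠ Y.filter fun e => e.1 ∈ (∅ : Finset S)) = L := by
        rw [List.filter_eq_self]
        intro q hq
        obtain ⟨_, _, _, hne, _⟩ := hL' q hq
        simp [hne.ne_empty]
      simp only [LTS.tauT_empty_right, ne_eq, not_true_eq_false, if_false,
        splitSplitters_eq hd hB o hL', replaceBlock_self hB (h₀ _ hB)]
      simp only [ne_eq] at hfilter
      rw [hfilter, ite_self]
      refine Total.pure ⟨⟨rfl, rfl, hL'⟩, ?_⟩
      simp only [List.length_cons]
      omega

end Harmless

/-! ### JGKW19 on the family of examples -/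

/-- The LTS `A_k`, with arbitrary names of states and actions. -/
structure IsExampleLTS {S A : Type} (k : ℕ) (G : LTS S A) (s₀ s₁ : S) (a : Fin (k + 1) → A) :
    Prop where
  ne : s₀ ≠ s₁
  inj : Function.Injective a
  ne_tau : ∀ i, a i ≠ G.tau
  mem_states : ∀ s, s ∈ G.states ↔ s = s₀ ∨ s = s₁
  mem_trans : ∀ e, e ∈ G.trans ↔ e = (s₁, G.tau, s₀) ∨ e = (s₁, a 0, s₁) ∨
    (∃ j : Fin k, e = (s₁, a j.succ, s₀)) ∨ ∃ j : Fin k, e = (s₀, a j.succ, s₀)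

/-- The bunches are disjoint nonempty sets of transitions, and equally labelled transitions are in
the same bunch. -/
structure BunchInvariant {S A : Type} (G : LTS S A) (Q : Finset (Finset (Tr S A))) : Prop where
  subset : ∀ T ∈ Q, T ⊆ G.trans
  nonempty : ∀ T ∈ Q, T.Nonempty
  saturated : ∀ T ∈ Q, ∀ e ∈ T, ∀ f ∈ G.trans, f.2.1 = e.2.1 → f ∈ T
  disjoint : ∀ T ∈ Q, ∀ T' ∈ Q, ∀ e, e ∈ T → e ∈ T' → T = T'

/-! ### Operations on bunches -/

namespace BunchInvariant

variable {S A : Type} {G : LTS S A} {Q : Finset (Finset (Tr S A))}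

theorem split (hQ : BunchInvariant G Q) {T : Finset (Tr S A)} (hT : T ∈ Q) (α : A)
    (hX : (T.filter fun f => f.2.1 = α).Nonempty)
    (hY : (T \ T.filter fun f => f.2.1 = α).Nonempty) :
    BunchInvariant G (insert (T.filter fun f => f.2.1 = α)
      (insert (T \ T.filter fun f => f.2.1 = α) (Q.erase T))) := by
  have hmem : ∀ Z ∈ insert (T.filter fun f => f.2.1 = α)
      (insert (T \ T.filter fun f => f.2.1 = α) (Q.erase T)),
      Z = (T.filter fun f => f.2.1 = α) ∨ Z = (T \ T.filter fun f => f.2.1 = α) ∨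
        (Z ≠ T ∧ Z ∈ Q) := by
    intro Z hZ
    simpa only [Finset.mem_insert, Finset.mem_erase] using hZ
  refine ⟨?_, ?_, ?_, ?_⟩
  · intro Z hZ
    rcases hmem Z hZ with rfl | rfl | ⟨-, h⟩
    · exact (Finset.filter_subset _ _).trans (hQ.subset T hT)
    · exact Finset.sdiff_subset.trans (hQ.subset T hT)
    · exact hQ.subset Z h
  · intro Z hZ
    rcases hmem Z hZ with rfl | rfl | ⟨-, h⟩
    · exact hX
    · exact hY
    · exact hQ.nonempty Z h
  · intro Z hZ e he f hf hfe
    rcases hmem Z hZ with rfl | rfl | ⟨-, h⟩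
    · rw [Finset.mem_filter] at he ⊢
      exact ⟨hQ.saturated T hT e he.1 f hf hfe, hfe.trans he.2⟩
    · rw [Finset.mem_sdiff, Finset.mem_filter] at he ⊢
      refine ⟨hQ.saturated T hT e he.1 f hf hfe, fun h => he.2 ⟨he.1, hfe.symm.trans h.2⟩⟩
    · exact hQ.saturated Z h e he f hf hfe
  · intro Z hZ Z' hZ' e he he'
    rcases hmem Z hZ with rfl | rfl | ⟨hne, h⟩ <;> rcases hmem Z' hZ' with rfl | rfl | ⟨hne', h'⟩
    · rfl
    · exact absurd he (Finset.mem_sdiff.1 he').2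
    · exact absurd (hQ.disjoint Z' h' T hT e he' (Finset.mem_filter.1 he).1) hne'
    · exact absurd he' (Finset.mem_sdiff.1 he).2
    · rfl
    · exact absurd (hQ.disjoint Z' h' T hT e he' (Finset.mem_sdiff.1 he).1) hne'
    · exact absurd (hQ.disjoint Z h T hT e he (Finset.mem_filter.1 he').1) hne
    · exact absurd (hQ.disjoint Z h T hT e he (Finset.mem_sdiff.1 he').1) hne
    · exact hQ.disjoint Z h Z' h' e he he'

/-- The growth by one is what the potential counts; disjointness and nonemptiness prevent the two
new bunches from coinciding with each other or with an old one. -/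
theorem card_split (hQ : BunchInvariant G Q) {T : Finset (Tr S A)} (hT : T ∈ Q) (α : A)
    (hX : (T.filter fun f => f.2.1 = α).Nonempty)
    (hY : (T \ T.filter fun f => f.2.1 = α).Nonempty) :
    (insert (T.filter fun f => f.2.1 = α)
      (insert (T \ T.filter fun f => f.2.1 = α) (Q.erase T))).card = Q.card + 1 := by
  have h₁ : (T \ T.filter fun f => f.2.1 = α) ∉ Q.erase T := by
    intro h
    obtain ⟨hne, h⟩ := Finset.mem_erase.1 h
    obtain ⟨e, he⟩ := hY
    exact hne (hQ.disjoint _ h T hT e he (Finset.mem_sdiff.1 he).1)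
  have h₂ : (T.filter fun f => f.2.1 = α) ∉
      insert (T \ T.filter fun f => f.2.1 = α) (Q.erase T) := by
    intro h
    obtain ⟨e, he⟩ := hX
    rcases Finset.mem_insert.1 h with h | h
    · rw [h] at he
      have := (Finset.mem_sdiff.1 he).2
      rw [h] at this
      exact this he
    · obtain ⟨hne, h⟩ := Finset.mem_erase.1 h
      exact hne (hQ.disjoint _ h T hT e he (Finset.mem_filter.1 he).1)
  rw [Finset.card_insert_of_notMem h₂, Finset.card_insert_of_notMem h₁,
    Finset.card_erase_of_mem hT]
  have := Finset.card_pos.2 ⟨T, hT⟩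
  omega

theorem insert (hQ : BunchInvariant G Q) {T : Finset (Tr S A)} (hT : T ⊆ G.trans) (hne : T.Nonempty)
    (hs : ∀ e ∈ T, ∀ f ∈ G.trans, f.2.1 = e.2.1 → f ∈ T) (hd : ∀ T' ∈ Q, ∀ e ∈ T', e ∉ T) :
    BunchInvariant G (insert T Q) := by
  refine ⟨?_, ?_, ?_, ?_⟩
  · intro Z hZ
    rcases Finset.mem_insert.1 hZ with rfl | h
    · exact hT
    · exact hQ.subset Z h
  · intro Z hZ
    rcases Finset.mem_insert.1 hZ with rfl | h
    · exact hne
    · exact hQ.nonempty Z h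
  · intro Z hZ
    rcases Finset.mem_insert.1 hZ with rfl | h
    · exact hs
    · exact hQ.saturated Z h
  · intro Z hZ Z' hZ' e he he'
    rcases Finset.mem_insert.1 hZ with rfl | h <;> rcases Finset.mem_insert.1 hZ' with rfl | h'
    · rfl
    · exact absurd he (hd Z' h' e he')
    · exact absurd he' (hd Z h e he)
    · exact hQ.disjoint Z h Z' h' e he he'

end BunchInvariant

/-! ### Transitions and action-block-slices of `A_k` -/

namespace IsExampleLTS

variable {S A : Type} {k : ℕ} {G : LTS S A} {s₀ s₁ : S} {a : Fin (k + 1) → A}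

theorem loopless (hG : IsExampleLTS k G s₀ s₁ a) (s : S) : (s, G.tau, s) ∉ G.trans := by
  rw [hG.mem_trans]
  rintro (h | h | ⟨j, h⟩ | ⟨j, h⟩) <;> simp only [Prod.mk.injEq] at h
  · exact hG.ne (h.2.2.symm.trans h.1)
  · exact hG.ne_tau _ h.2.1.symm
  · exact hG.ne_tau _ h.2.1.symm
  · exact hG.ne_tau _ h.2.1.symm

theorem source_mem (hG : IsExampleLTS k G s₀ s₁ a)
    {e : Tr S A} (he : e ∈ G.trans) : e.1 = s₀ ∨ e.1 = s₁ := by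
  rcases (hG.mem_trans e).1 he with rfl | rfl | ⟨j, rfl⟩ | ⟨j, rfl⟩ <;> simp

theorem target_mem (hG : IsExampleLTS k G s₀ s₁ a)
    {e : Tr S A} (he : e ∈ G.trans) : e.2.2 = s₀ ∨ e.2.2 = s₁ := by
  rcases (hG.mem_trans e).1 he with rfl | rfl | ⟨j, rfl⟩ | ⟨j, rfl⟩ <;> simp

theorem eq_zero_of_action (hG : IsExampleLTS k G s₀ s₁ a)
    {e : Tr S A} (he : e ∈ G.trans) (h : e.2.1 = a 0) :
    e = (s₁, a 0, s₁) := by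
  rcases (hG.mem_trans e).1 he with rfl | h' | ⟨j, rfl⟩ | ⟨j, rfl⟩
  · exact absurd h.symm (hG.ne_tau 0)
  · exact h'
  · exact absurd (hG.inj h) (Fin.succ_ne_zero j)
  · exact absurd (hG.inj h) (Fin.succ_ne_zero j)

theorem eq_tau_of_action (hG : IsExampleLTS k G s₀ s₁ a)
    {e : Tr S A} (he : e ∈ G.trans) (h : e.2.1 = G.tau) :
    e = (s₁, G.tau, s₀) := by
  rcases (hG.mem_trans e).1 he with h' | rfl | ⟨j, rfl⟩ | ⟨j, rfl⟩
  · exact h'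
  · exact absurd h (hG.ne_tau 0)
  · exact absurd h (hG.ne_tau _)
  · exact absurd h (hG.ne_tau _)

/-- Because the label determines the target, slices depend on the label only and not on the current
partition; this makes them small and few. -/
theorem target_eq_of_action (hG : IsExampleLTS k G s₀ s₁ a)
    {e f : Tr S A} (he : e ∈ G.trans) (hf : f ∈ G.trans)
    (h : f.2.1 = e.2.1) : f.2.2 = e.2.2 := by
  by_cases h₀ : e.2.1 = a 0
  · rw [hG.eq_zero_of_action he h₀, hG.eq_zero_of_action hf (h.trans h₀)]
  · have key : ∀ e ∈ G.trans, e.2.1 ≠ a 0 → e.2.2 = s₀ := by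
      intro e he h
      rcases (hG.mem_trans e).1 he with rfl | rfl | ⟨j, rfl⟩ | ⟨j, rfl⟩
      · rfl
      · exact absurd rfl h
      · rfl
      · rfl
    rw [key e he h₀, key f hf (h ▸ h₀)]

theorem mem_tau (hG : IsExampleLTS k G s₀ s₁ a)
    : (s₁, G.tau, s₀) ∈ G.trans := (hG.mem_trans _).2 (Or.inl rfl)

theorem mem_fst (hG : IsExampleLTS k G s₀ s₁ a) (j : Fin k) : (s₁, a j.succ, s₀) ∈ G.trans :=
  (hG.mem_trans _).2 (Or.inr (Or.inr (Or.inl ⟨j, rfl⟩)))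

theorem mem_snd (hG : IsExampleLTS k G s₀ s₁ a) (j : Fin k) : (s₀, a j.succ, s₀) ∈ G.trans :=
  (hG.mem_trans _).2 (Or.inr (Or.inr (Or.inr ⟨j, rfl⟩)))

theorem inert_pair (hG : IsExampleLTS k G s₀ s₁ a) : G.inert {s₀, s₁} = {(s₁, G.tau, s₀)} := by
  ext e
  simp only [LTS.inert, LTS.mem_tauT, Finset.mem_singleton]
  constructor
  · rintro ⟨h, h', -⟩
    exact hG.eq_tau_of_action h h'
  · rintro rfl
    exact ⟨hG.mem_tau, rfl, by simp, by simp⟩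

theorem bottom_pair (hG : IsExampleLTS k G s₀ s₁ a) : G.bottom {s₀, s₁} = {s₀} := by
  ext s
  simp only [LTS.mem_bottom, hG.inert_pair, Finset.mem_insert, Finset.mem_singleton]
  constructor
  · rintro ⟨h | h, h'⟩
    · exact h
    · exact absurd h.symm (h' _ rfl)
  · rintro rfl
    exact ⟨Or.inl rfl, by rintro _ rfl; exact hG.ne.symm⟩

theorem bottom_single (hG : IsExampleLTS k G s₀ s₁ a)
    (s : S) : G.bottom {s} = {s} := G.bottom_singleton (hG.loopless s)

theorem tauT_single (hG : IsExampleLTS k G s₀ s₁ a) : G.tauT {s₁} {s₀} = {(s₁, G.tau, s₀)} := by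
  ext e
  simp only [LTS.mem_tauT, Finset.mem_singleton]
  constructor
  · rintro ⟨h, h', -⟩
    exact hG.eq_tau_of_action h h'
  · rintro rfl
    exact ⟨hG.mem_tau, rfl, rfl, rfl⟩

theorem card_slice_le (hG : IsExampleLTS k G s₀ s₁ a)
    {T : Finset (Tr S A)} (hT : T ⊆ G.trans) {e : Tr S A} (he : e ∈ T) :
    (T.filter fun f => f.2.1 = e.2.1).card ≤ 2 := by
  have h : (T.filter fun f => f.2.1 = e.2.1) ⊆ {(s₀, e.2.1, e.2.2), (s₁, e.2.1, e.2.2)} := by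
    intro f hf
    obtain ⟨hf, hfe⟩ := Finset.mem_filter.1 hf
    have h₁ := hG.target_eq_of_action (hT he) (hT hf) hfe
    rw [← hfe, ← h₁, Finset.mem_insert, Finset.mem_singleton]
    rcases hG.source_mem (hT hf) with h | h
    · exact Or.inl (by rw [← h])
    · exact Or.inr (by rw [← h])
  exact (Finset.card_le_card h).trans Finset.card_le_two

/-- A label occurs in at most one bunch, and there are k + 2 labels including `τ`. -/
theorem bunches_card_le (hG : IsExampleLTS k G s₀ s₁ a)
    {Q : Finset (Finset (Tr S A))} (hQ : BunchInvariant G Q) :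
    Q.card ≤ k + 2 := by
  have h : Q.card ≤ (insert G.tau (Finset.univ.image a)).card := by
    refine Finset.card_le_card_of_forall_subsingleton (fun T b => ∃ e ∈ T, e.2.1 = b) ?_ ?_
    · intro T hT
      obtain ⟨e, he⟩ := hQ.nonempty T hT
      refine ⟨e.2.1, ?_, e, he, rfl⟩
      rcases (hG.mem_trans e).1 (hQ.subset T hT he) with rfl | rfl | ⟨j, rfl⟩ | ⟨j, rfl⟩ <;> simp
    · rintro b - T ⟨hT, e, he, rfl⟩ T' ⟨hT', e', he', h⟩
      exact hQ.disjoint T hT T' hT' e' (hQ.saturated T hT e he e' (hQ.subset T' hT' he') h) he'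
  refine h.trans ((Finset.card_insert_le _ _).trans ?_)
  have : (Finset.univ.image a).card ≤ k + 1 := Finset.card_image_le.trans (by simp)
  omega

/-- The action-block-slices of a bunch, for a partition that covers all states. -/
theorem mem_actionBlockSlices (hG : IsExampleLTS k G s₀ s₁ a)
    {P : Finset (Finset S)} {T X : Finset (Tr S A)} (hT : T ⊆ G.trans)
    (hP : ∀ s, s = s₀ ∨ s = s₁ → ∃ B ∈ P, s ∈ B) :
    X ∈ actionBlockSlices P T ↔ ∃ e ∈ T, (T.filter fun f => f.2.1 = e.2.1) = X := by
  have key : ∀ e ∈ T, (T.filter fun f => f.2.1 = e.2.1 ∧ ∃ B ∈ P, f.2.2 ∈ B ∧ e.2.2 ∈ B) =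
      T.filter fun f => f.2.1 = e.2.1 := by
    intro e he
    refine Finset.filter_congr fun f hf => ⟨fun h => h.1, fun h => ⟨h, ?_⟩⟩
    obtain ⟨B, hB, hs⟩ := hP _ (hG.target_mem (hT he))
    refine ⟨B, hB, ?_, hs⟩
    rw [hG.target_eq_of_action (hT he) (hT hf) h]
    exact hs
  simp only [actionBlockSlices, Finset.mem_image]
  exact exists_congr fun e => and_congr_right fun he => by rw [key e he]

end IsExampleLTS

/-! #### Iterations of the main loop of JGKW19 -/

/-- The part of an iteration of the main loop after the choice of the bunch `T` and the slice
`X`. -/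
def LTS.iterationJ {S A : Type} (G : LTS S A) (J : JState S A) (T X : Finset (Tr S A)) :
    Alg (JState S A ⊕ Finset (Finset S)) := do
  tick X.card
  let Y := T \ X
  let splittable := J.blocks.filter fun B => (∃ e ∈ X, e.1 ∈ B) ∧ ∃ e ∈ Y, e.1 ∈ B
  let J₁ ← forEach splittable
    (fun B (J : JState S A) => do
      let XB := X.filter fun e => e.1 ∈ B
      let YB := Y.filter fun e => e.1 ∈ B
      let M ← pick {M | IsMarking (XB.image fun e => e.1) YB M}
      tick (XB.card + M.card)
      pure { J with splitters := J.splitters ++ [⟨XB, XB, True⟩, ⟨YB, M, False⟩] })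
    { J with bunches := insert X (insert Y (J.bunches.erase T)) }
  let J₂ ← G.stabilize Y J₁
  pure (.inl J₂)

/-- An iteration in which no block is split. -/
theorem LTS.total_iterationJ_of_bottom {S A : Type} {G : LTS S A} {P : Finset (Finset S)}
    {Q : Finset (Finset (Tr S A))} {T X : Finset (Tr S A)}
    (hd : ∀ B ∈ P, ∀ B' ∈ P, ∀ s, s ∈ B → s ∈ B' → B = B') (h₀ : ∀ B ∈ P, B.Nonempty)
    (hP : P.card ≤ 2) (hX : X.card ≤ 2)
    (h : ∀ B ∈ P, (∃ e ∈ X, e.1 ∈ B) → (∃ e ∈ T \ X, e.1 ∈ B) → ∀ s ∈ G.bottom B,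
      (∃ e ∈ X, e.1 = s) ∧ ∃ e ∈ T \ X, e.1 = s) :
    Total (G.iterationJ ⟨P, Q, []⟩ T X) 37 fun r _ =>
      r = .inl ⟨P, insert X (insert (T \ X) (Q.erase T)), []⟩ := by
  set Q' := insert X (insert (T \ X) (Q.erase T)) with hQ'
  -- At most two blocks contribute two splitters each, marked by at most two transitions; handling
  -- each of the four entries takes at most 6 steps.
  refine Total.weaken (Total.tick_bind (n' := 2 * (1 + 4) + (1 + 4 * 6 + 0)) ?_)
    (show X.card + (2 * (1 + 4) + (1 + 4 * 6 + 0)) ≤ 37 by omega)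
  have hcard : (P.filter fun B => (∃ e ∈ X, e.1 ∈ B) ∧ ∃ e ∈ T \ X, e.1 ∈ B).card ≤ 2 :=
    (Finset.card_filter_le _ _).trans hP
  refine Total.bind (Total.weaken (total_forEach (b := 4)
    (fun D J _ => J.blocks = P ∧ J.bunches = Q' ∧ J.splitters.length = 2 * D.card ∧
      ∀ p ∈ J.splitters, Harmless G P p) _ ⟨rfl, rfl, rfl, by simp⟩ ?_)
    (Nat.mul_le_mul_right (1 + 4) hcard)) ?_
  · rintro B hB D ⟨P', Q'', L⟩ c hBD ⟨hP', hQ'', hl, hL⟩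
    obtain ⟨hB, hXB, hYB⟩ := Finset.mem_filter.1 hB
    have hs := h B hB hXB hYB
    refine Total.pick_bind (exists_isMarking _ _) fun M hM => ?_
    have hM : IsMarking _ _ M := hM
    have hx : (X.filter fun e => e.1 ∈ B).card ≤ 2 := (Finset.card_filter_le _ _).trans hX
    have hMc : M.card ≤ 2 := hM.card_le.trans (Finset.card_image_le.trans hx)
    refine Total.weaken (Total.tick_bind (n' := 0) (Total.pure ⟨hP', hQ'', ?_, ?_⟩))
      (show (X.filter fun e => e.1 ∈ B).card + M.card + 0 ≤ 4 by omega)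
    · rw [Finset.card_insert_of_notMem hBD, List.length_append, hl]
      simp only [List.length_cons, List.length_nil]
      omega
    · intro p hp
      rcases List.mem_append.1 hp with hp | hp
      · exact hL p hp
      · have hX' : ∀ s ∈ G.bottom B, ∃ e ∈ X.filter (fun e => e.1 ∈ B), e.1 = s := by
          intro s hsB
          obtain ⟨e, he, rfl⟩ := (hs s hsB).1
          exact ⟨e, Finset.mem_filter.2 ⟨he, (G.mem_bottom.1 hsB).1⟩, rfl⟩
        have hne : ∀ Z : Finset (Tr S A), (∃ e ∈ Z, e.1 ∈ B) →
            (Z.filter fun e => e.1 ∈ B).Nonempty := fun Z ⟨e, he, heB⟩ =>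
          ⟨e, Finset.mem_filter.2 ⟨he, heB⟩⟩
        simp only [List.mem_cons, List.not_mem_nil, or_false] at hp
        rcases hp with rfl | rfl
        · exact ⟨B, hB, fun e he => (Finset.mem_filter.1 he).2, hne X hXB, subset_rfl, hX', hx⟩
        · refine ⟨B, hB, fun e he => (Finset.mem_filter.1 he).2, hne _ hYB, hM.1, ?_, hMc⟩
          intro s hsB
          obtain ⟨e, he, rfl⟩ := hX' s hsB
          obtain ⟨f, hf, hfe⟩ := (hs _ hsB).2
          exact hM.exists_mem (Finset.mem_image_of_mem _ he)
            ⟨f, Finset.mem_filter.2 ⟨hf, hfe ▸ (G.mem_bottom.1 hsB).1⟩, hfe⟩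
  · rintro ⟨P', Q'', L⟩ c ⟨rfl, rfl, hl, hL⟩
    have hl : L.length = 2 * _ := hl
    refine Total.bind (Total.weaken (total_stabilize_of_harmless hd h₀ (T \ X) hL)
      (show 1 + L.length * 6 ≤ 1 + 4 * 6 by rw [hl]; dsimp only at hcard ⊢; omega)) ?_
    rintro _ c' rfl
    exact Total.pure rfl

namespace IsExampleLTS

variable {S A : Type} {k : ℕ} {G : LTS S A} {s₀ s₁ : S} {a : Fin (k + 1) → A}

/-- Treatment of the new bottom state `s₁`. -/
theorem total_newBottomJ (hG : IsExampleLTS k G s₀ s₁ a)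
    {P : Finset (Finset S)} {Q : Finset (Finset (Tr S A))}
    {L : List (Splitter S A)} (hd : ∀ B ∈ P, ∀ B' ∈ P, ∀ s, s ∈ B → s ∈ B' → B = B')
    (h₁ : {s₁} ∈ P)
    (hL : ∀ p ∈ L, (∀ e ∈ p.slice, e.1 = s₁) ∧ p.marked.Nonempty ∧ p.marked ⊆ p.slice ∧
      p.marked.card ≤ 1) :
    Total (G.newBottomJ {s₁} {s₀} ⟨P, Q, L⟩) (1 + (4 + (Q.card + 1 + G.trans.card)))
      fun J _ => J.blocks = P ∧ J.bunches = insert {(s₁, G.tau, s₀)} Q ∧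
        J.splitters.length ≤ L.length + (Q.card + 1) ∧ ∀ p ∈ J.splitters, Harmless G P p := by
  have hharm : ∀ p : Splitter S A, (∀ e ∈ p.slice, e.1 = s₁) → p.marked.Nonempty →
      p.marked ⊆ p.slice → p.marked.card ≤ 2 → Harmless G P p := by
    intro p hs hne hm hc
    refine ⟨{s₁}, h₁, fun e he => by simp [hs e he], hne.mono hm, hm, ?_, hc⟩
    rw [hG.bottom_single]
    intro s hs'
    obtain rfl := Finset.mem_singleton.1 hs'
    obtain ⟨e, he⟩ := hne
    exact ⟨e, he, hs e (hm he)⟩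
  have hL' : ∀ p ∈ L, Harmless G P p := fun p hp =>
    hharm p (hL p hp).1 (hL p hp).2.1 (hL p hp).2.2.1 ((hL p hp).2.2.2.trans one_le_two)
  unfold LTS.newBottomJ
  simp only [hG.tauT_single, Finset.card_singleton]
  refine Total.tick_bind (Total.bind (Total.weaken (G.total_splitBlock_of_bottom ?_)
    (le_of_eq (by simp))) ?_)
  · rw [hG.bottom_single]
    intro s hs
    exact ⟨_, Finset.mem_singleton_self _, (Finset.mem_singleton.1 hs).symm⟩
  rintro _ c rfl
  refine Total.pick_bind ⟨true, trivial⟩ fun o _ => ?_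
  simp only [LTS.tauT_empty_right, Finset.union_empty, splitSplitters_eq hd h₁ o hL',
    replaceBlock_self h₁ (Finset.singleton_nonempty s₁)]
  set Q' := insert {(s₁, G.tau, s₀)} Q
  have hc₁ : (blockBunchSlices Q' {s₁}).card ≤ Q.card + 1 :=
    (Finset.card_erase_le.trans Finset.card_image_le).trans (Finset.card_insert_le _ _)
  have hc₂ := G.outT_card_le (G.bottom {s₁})
  refine Total.weaken (Total.tick_bind (n' := 0) ?_)
    ((Nat.add_zero _).le.trans (Nat.add_le_add hc₁ hc₂))
  refine Total.pick_bind ?_ fun mk hmk => ?_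
  · choose mk hmk using exists_isMarking (A := A) (G.bottom {s₁})
    exact ⟨mk, fun X _ => hmk X⟩
  have hmk : ∀ X ∈ blockBunchSlices Q' {s₁}, IsMarking (G.bottom {s₁}) X (mk X) := hmk
  refine Total.pick_bind ⟨_, Finset.coe_toList _⟩ fun l hl => ?_
  have hl : (l : Multiset (Finset (Tr S A))) = Finset.val _ := hl
  have hmem : ∀ X ∈ l, X ∈ blockBunchSlices Q' {s₁} := by
    intro X hX
    rw [← Multiset.mem_coe, hl, Finset.mem_val] at hX
    exact (Finset.mem_filter.1 hX).1
  have hlen : l.length ≤ Q.card + 1 := by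
    rw [← Multiset.coe_card, hl]
    exact (Finset.card_filter_le _ _).trans hc₁
  have hslice : ∀ X ∈ blockBunchSlices Q' {s₁}, (∀ e ∈ X, e.1 = s₁) ∧ (mk X).Nonempty ∧
      mk X ⊆ X ∧ (mk X).card ≤ 1 := by
    intro X hX
    have hm := hmk X hX
    obtain ⟨hne, hX⟩ := Finset.mem_erase.1 hX
    obtain ⟨Z, -, rfl⟩ := Finset.mem_image.1 hX
    have hs : ∀ e ∈ Z.filter (fun e => e.1 ∈ ({s₁} : Finset S)), e.1 = s₁ :=
      fun e he => Finset.mem_singleton.1 (Finset.mem_filter.1 he).2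
    refine ⟨hs, ?_, hm.1, ?_⟩
    · obtain ⟨e, he⟩ := Finset.nonempty_of_ne_empty hne
      obtain ⟨f, hf, -⟩ := hm.exists_mem (s := s₁) (by rw [hG.bottom_single]; simp) ⟨e, he, hs e he⟩
      exact ⟨f, hf⟩
    · have := hm.card_le
      rwa [hG.bottom_single, Finset.card_singleton] at this
  refine Total.pure ⟨rfl, rfl, ?_, ?_⟩
  · rw [List.length_append, List.length_map, List.length_map]
    omega
  · intro p hp
    rcases List.mem_append.1 hp with hp | hp
    · obtain ⟨q, hq, rfl⟩ := List.mem_map.1 hp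
      split_ifs with hq'
      · obtain ⟨hs, hne, hm, hc⟩ := hL q hq
        obtain ⟨-, -, hm', hc'⟩ := hslice _ hq'
        -- An entry that was already in the list keeps its marked transition and may gain another
        -- one, whence the bound 2 in `Harmless`.
        exact hharm _ hs (hne.mono Finset.subset_union_left) (Finset.union_subset hm hm')
          ((Finset.card_union_le _ _).trans (Nat.add_le_add hc hc'))
      · exact hL' q hq
    · obtain ⟨X, hX, rfl⟩ := List.mem_map.1 hp
      obtain ⟨hs, hne, hm, hc⟩ := hslice X (hmem X hX)
      exact hharm _ hs hne hm (hc.trans one_le_two)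

theorem replaceBlock_pair : replaceBlock {{s₀, s₁}} {s₀, s₁} {s₁} {s₀} = {{s₁}, {s₀}} := by
  ext B
  simp only [replaceBlock, Finset.mem_union, Finset.mem_erase, Finset.mem_insert,
    Finset.mem_singleton]
  constructor
  · rintro (⟨h, h'⟩ | ⟨-, h⟩)
    · exact absurd h' h
    · exact h
  · rintro (rfl | rfl) <;> simp

theorem eq_of_mem_singletons : ∀ B ∈ ({{s₁}, {s₀}} : Finset (Finset S)),
    ∀ B' ∈ ({{s₁}, {s₀}} : Finset (Finset S)), ∀ s, s ∈ B → s ∈ B' → B = B' := by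
  intro B hB B' hB' s hs hs'
  simp only [Finset.mem_insert, Finset.mem_singleton] at hB hB'
  rcases hB with rfl | rfl <;> rcases hB' with rfl | rfl <;>
    simp_all

theorem nonempty_of_mem_singletons : ∀ B ∈ ({{s₁}, {s₀}} : Finset (Finset S)), B.Nonempty := by
  intro B hB
  simp only [Finset.mem_insert, Finset.mem_singleton] at hB
  rcases hB with rfl | rfl <;> simp

/-- Stabilisation under `s₁ →a₀ s₁` and the rest `Y` of its bunch. -/
theorem total_stabilize_pair (hG : IsExampleLTS k G s₀ s₁ a)
    {Q : Finset (Finset (Tr S A))} {Y M : Finset (Tr S A)}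
    (hM : M ⊆ Y) (hM₁ : ∀ e ∈ M, e.1 = s₁) (hne : M.Nonempty)
    (hc : M.card ≤ 1) :
    Total (G.stabilize Y ⟨{{s₀, s₁}}, Q, [⟨{(s₁, a 0, s₁)}, {(s₁, a 0, s₁)}, True⟩,
      ⟨Y, M, False⟩]⟩) (35 + 3 * G.trans.card + 7 * (Q.card + 1))
      fun J _ => J = ⟨{{s₁}, {s₀}}, insert {(s₁, G.tau, s₀)} Q, []⟩ := by
  have hn : 35 + 3 * G.trans.card + 7 * (Q.card + 1) =
      1 + (9 + 2 * G.trans.card + (1 + (4 + (Q.card + 1 + G.trans.card)))) +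
        (1 + (2 + (Q.card + 1)) * 6) + 7 := by ring
  refine Total.weaken (Total.loop_step (n := 9 + 2 * G.trans.card +
    (1 + (4 + (Q.card + 1 + G.trans.card)) + 0)) (n' := 1 + (2 + (Q.card + 1)) * 6)
    (Q' := fun r _ => ∃ J, r = Sum.inl (β := JState S A) J ∧ J.blocks = {{s₁}, {s₀}} ∧
      J.bunches = insert {(s₁, G.tau, s₀)} Q ∧ J.splitters.length ≤ 2 + (Q.card + 1) ∧
        ∀ p ∈ J.splitters, Harmless G {{s₁}, {s₀}} p) ?_ ?_ ?_)
    (by omega)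
  · refine Total.pick_bind ⟨{s₀, s₁}, by simp⟩ ?_
    rintro B ⟨hB, -⟩
    obtain rfl := Finset.mem_singleton.1 hB
    refine Total.bind (G.total_splitBlock_pair hG.ne hG.inert_pair rfl) ?_
    rintro _ c rfl
    refine Total.pick_bind ⟨true, trivial⟩ fun o _ => ?_
    simp only [if_true, hG.tauT_single, ne_eq, Finset.singleton_ne_empty, not_false_eq_true,
      replaceBlock_pair]
    have hY₁ : ∃ e ∈ Y, e.1 ∈ ({s₁} ∪ {s₀} : Finset S) := by
      obtain ⟨e, he⟩ := hne
      exact ⟨e, hM he, by simp [hM₁ e he]⟩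
    have hMr : (M.filter fun e => e.1 ∈ ({s₁} : Finset S)) = M := by
      rw [Finset.filter_eq_self]
      intro e he
      simp [hM₁ e he]
    -- The first splitter is primary, so the slice of `Y` from {s₀} is dropped. This matters: all
    -- marked transitions start in s₁, and that slice would have none.
    set L := (splitSplitters {s₁} {s₀} o [⟨Y, M, False⟩]).filter
      fun q => ¬ q.slice = Y.filter fun e => e.1 ∈ ({s₀} : Finset S) with hL
    have hlen : L.length ≤ 2 := by
      refine (List.length_filter_le _ _).trans ?_
      simp only [splitSplitters, List.flatMap_cons, List.flatMap_nil, if_pos hY₁, List.append_nil]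
      refine (List.length_filter_le _ _).trans ?_
      split_ifs <;> simp
    have hmem : ∀ p ∈ L, p = ⟨Y.filter fun e => e.1 ∈ ({s₁} : Finset S), M, False⟩ := by
      intro p hp
      rw [hL, List.mem_filter] at hp
      obtain ⟨hp, hne⟩ := hp
      simp only [splitSplitters, List.flatMap_cons, List.flatMap_nil, if_pos hY₁,
        List.append_nil, List.mem_filter] at hp
      have hp' : p = Splitter.restrict ⟨Y, M, False⟩ {s₁} ∨
          p = Splitter.restrict ⟨Y, M, False⟩ {s₀} := by
        have := hp.1
        split_ifs at this <;> simp only [List.mem_cons, List.not_mem_nil, or_false] at this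
        · exact this
        · exact this.symm
      rcases hp' with rfl | rfl
      · simp only [Splitter.restrict, hMr]
      · simp [Splitter.restrict] at hne
    refine Total.bind (hG.total_newBottomJ eq_of_mem_singletons (by simp) ?_) ?_
    · intro p hp
      rw [hmem p hp]
      refine ⟨fun e he => Finset.mem_singleton.1 (Finset.mem_filter.1 he).2, hne, ?_, hc⟩
      intro e he
      exact Finset.mem_filter.2 ⟨hM he, by simp [hM₁ e he]⟩
    · rintro J c ⟨h₁, h₂, h₃, h₄⟩
      exact Total.pure ⟨J, rfl, h₁, h₂, h₃.trans (Nat.add_le_add_right hlen _), h₄⟩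
  · rintro _ c ⟨⟨P, Q', L⟩, h, h₁, h₂, h₃, h₄⟩
    obtain rfl := Sum.inl.inj h
    obtain rfl : P = _ := h₁
    obtain rfl : Q' = _ := h₂
    exact Total.weaken (total_stabilize_of_harmless eq_of_mem_singletons
      nonempty_of_mem_singletons Y h₄) (Nat.add_le_add_left (Nat.mul_le_mul_right 6 h₃) 1)
  · rintro b c ⟨J, h, -⟩
    cases h

/-- The iteration in which the block `{s₀, s₁}` is split. -/
theorem total_iterationJ_pair (hG : IsExampleLTS k G s₀ s₁ a)
    {Q : Finset (Finset (Tr S A))} {T : Finset (Tr S A)}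
    (hT : T ⊆ G.trans) (h : ∃ e ∈ T, e ≠ (s₁, a 0, s₁) ∧ e.1 = s₁) :
    Total (G.iterationJ ⟨{{s₀, s₁}}, Q, []⟩ T {(s₁, a 0, s₁)})
      (40 + 3 * G.trans.card + 7 * ((insert {(s₁, a 0, s₁)}
        (insert (T \ {(s₁, a 0, s₁)}) (Q.erase T))).card + 1)) fun r _ =>
      r = .inl ⟨{{s₁}, {s₀}}, insert {(s₁, G.tau, s₀)} (insert {(s₁, a 0, s₁)}
        (insert (T \ {(s₁, a 0, s₁)}) (Q.erase T))), []⟩ := by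
  set Y := T \ {(s₁, a 0, s₁)} with hY
  set Q' := insert {(s₁, a 0, s₁)} (insert Y (Q.erase T)) with hQ'
  have hYT : Y ⊆ G.trans := Finset.sdiff_subset.trans hT
  have hYV : (Y.filter fun e => e.1 ∈ ({s₀, s₁} : Finset S)) = Y := by
    rw [Finset.filter_eq_self]
    intro e he
    rcases hG.source_mem (hYT he) with h | h <;> simp [h]
  have hXV : (({(s₁, a 0, s₁)} : Finset (Tr S A)).filter
      fun e => e.1 ∈ ({s₀, s₁} : Finset S)) = {(s₁, a 0, s₁)} := by
    rw [Finset.filter_eq_self]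
    simp
  obtain ⟨e, heT, hne, he₁⟩ := h
  have heY : e ∈ Y := Finset.mem_sdiff.2 ⟨heT, by simpa using hne⟩
  have hsp : (({{s₀, s₁}} : Finset (Finset S)).filter fun B =>
      (∃ e ∈ ({(s₁, a 0, s₁)} : Finset (Tr S A)), e.1 ∈ B) ∧ ∃ e ∈ Y, e.1 ∈ B) =
      {{s₀, s₁}} := by
    rw [Finset.filter_singleton, if_pos]
    exact ⟨⟨_, Finset.mem_singleton_self _, by simp⟩, e, heY, by simp [he₁]⟩
  refine Total.weaken (Total.tick_bind (n' := 1 * (1 + 2) +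
    (35 + 3 * G.trans.card + 7 * (Q'.card + 1) + 0)) ?_)
    (by rw [Finset.card_singleton]; omega)
  dsimp only
  rw [← hY, hsp]
  refine Total.bind (total_forEach (b := 2)
    (fun D J _ => ({s₀, s₁} ∉ D ∧ J = ⟨{{s₀, s₁}}, Q', []⟩) ∨ {s₀, s₁} ∈ D ∧ ∃ M,
      M ⊆ Y ∧ (∀ e ∈ M, e.1 = s₁) ∧ M.Nonempty ∧ M.card ≤ 1 ∧
      J = ⟨{{s₀, s₁}}, Q', [⟨{(s₁, a 0, s₁)}, {(s₁, a 0, s₁)}, True⟩, ⟨Y, M, False⟩]⟩)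
    _ (Or.inl ⟨by simp, rfl⟩) ?_) ?_
  · rintro B hB D J c hBD (⟨-, rfl⟩ | ⟨h, -⟩)
    · obtain rfl := Finset.mem_singleton.1 hB
      simp only [hYV, hXV, Finset.image_singleton, Finset.card_singleton]
      refine Total.pick_bind (exists_isMarking _ _) fun M hM => ?_
      have hM : IsMarking _ _ M := hM
      have hMc : M.card ≤ 1 := hM.card_le
      refine Total.weaken (Total.tick_bind (n' := 0) (Total.pure (Or.inr
        ⟨Finset.mem_insert_self _ _, M, hM.1, ?_, ?_, hMc, rfl⟩)))
        (show 1 + M.card + 0 ≤ 2 by omega)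
      · exact fun f hf => Finset.mem_singleton.1 (hM.2.1 f hf)
      · obtain ⟨f, hf, -⟩ := hM.exists_mem (Finset.mem_singleton_self _) ⟨e, heY, he₁⟩
        exact ⟨f, hf⟩
    · obtain rfl := Finset.mem_singleton.1 hB
      exact absurd h hBD
  · rintro J c (⟨h, -⟩ | ⟨-, M, h₁, h₂, h₃, h₄, rfl⟩)
    · exact absurd (Finset.mem_singleton_self _) h
    · refine Total.bind (hG.total_stabilize_pair h₁ h₂ h₃ h₄) ?_
      rintro _ c rfl
      exact Total.pure rfl

end IsExampleLTS

/-- The invariant of the main loop of JGKW19. -/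
structure JInvariant {S A : Type} {k : ℕ} (G : LTS S A) (s₀ s₁ : S) (a : Fin (k + 1) → A)
    (J : JState S A) : Prop where
  splitters : J.splitters = []
  bunches : BunchInvariant G J.bunches
  blocks : J.blocks = {{s₁}, {s₀}} ∨ J.blocks = {{s₀, s₁}} ∧ ∀ T ∈ J.bunches,
    (s₁, G.tau, s₀) ∉ T ∧ ((s₁, a 0, s₁) ∈ T → ∃ j : Fin k, (s₁, a j.succ, s₀) ∈ T)

/-- The potential that pays for the iterations of the main loop of JGKW19. -/
def potentialJ {S A : Type} (k : ℕ) (G : LTS S A) (s₁ : S) (J : JState S A) : ℕ :=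
  1 + 38 * (k + 2 - J.bunches.card) +
    if {s₁} ∈ J.blocks then 0 else 40 + 3 * G.trans.card + 7 * (k + 2)

/-! ### The main loop of JGKW19 -/

namespace IsExampleLTS

variable {S A : Type} {k : ℕ} {G : LTS S A} {s₀ s₁ : S} {a : Fin (k + 1) → A}

theorem exists_small_slice (hG : IsExampleLTS k G s₀ s₁ a)
    {P : Finset (Finset S)} {T : Finset (Tr S A)} (hT : T ⊆ G.trans)
    (hP : ∀ s, s = s₀ ∨ s = s₁ → ∃ B ∈ P, s ∈ B) (h : 1 < (actionBlockSlices P T).card) :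
    ∃ X ∈ actionBlockSlices P T, 2 * X.card ≤ T.card := by
  obtain ⟨X, hX, X', hX', hne⟩ := Finset.one_lt_card.1 h
  obtain ⟨e, -, he⟩ := (hG.mem_actionBlockSlices hT hP).1 hX
  obtain ⟨e', -, he'⟩ := (hG.mem_actionBlockSlices hT hP).1 hX'
  have hd : Disjoint X X' := by
    rw [Finset.disjoint_left]
    rintro f hf hf'
    rw [← he, Finset.mem_filter] at hf
    rw [← he', Finset.mem_filter] at hf'
    exact hne (by rw [← he, ← he', ← hf.2, ← hf'.2])
  have hc : X.card + X'.card ≤ T.card := by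
    rw [← Finset.card_union_of_disjoint hd, ← he, ← he']
    exact Finset.card_le_card (Finset.union_subset (Finset.filter_subset _ _)
      (Finset.filter_subset _ _))
  rcases le_total X.card X'.card with h | h
  · exact ⟨X, hX, by omega⟩
  · exact ⟨X', hX', by omega⟩

/-- A splittable block consists of one bottom state, which has transitions in both parts of the
bunch. -/
theorem total_iterationJ_singletons (hG : IsExampleLTS k G s₀ s₁ a)
    {Q : Finset (Finset (Tr S A))} {T X : Finset (Tr S A)}
    (hX : X.card ≤ 2) :
    Total (G.iterationJ ⟨{{s₁}, {s₀}}, Q, []⟩ T X) 37 fun r _ =>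
      r = .inl ⟨{{s₁}, {s₀}}, insert X (insert (T \ X) (Q.erase T)), []⟩ := by
  refine LTS.total_iterationJ_of_bottom eq_of_mem_singletons nonempty_of_mem_singletons
    Finset.card_le_two hX ?_
  rintro B hB ⟨e, he, heB⟩ ⟨f, hf, hfB⟩ s hs
  obtain ⟨t, rfl⟩ : ∃ t, B = {t} := by
    simp only [Finset.mem_insert, Finset.mem_singleton] at hB
    rcases hB with rfl | rfl
    exacts [⟨_, rfl⟩, ⟨_, rfl⟩]
  rw [hG.bottom_single] at hs
  rw [Finset.mem_singleton] at hs heB hfB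
  exact ⟨⟨e, he, heB.trans hs.symm⟩, f, hf, hfB.trans hs.symm⟩

theorem exists_succ_of_action (hG : IsExampleLTS k G s₀ s₁ a)
    {e : Tr S A} (he : e ∈ G.trans) (h₀ : e.2.1 ≠ a 0)
    (hτ : e.2.1 ≠ G.tau) : ∃ j : Fin k, e.2.1 = a j.succ := by
  rcases (hG.mem_trans e).1 he with rfl | rfl | ⟨j, rfl⟩ | ⟨j, rfl⟩
  · exact absurd rfl hτ
  · exact absurd rfl h₀
  · exact ⟨j, rfl⟩
  · exact ⟨j, rfl⟩

/-- If the slice of an action other than `a₀` is small, then the rest of the bunch contains another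
such slice. -/
theorem exists_succ_in_rest (hG : IsExampleLTS k G s₀ s₁ a) {T : Finset (Tr S A)} (hT : T ⊆ G.trans)
    (hs : ∀ e ∈ T, ∀ f ∈ G.trans, f.2.1 = e.2.1 → f ∈ T) (hτ : (s₁, G.tau, s₀) ∉ T) {j : Fin k}
    {e : Tr S A} (he : e ∈ T) (hj : e.2.1 = a j.succ)
    (hc : 2 * (T.filter fun f => f.2.1 = e.2.1).card ≤ T.card) :
    ∃ i : Fin k, ∀ s, s = s₀ ∨ s = s₁ →
      (s, a i.succ, s₀) ∈ T \ T.filter fun f => f.2.1 = e.2.1 := by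
  have hτ' : ∀ f ∈ T, f.2.1 ≠ G.tau := fun f hf h => hτ (hG.eq_tau_of_action (hT hf) h ▸ hf)
  have hmem : ∀ i : Fin k, ∀ s, s = s₀ ∨ s = s₁ → (s, a i.succ, s₀) ∈ G.trans := by
    rintro i s (rfl | rfl)
    exacts [hG.mem_snd i, hG.mem_fst i]
  by_cases h : ∃ f ∈ T \ T.filter (fun f => f.2.1 = e.2.1), f.2.1 ≠ a 0
  · obtain ⟨f, hf, hf₀⟩ := h
    obtain ⟨hfT, hfe⟩ := Finset.mem_sdiff.1 hf
    obtain ⟨i, hi⟩ := hG.exists_succ_of_action (hT hfT) hf₀ (hτ' f hfT)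
    refine ⟨i, fun s hs' => Finset.mem_sdiff.2 ⟨hs f hfT _ (hmem i s hs') hi.symm, fun h => ?_⟩⟩
    exact hfe (Finset.mem_filter.2 ⟨hfT, hi.trans (Finset.mem_filter.1 h).2⟩)
  · push Not at h
    -- If the rest contained only a₀-transitions, it would have at most one element; but the slice
    -- has two and is at most half of the bunch.
    have h₁ : (T \ T.filter fun f => f.2.1 = e.2.1).card ≤ 1 := by
      rw [← Finset.card_singleton (s₁, a 0, s₁)]
      refine Finset.card_le_card fun f hf => Finset.mem_singleton.2 ?_
      exact hG.eq_zero_of_action (hT (Finset.mem_sdiff.1 hf).1) (h f hf)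
    have h₂ : 2 ≤ (T.filter fun f => f.2.1 = e.2.1).card := by
      rw [← Finset.card_pair (a := (s₀, a j.succ, s₀)) (b := (s₁, a j.succ, s₀))
        fun h => hG.ne (congrArg Prod.fst h)]
      refine Finset.card_le_card ?_
      intro f hf
      simp only [Finset.mem_insert, Finset.mem_singleton] at hf
      rcases hf with rfl | rfl
      · exact Finset.mem_filter.2 ⟨hs e he _ (hG.mem_snd j) hj.symm, hj.symm⟩
      · exact Finset.mem_filter.2 ⟨hs e he _ (hG.mem_fst j) hj.symm, hj.symm⟩
    have h₃ := Finset.card_sdiff_add_card_eq_card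
      (Finset.filter_subset (fun f : Tr S A => f.2.1 = e.2.1) T)
    omega

theorem bottom_subset_pair (hG : IsExampleLTS k G s₀ s₁ a) {T : Finset (Tr S A)} {j : Fin k}
    (h : (s₀, a j.succ, s₀) ∈ T) : ∀ s ∈ G.bottom {s₀, s₁}, ∃ e ∈ T, e.1 = s := by
  rw [hG.bottom_pair]
  intro s hs
  exact ⟨_, h, (Finset.mem_singleton.1 hs).symm⟩

/-- One iteration of the main loop of JGKW19. -/
theorem total_iterationJ (hG : IsExampleLTS k G s₀ s₁ a)
    {J : JState S A} (hJ : JInvariant G s₀ s₁ a J) {T X : Finset (Tr S A)}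
    (hT : T ∈ J.bunches) {e : Tr S A} (he : e ∈ T) (hX : (T.filter fun f => f.2.1 = e.2.1) = X)
    (hc : 2 * X.card ≤ T.card) :
    ∃ n, 1 + n ≤ potentialJ k G s₁ J ∧ Total (G.iterationJ J T X) n fun r _ =>
      match r with
      | .inl J' => JInvariant G s₀ s₁ a J' ∧ 1 + n + potentialJ k G s₁ J' ≤ potentialJ k G s₁ J
      | .inr _ => True := by
  obtain ⟨P, Q, L⟩ := J
  obtain ⟨hL, hQ, hP⟩ := hJ
  obtain rfl : L = [] := hL
  simp only at hT hQ hP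
  have hTt := hQ.subset T hT
  have hX₂ : X.card ≤ 2 := hX ▸ hG.card_slice_le hTt he
  have heX : e ∈ X := hX ▸ Finset.mem_filter.2 ⟨he, rfl⟩
  have hXne : X.Nonempty := ⟨e, heX⟩
  have hXT : X ⊆ T := hX ▸ Finset.filter_subset _ _
  have hYne : (T \ X).Nonempty := by
    rw [← Finset.card_pos]
    have := Finset.card_sdiff_add_card_eq_card hXT
    have := hXne.card_pos
    omega
  have hQ' : BunchInvariant G (insert X (insert (T \ X) (Q.erase T))) := by
    subst hX
    exact hQ.split hT _ hXne hYne
  have hcard : (insert X (insert (T \ X) (Q.erase T))).card = Q.card + 1 := by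
    subst hX
    exact hQ.card_split hT _ hXne hYne
  have hle := hG.bunches_card_le hQ'
  rcases hP with rfl | ⟨rfl, hP⟩
  · refine ⟨37, ?_, (hG.total_iterationJ_singletons hX₂).mono le_rfl ?_⟩
    · simp only [potentialJ]
      omega
    · rintro _ c - rfl
      refine ⟨⟨rfl, hQ', Or.inl rfl⟩, ?_⟩
      simp only [potentialJ, hcard]
      omega
  · obtain ⟨hτ, hstab⟩ := hP T hT
    have hs₁ : ({s₁} : Finset S) ∉ ({{s₀, s₁}} : Finset (Finset S)) := by
      rw [Finset.mem_singleton]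
      intro h
      have : s₀ ∈ ({s₁} : Finset S) := h ▸ Finset.mem_insert_self _ _
      exact hG.ne (Finset.mem_singleton.1 this)
    by_cases h₀ : e.2.1 = a 0
    · obtain rfl := hG.eq_zero_of_action (hTt he) h₀
      obtain rfl : X = {(s₁, a 0, s₁)} := by
        refine Finset.eq_singleton_iff_unique_mem.2 ⟨heX, fun f hf => ?_⟩
        rw [← hX] at hf
        obtain ⟨hf, hf'⟩ := Finset.mem_filter.1 hf
        exact hG.eq_zero_of_action (hTt hf) hf'
      obtain ⟨j, hj⟩ := hstab he
      -- Splitting off a₀ separates s₁ from s₀, and the inert transition becomes a bunch of its own,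
      -- so this iteration adds two bunches.
      have hQ'' : BunchInvariant G (insert {(s₁, G.tau, s₀)} (insert {(s₁, a 0, s₁)}
          (insert (T \ {(s₁, a 0, s₁)}) (Q.erase T)))) := by
        refine hQ'.insert (by simpa using hG.mem_tau) (by simp) ?_ ?_
        · intro f hf g hg hgf
          obtain rfl := Finset.mem_singleton.1 hf
          exact Finset.mem_singleton.2 (hG.eq_tau_of_action hg hgf)
        · intro T' hT' f hf hfτ
          obtain rfl := Finset.mem_singleton.1 hfτ
          simp only [Finset.mem_insert, Finset.mem_erase] at hT'
          rcases hT' with rfl | rfl | ⟨-, hT'⟩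
          · simp only [Finset.mem_singleton, Prod.mk.injEq] at hf
            exact hG.ne hf.2.2
          · exact hτ (Finset.mem_sdiff.1 hf).1
          · exact (hP T' hT').1 hf
      have hcard' : (insert {(s₁, G.tau, s₀)} (insert {(s₁, a 0, s₁)}
          (insert (T \ {(s₁, a 0, s₁)}) (Q.erase T)))).card = Q.card + 2 := by
        rw [Finset.card_insert_of_notMem, hcard]
        intro h
        simp only [Finset.mem_insert, Finset.mem_erase, Finset.singleton_inj, Prod.mk.injEq] at h
        rcases h with h | h | ⟨-, h⟩
        · exact hG.ne h.2.2
        · have : (s₁, G.tau, s₀) ∈ T \ {(s₁, a 0, s₁)} := h ▸ Finset.mem_singleton_self _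
          exact hτ (Finset.mem_sdiff.1 this).1
        · exact (hP _ h).1 (Finset.mem_singleton_self _)
      have hle' := hG.bunches_card_le hQ''
      rw [hcard'] at hle'
      refine ⟨_, ?_, (hG.total_iterationJ_pair hTt ⟨_, hj, ?_, rfl⟩).mono le_rfl ?_⟩
      · simp only [potentialJ, hs₁, if_false, hcard]
        omega
      · intro h
        exact Fin.succ_ne_zero j (hG.inj (congrArg (fun f => f.2.1) h))
      · rintro _ c - rfl
        refine ⟨⟨rfl, hQ'', Or.inl rfl⟩, ?_⟩
        simp only [potentialJ, hs₁, if_false, hcard, hcard',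
          Finset.mem_insert_self, if_true]
        omega
    · obtain ⟨j, hj⟩ := hG.exists_succ_of_action (hTt he) h₀
        fun h => hτ (hG.eq_tau_of_action (hTt he) h ▸ he)
      -- The bottom state s₀ has transitions both in the slice and in the rest, so the pair stays
      -- whole; the corresponding transition of s₁ in the rest restores the invariant for a₀.
      obtain ⟨i, hi⟩ := hG.exists_succ_in_rest hTt (hQ.saturated T hT) hτ he hj (hX ▸ hc)
      rw [hX] at hi
      have hjX : (s₀, a j.succ, s₀) ∈ X := by
        rw [← hX]
        exact Finset.mem_filter.2 ⟨hQ.saturated T hT e he _ (hG.mem_snd j) hj.symm, hj.symm⟩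
      refine ⟨37, ?_, (LTS.total_iterationJ_of_bottom ?_ ?_ ?_ hX₂ ?_).mono le_rfl ?_⟩
      · simp only [potentialJ]
        omega
      · intro B hB B' hB' _ _ _
        rw [Finset.mem_singleton.1 hB, Finset.mem_singleton.1 hB']
      · intro B hB
        rw [Finset.mem_singleton.1 hB]
        exact Finset.insert_nonempty _ _
      · simp
      · intro B hB _ _ s hs
        obtain rfl := Finset.mem_singleton.1 hB
        exact ⟨hG.bottom_subset_pair hjX s hs, hG.bottom_subset_pair (hi s₀ (Or.inl rfl)) s hs⟩
      · rintro _ c - rfl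
        refine ⟨⟨rfl, hQ', Or.inr ⟨rfl, ?_⟩⟩, ?_⟩
        · intro T' hT'
          simp only [Finset.mem_insert, Finset.mem_erase] at hT'
          rcases hT' with rfl | rfl | ⟨-, hT'⟩
          · refine ⟨fun h => hτ (hXT h), fun h => ?_⟩
            rw [← hX] at h
            exact absurd (Finset.mem_filter.1 h).2.symm h₀
          · exact ⟨fun h => hτ (Finset.mem_sdiff.1 h).1, fun _ => ⟨i, hi s₁ (Or.inr rfl)⟩⟩
          · exact hP T' hT'
        · simp only [potentialJ, hcard]
          omega

theorem total_refineJ (hG : IsExampleLTS k G s₀ s₁ a)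
    {J : JState S A} (hJ : JInvariant G s₀ s₁ a J) :
    Total (G.refineJ J) (potentialJ k G s₁ J) fun _ _ => True := by
  refine total_loop (Q := fun _ => True) (JInvariant G s₀ s₁ a) (potentialJ k G s₁) ?_ J hJ
  intro J hJ
  have hpos : 1 ≤ potentialJ k G s₁ J := by
    simp only [potentialJ]
    omega
  have hP : ∀ s, s = s₀ ∨ s = s₁ → ∃ B ∈ J.blocks, s ∈ B := by
    rcases hJ.blocks with h | ⟨h, -⟩ <;> rw [h] <;> rintro s (rfl | rfl) <;> simp
  refine ⟨potentialJ k G s₁ J - 1, by omega, ?_⟩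
  by_cases h : ∃ T ∈ J.bunches, 1 < (actionBlockSlices J.blocks T).card
  · rw [if_pos h]
    refine Total.pick_bind h ?_
    rintro T ⟨hT, hslices⟩
    have hTt := hJ.bunches.subset T hT
    refine Total.pick_bind (hG.exists_small_slice hTt hP hslices) ?_
    rintro X ⟨hX, hc⟩
    obtain ⟨e, he, hX⟩ := (hG.mem_actionBlockSlices hTt hP).1 hX
    obtain ⟨n, hn, ht⟩ := hG.total_iterationJ hJ hT he hX hc
    refine Total.mono ht (by omega) ?_
    rintro (J' | b) c hcn hQ
    · exact ⟨hQ.1, le_trans (by omega) hQ.2⟩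
    · trivial
  · rw [if_neg h]
    exact Total.pure trivial

theorem states_eq (hG : IsExampleLTS k G s₀ s₁ a) : G.states = {s₀, s₁} := by
  ext s
  rw [hG.mem_states, Finset.mem_insert, Finset.mem_singleton]

theorem contract_eq (hG : IsExampleLTS k G s₀ s₁ a) : (G.contract fun _ _ => True) = G := by
  refine LTS.contract_eq _ ?_ hG.loopless
  have key : ∀ s t, Relation.ReflTransGen (fun u v => True ∧ (u, G.tau, v) ∈ G.trans) s t →
      s = t ∨ s = s₁ ∧ t = s₀ := by
    intro s t h
    induction h with
    | refl => exact Or.inl rfl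
    | tail _ h ih =>
      have h' := hG.eq_tau_of_action h.2 rfl
      simp only [Prod.mk.injEq, true_and] at h'
      obtain ⟨rfl, rfl⟩ := h'
      rcases ih with rfl | ⟨-, h⟩
      · exact Or.inr ⟨rfl, rfl⟩
      · exact absurd h.symm hG.ne
  rintro s t ⟨h, h'⟩
  rcases key s t h with h | ⟨rfl, rfl⟩
  · exact h
  · rcases key _ _ h' with h | ⟨h, -⟩
    · exact h.symm
    · exact absurd h hG.ne

theorem total_jgkw19 (hG : IsExampleLTS k G s₀ s₁ a) (hk : 1 ≤ k) :
    Total G.jgkw19 (97 + 45 * k + 6 * G.trans.card) fun _ _ => True := by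
  have hv : ∀ s, s = s₀ ∨ s = s₁ → (s, a (Fin.succ ⟨0, hk⟩), s₀) ∈ G.visible := by
    rintro s (rfl | rfl)
    · exact G.mem_visible.2 ⟨hG.mem_snd _, hG.ne_tau _⟩
    · exact G.mem_visible.2 ⟨hG.mem_fst _, hG.ne_tau _⟩
  have hr : G.reachers {s₀, s₁} G.visible = {s₀, s₁} := by
    refine G.reachers_eq fun s hs => ⟨_, hv s ?_, rfl⟩
    simpa using hs
  have hcard : G.states.card = 2 := by
    rw [hG.states_eq, Finset.card_pair hG.ne]
  have hb : (({{s₀, s₁}, ∅} : Finset (Finset S)).erase ∅) = {{s₀, s₁}} := by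
    ext B
    simp only [Finset.mem_erase, Finset.mem_insert, Finset.mem_singleton]
    constructor
    · rintro ⟨h, h' | h'⟩
      · exact h'
      · exact absurd h' h
    · rintro rfl
      exact ⟨by simp, Or.inl rfl⟩
  have hq : (({G.visible} : Finset (Finset (Tr S A))).erase ∅) = {G.visible} := by
    rw [Finset.erase_eq_of_notMem]
    rw [Finset.mem_singleton]
    exact fun h => Finset.notMem_empty _ (h ▸ hv s₀ (Or.inl rfl))
  have hJ : JInvariant G s₀ s₁ a ⟨{{s₀, s₁}}, {G.visible}, []⟩ := by
    refine ⟨rfl, ⟨?_, ?_, ?_, ?_⟩, Or.inr ⟨rfl, ?_⟩⟩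
    · intro T hT
      rw [Finset.mem_singleton.1 hT]
      exact Finset.filter_subset _ _
    · intro T hT
      rw [Finset.mem_singleton.1 hT]
      exact ⟨_, hv s₀ (Or.inl rfl)⟩
    · intro T hT e he f hf hfe
      rw [Finset.mem_singleton.1 hT] at he ⊢
      exact G.mem_visible.2 ⟨hf, hfe ▸ (G.mem_visible.1 he).2⟩
    · intro T hT T' hT' _ _ _
      rw [Finset.mem_singleton.1 hT, Finset.mem_singleton.1 hT']
    · intro T hT
      rw [Finset.mem_singleton.1 hT]
      exact ⟨fun h => (G.mem_visible.1 h).2 rfl, fun _ => ⟨⟨0, hk⟩, hv s₁ (Or.inr rfl)⟩⟩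
  have ht := hG.total_refineJ hJ
  have hpot : potentialJ k G s₁ ⟨{{s₀, s₁}}, {G.visible}, []⟩ ≤
      93 + 45 * k + 3 * G.trans.card := by
    have : (({G.visible} : Finset (Finset (Tr S A)))).card = 1 := Finset.card_singleton _
    simp only [potentialJ, this]
    split_ifs <;> omega
  unfold LTS.jgkw19
  simp only [hG.contract_eq, hG.states_eq, hr, sdiff_self, Finset.bot_eq_empty,
    LTS.tauT_empty_right, Finset.union_empty, hb, hq, Finset.card_pair hG.ne]
  refine Total.weaken (Total.tick_bind (Total.tick_bind (Total.tick_bind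
    (Total.weaken ht hpot)))) (by omega)

end IsExampleLTS

theorem isExampleLTS_exampleLTS (k : ℕ) :
    IsExampleLTS k (exampleLTS k) 0 1 fun i => some i where
  ne := by simp
  inj := Option.some_injective _
  ne_tau := fun i => Option.some_ne_none i
  mem_states := fun s => ⟨fun _ => by fin_cases s <;> simp, fun _ => Finset.mem_univ s⟩
  mem_trans := fun _ => mem_exampleLTS_trans

theorem total_jgkw19_exampleLTS {k : ℕ} (hk : 1 ≤ k) :
    Total (exampleLTS k).jgkw19 (60 * (exampleLTS k).trans.card) fun _ _ => True := by
  refine ((isExampleLTS_exampleLTS k).total_jgkw19 hk).weaken ?_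
  rw [exampleLTS_trans_card]
  omega

end

theorem mainTheorem3 :
    (∀ k : ℕ, (exampleLTS k).states.card = 2 ∧ (exampleLTS k).trans.card = 2 * k + 2 ∧
      Fintype.card (Option (Fin (k + 1))) = k + 2) ∧
    (∃ c C : ℝ, 0 < c ∧ 0 < C ∧ ∀ k : ℕ, 2 ≤ k →
      (∀ r t, (exampleLTS k).gjkw17 r t → (t : ℝ) ≤ C * (k * Real.log k)) ∧
      (∃ out t, (exampleLTS k).gjkw17 (some out) t ∧ HandlesFirst k out.2) ∧
      (∀ out t, (exampleLTS k).gjkw17 (some out) t → HandlesFirst k out.2 →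
        c * (k * Real.log k) ≤ t ∧
        c * ((exampleLTS k).trans.card *
          (Real.log (Fintype.card (Option (Fin (k + 1)))) +
            Real.log (exampleLTS k).states.card)) ≤ t)) ∧
    (¬ ∃ C : ℝ, ∀ (S A : Type) [Fintype A] (G : LTS S A),
      2 ≤ G.states.card → G.states.card ≤ G.trans.card + 1 →
      ∀ r t, G.gjkw17 r t → (t : ℝ) ≤ C * (G.trans.card * Real.log G.states.card)) ∧
    (∃ C : ℝ, 0 < C ∧ ∀ k : ℕ, 1 ≤ k →
      (∃ out t, (exampleLTS k).jgkw19 (some out) t) ∧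
      ∀ r t, (exampleLTS k).jgkw19 r t → (t : ℝ) ≤ C * (exampleLTS k).trans.card) := by
  -- The factor 1/36 is 1/4 from k log k ≤ 4t times 1/9 from the comparison of m(log |Act| + log n)
  -- with k log k.
  refine ⟨fun k => ⟨exampleLTS_states_card k, exampleLTS_trans_card k, by simp⟩,
    ⟨1 / 36, 2000, by norm_num, by norm_num, fun k hk => ⟨fun r t h => ?_,
      gjkw17_handlesFirst (one_le_two.trans hk), fun out t h hout => ?_⟩⟩,
    gjkw17_not_linearithmic, 60, by norm_num, fun k hk => ?_⟩
  · exact (Nat.cast_le.2 (gjkw17_le (one_le_two.trans hk) h)).trans (upper_le_mul_log hk)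
  · have h₁ := lower_mul_log hk (factorial_le_of_handlesFirst (one_le_two.trans hk) h hout)
    have h₂ := size_mul_log_le hk
    have ht : (0 : ℝ) ≤ t := Nat.cast_nonneg t
    constructor
    · linarith
    · linarith
  · have ht := total_jgkw19_exampleLTS hk
    refine ⟨ht.2.2, fun r t h => ?_⟩
    exact_mod_cast ht.le h
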